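/- **Definitions.** A group $G$ is boolean if each of its elements is its own inverse; its dimension is its dimension over $\mathbb F_2$. A *quaternionic structure* $S=(G,-1,q)$ consists of a boolean group $G$, an element $-1\in G$ (possibly $-1=1$; write $-a:=(-1)a$) and a surjection $q:G\times G\to Q$ onto a set $Q$ (of "quaternions") with a distinguished element $0$, such that for all $a,b,c,d\in G$: $q(a,-a)=0$; $q(a,b)=q(b,a)$; $q(a,b)=q(a,c)\iff q(a,bc)=0$; and $q(a,b)=q(c,d)\iff\exists x\in G:\ q(a,b)=q(a,x)=q(c,x)=q(c,d)$. Its *order* is $\dim G$. An isomorphism $S\to S'$ is a group isomorphism $\phi$ with $\phi(-1)=-1'$ and $q(a,b)=0\iff q'(\phi(a),\phi(b))=0'$. $S$ is *degenerate* if there is $a\ne 1$ with $q(a,x)=0$ for all $x\in G$. The *value group* of $a\in G$ is $V(a)=\{b\in G: q(a,b)=0\}$. $S$ is *$k$-rigid* if $\dim V(a)=k$ for some $a\in G$, and *strictly $k$-rigid* if $k$ is the smallest number for which it is $k$-rigid. The *direct product* $S_1\times S_2$ is formed componentwise on $G_1\times G_2$ with quaternions $Q_1\times Q_2$. The *group extension*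 $S\Delta$ is the structure on $G\times\{1,x\}$, with $\{1,x\}$ cyclic of order $2$ and with the same $-1$, given by $$q_x(ax^\alpha,bx^\beta)=\big(q(a,b),\,(-1)^{\alpha\beta}a^\beta b^\alpha\big)\in Q\times G\quad(a,b\in G,\ \alpha,\beta\in\{0,1\}),$$ with zero quaternion $(0,1)$ and with the values of $q_x$ as its quaternions. $S$ is *indecomposable* if it has order at least $1$ and is not isomorphic to a direct product of two structures of order at least $1$. A *local type structure* is a finite nondegenerate quaternionic structure of order at least $3$ with exactly two quaternions. A structure is of *elementary type* if, up to isomorphism, it can be obtained by direct products and group extensions from local type structures, the structure $\mathbb L_0$ of order $0$, and the three structures of order $1$: those with $q=0$ and $-1=1$, respectively $-1\neq1$, and the one with $G=\{1,-1\}$, $-1\ne 1$ and $q(-1,-1)\neq 0$. For $n,k\in\mathbb N_0$ let $e(n)$, $e'(n)$, $e_{\mathrm d}(n)$, $e_\Delta(n)$ be the numbers of isomorphism types of elementary type structures of order $n$ that are, respectively: arbitrary; with $-1=1$; degenerate; isomorphic to a group extension of some quaternionic structure. Let $e_k(n)$ be the number of isomorphism types of nondegenerate strictly $k$-rigid elementary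 type structures of order $n$, and $\overline e_k(n)$ the number of those that are indecomposable. Let $P_{k,n}$ be the set of matrices $(m_{i,j})_{0\le i\le k,\,1\le j\le n}$ over $\mathbb N_0$ with $\sum_{i,j} i\,m_{i,j}=k$ and $\sum_{i,j} j\,m_{i,j}=n$. Binomial coefficients $\binom{r+m-1}{m}$ count multisets of size $m$ from $r$ elements (so for $r=0$ the value is $1$ if $m=0$, and $0$ otherwise). **Lemma.** Let $k,n\in\mathbb N_0$. All the numbers above are finite, and the following hold. (a) $e_{\mathrm d}(n)=e(n-1)+e'(n-1)-e'(n-2)$ for $n\ge2$. (b) $e_\Delta(n)=e(n-1)$ for $n>2$. (c) $e_0(0)=e_0(1)=e_0(2)=1=\overline e_0(1)$, $\overline e_0(0)=\overline e_0(2)=0$ and $e_1(2)=\overline e_1(2)=2$. If $k\ge n$ and $(k,n)\ne(0,0)$, then $e_k(n)=0$. (d) If $n>2$ and $k\ge 2$, then (i) $\overline e_0(n)=e_0(n-1)$ and $e_0(n)=\sum_{m\in P_{0,n}}\prod_{j=1}^n\binom{\overline e_0(j)+m_{0,j}-1}{m_{0,j}}$; (ii) $\overline e_1(n)=e_\Delta(n)-\overline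 e_0(n)$ and $e_1(n)=\sum_{j=2}^n\overline e_1(j)\,e_0(n-j)$; (iii) $\overline e_k(n)=2$ if $k+1=n$ is even, $\overline e_k(n)=1$ if $k+1=n$ is odd, and $\overline e_k(n)=0$ otherwise; (iv) $e_k(n)=\sum_{m\in P_{k,n}}\prod_{0\le i\le k,\ 1\le j\le n}\binom{\overline e_i(j)+m_{i,j}-1}{m_{i,j}}$. -/

import Mathlib

/-! ### Boolean groups and their dimension -/

/-- The dimension over `𝔽₂` of a boolean group (one in which every element is its own inverse). -/
noncomputable def boolDim (G : Type) [CommGroup G] (h : ∀ g : G, g * g = 1) : Cardinal :=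
  letI : Module (ZMod 2) (Additive G) :=
    AddCommGroup.zmodModule (n := 2) (fun x => by
      rw [two_nsmul]; exact congrArg Additive.ofMul (h x.toMul))
  Module.rank (ZMod 2) (Additive G)

/-! ### Quaternionic structures -/

/-- A quaternionic structure `(G, -1, q)`, with `q : G × G → Q` onto the set `Q` of quaternions.
The distinguished elements `-1 ∈ G` and `0 ∈ Q` are called `neg` and `zero`. -/
structure QuatStr where
  G : Type
  Q : Type
  [grp : CommGroup G]
  mul_self : ∀ a : G, a * a = 1
  neg : G
  zero : Q
  q : G → G → Q
  surj : ∀ z : Q, ∃ a b : G, q a b = z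
  q1 : ∀ a, q a (neg * a) = zero
  q2 : ∀ a b, q a b = q b a
  q3 : ∀ a b c, q a b = q a c ↔ q a (b * c) = zero
  q4 : ∀ a b c d, q a b = q c d ↔ ∃ x, q a b = q a x ∧ q a x = q c x ∧ q c x = q c d

namespace QuatStr

instance instGrp (S : QuatStr) : CommGroup S.G := S.grp

variable (S T : QuatStr)

theorem q_one (a : S.G) : S.q a 1 = S.zero := by
  have h := (S.q3 a 1 1).1 rfl
  rwa [mul_one] at h

theorem one_q (a : S.G) : S.q 1 a = S.zero := by
  rw [S.q2, q_one]

/-- `q(a, b) = q(a, -ab)`. -/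
theorem q_neg_mul (a b : S.G) : S.q a (S.neg * a * b) = S.q a b := by
  rw [S.q3, mul_assoc, mul_assoc, S.mul_self, mul_one]
  exact S.q1 a

/-- The order of a quaternionic structure is the dimension of its group. -/
noncomputable def order : Cardinal := boolDim S.G S.mul_self

/-- The radical. -/
def rad : Set S.G := {a | ∀ x, S.q a x = S.zero}

/-- Degenerate structures. -/
def Degenerate : Prop := S.rad ≠ {1}

/-- The value group `V(a) = {b | q(a, b) = 0}`. -/
def V (a : S.G) : Subgroup S.G where
  carrier := {b | S.q a b = S.zero}
  one_mem' := S.q_one a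
  mul_mem' {b c} hb hc := (S.q3 a b c).1 (Eq.trans hb (Eq.symm hc))
  inv_mem' {b} hb := by
    have : b⁻¹ = b := inv_eq_of_mul_eq_one_left (S.mul_self b)
    rw [this]; exact hb

/-- `S` contains a `k`-rigid element, i.e. an element whose value group has dimension `k`. -/
def Rigid (k : ℕ) : Prop :=
  ∃ a : S.G, boolDim (S.V a) (fun g => Subtype.ext (S.mul_self g)) = (k : Cardinal)

/-- `k` is the smallest number such that `S` is `k`-rigid. -/
def StrictlyRigid (k : ℕ) : Prop := S.Rigid k ∧ ∀ l < k, ¬ S.Rigid l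

/-- Isomorphism of quaternionic structures. -/
def Iso : Prop :=
  ∃ φ : S.G ≃* T.G, φ S.neg = T.neg ∧
    ∀ a b, S.q a b = S.zero ↔ T.q (φ a) (φ b) = T.zero

theorem Iso.refl : S.Iso S := ⟨MulEquiv.refl _, rfl, fun _ _ => Iff.rfl⟩

theorem Iso.symm {S T : QuatStr} : S.Iso T → T.Iso S := by
  rintro ⟨φ, h, hq⟩
  refine ⟨φ.symm, by rw [← h, φ.symm_apply_apply], fun a b => ?_⟩
  rw [hq, φ.apply_symm_apply, φ.apply_symm_apply]

theorem Iso.trans {S T U : QuatStr} : S.Iso T → T.Iso U → S.Iso U := by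
  rintro ⟨φ, h, hq⟩ ⟨ψ, h2, hq2⟩
  exact ⟨φ.trans ψ, by simp [h, h2], fun a b => (hq a b).trans (hq2 _ _)⟩

instance isoSetoid : Setoid QuatStr where
  r := Iso
  iseqv := ⟨Iso.refl, Iso.symm, Iso.trans⟩

/-- The direct product. -/
def prod : QuatStr where
  G := S.G × T.G
  Q := S.Q × T.Q
  mul_self a := Prod.ext (S.mul_self a.1) (T.mul_self a.2)
  neg := (S.neg, T.neg)
  zero := (S.zero, T.zero)
  q a b := (S.q a.1 b.1, T.q a.2 b.2)
  surj z := by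
    obtain ⟨a, b, h⟩ := S.surj z.1
    obtain ⟨c, d, h2⟩ := T.surj z.2
    exact ⟨(a, c), (b, d), Prod.ext h h2⟩
  q1 a := Prod.ext (S.q1 a.1) (T.q1 a.2)
  q2 a b := Prod.ext (S.q2 _ _) (T.q2 _ _)
  q3 a b c := by
    simp only [Prod.ext_iff, Prod.fst_mul, Prod.snd_mul, S.q3, T.q3]
  q4 a b c d := by
    constructor
    · intro h
      obtain ⟨x, hx⟩ := (S.q4 _ _ _ _).1 (Prod.ext_iff.1 h).1
      obtain ⟨y, hy⟩ := (T.q4 _ _ _ _).1 (Prod.ext_iff.1 h).2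
      exact ⟨(x, y), Prod.ext hx.1 hy.1, Prod.ext hx.2.1 hy.2.1, Prod.ext hx.2.2 hy.2.2⟩
    · rintro ⟨x, h1, h2, h3⟩
      exact h1.trans (h2.trans h3)

/-! ### Group extensions -/

/-- The cyclic group of order two. -/
abbrev C2 : Type := Multiplicative (ZMod 2)

/-- `a ^ α` for an exponent `α ∈ {0, 1}`, where `x ^ α` is the element `α` of `{1, x} = C2`. -/
def pw (a : S.G) (α : C2) : S.G := a ^ (ZMod.val (Multiplicative.toAdd α))

/-- The map `q_x(a x^α, b x^β) = (q(a, b), (-1)^(αβ) a^β b^α)` on `G × {1, x}`. -/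
def extMap (A B : S.G × C2) : S.Q × S.G :=
  (S.q A.1 B.1, S.pw (S.pw S.neg A.2) B.2 * S.pw A.1 B.2 * S.pw B.1 A.2)

theorem c2_cases (α : C2) : α = 1 ∨ α = Multiplicative.ofAdd 1 := by
  revert α; decide

theorem pw_one (a : S.G) : S.pw a 1 = 1 := by
  have h : ZMod.val (Multiplicative.toAdd (1 : C2)) = 0 := by decide
  rw [pw, h, pow_zero]

theorem pw_gen (a : S.G) : S.pw a (Multiplicative.ofAdd 1) = a := by
  have h : ZMod.val (Multiplicative.toAdd (Multiplicative.ofAdd 1 : C2)) = 1 := by decide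
  rw [pw, h, pow_one]

theorem gen_mul_gen : (Multiplicative.ofAdd 1 : C2) * Multiplicative.ofAdd 1 = 1 := by decide

theorem mul_eq_one_iff_eq (a b : S.G) : a * b = 1 ↔ a = b := by
  constructor
  · intro h
    exact mul_right_cancel (h.trans (S.mul_self b).symm)
  · rintro rfl
    exact S.mul_self a

theorem extMap_mul (A B C : S.G × C2) :
    (S.extMap A (B * C)).2 = (S.extMap A B).2 * (S.extMap A C).2 := by
  obtain ⟨a, α⟩ := A
  obtain ⟨b, β⟩ := B
  obtain ⟨c, γ⟩ := C
  have key : ∀ u v w : S.G, u * v * (u * w) = v * w := fun u v w => by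
    rw [mul_mul_mul_comm, S.mul_self, one_mul]
  rcases c2_cases α with rfl | rfl <;> rcases c2_cases β with rfl | rfl <;>
    rcases c2_cases γ with rfl | rfl <;>
    simp [extMap, pw_one, pw_gen, gen_mul_gen, S.mul_self, key, mul_left_comm, mul_assoc]

theorem extMap_comm (A B : S.G × C2) : S.extMap A B = S.extMap B A := by
  obtain ⟨a, α⟩ := A
  obtain ⟨b, β⟩ := B
  refine Prod.ext (S.q2 _ _) ?_
  rcases c2_cases α with rfl | rfl <;> rcases c2_cases β with rfl | rfl <;>
    simp [extMap, pw_one, pw_gen, mul_comm, mul_left_comm]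

theorem extMap_neg (A : S.G × C2) : S.extMap A ((S.neg, 1) * A) = (S.zero, 1) := by
  obtain ⟨a, α⟩ := A
  refine Prod.ext (S.q1 a) ?_
  have h := S.mul_self (S.neg * a)
  rcases c2_cases α with rfl | rfl <;>
    simp [extMap, pw_one, pw_gen, h]

theorem extMap_slot (A B C D : S.G × C2) (h : S.extMap A B = S.extMap C D) :
    ∃ X, S.extMap A B = S.extMap A X ∧ S.extMap A X = S.extMap C X ∧
      S.extMap C X = S.extMap C D := by
  suffices h2 : ∃ X, S.extMap A X = S.extMap A B ∧ S.extMap C X = S.extMap C D by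
    obtain ⟨X, hX, hY⟩ := h2
    exact ⟨X, hX.symm, hX.trans (h.trans hY.symm), hY⟩
  obtain ⟨a, α⟩ := A
  obtain ⟨b, β⟩ := B
  obtain ⟨c, γ⟩ := C
  obtain ⟨d, δ⟩ := D
  have hc : ∀ u v : S.G, S.neg * u * (S.neg * u * v) = v := fun u v => by
    rw [← mul_assoc, S.mul_self, one_mul]
  -- if `A` involves `x` and `C` does not
  have mixed : ∀ (a b c d : S.G) (β δ : C2),
      S.extMap (a, Multiplicative.ofAdd 1) (b, β) = S.extMap (c, 1) (d, δ) →
      ∃ X, S.extMap (a, Multiplicative.ofAdd 1) X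
          = S.extMap (a, Multiplicative.ofAdd 1) (b, β) ∧
        S.extMap (c, 1) X = S.extMap (c, 1) (d, δ) := by
    intro a b c d β δ h
    have main : ∀ z e, S.extMap (a, Multiplicative.ofAdd 1) (b, β) = (z, e) →
        S.extMap (c, 1) (d, δ) = (z, e) →
        ∃ X, S.extMap (a, Multiplicative.ofAdd 1) X = (z, e) ∧ S.extMap (c, 1) X = (z, e) := by
      intro z e h1 h2
      have h3 : S.q a e = z := by
        rcases c2_cases β with rfl | rfl <;>
          simp only [extMap, pw_one, pw_gen, one_mul, Prod.mk.injEq] at h1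
        · rw [← h1.1, ← h1.2]
        · rw [← h1.1, ← h1.2, q_neg_mul]
      rcases c2_cases δ with rfl | rfl <;>
        simp only [extMap, pw_one, pw_gen, one_mul, mul_one, Prod.mk.injEq] at h2
      · obtain ⟨-, rfl⟩ := h2
        refine ⟨(1, 1), ?_⟩
        simp [extMap, pw_one, q_one] at h3 ⊢
        simp [h3, pw_gen]
      · obtain ⟨-, rfl⟩ := h2
        refine ⟨(S.neg * a * c, Multiplicative.ofAdd 1), ?_⟩
        have h4 : S.q c (S.neg * a * c) = S.q a c := by
          rw [mul_right_comm, q_neg_mul, S.q2]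
        simp [extMap, pw_one, pw_gen, q_neg_mul, hc, h3, h4]
    obtain ⟨X, hX, hY⟩ := main _ _ rfl h.symm
    exact ⟨X, hX, hY.trans h⟩
  rcases c2_cases α with rfl | rfl <;> rcases c2_cases γ with rfl | rfl
  · -- neither `A` nor `C` involves `x`
    rcases c2_cases β with rfl | rfl <;> rcases c2_cases δ with rfl | rfl <;>
      simp only [extMap, pw_one, pw_gen, one_mul, mul_one, Prod.mk.injEq] at h
    · obtain ⟨x, h1, h2, h3⟩ := (S.q4 _ _ _ _).1 h.1
      exact ⟨(x, 1), by simp [extMap, pw_one, ← h3, ← h1]⟩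
    · obtain ⟨h1, rfl⟩ := h
      rw [one_q] at h1
      exact ⟨(1, 1), by simp [extMap, pw_one, pw_gen, h1, one_q, q_one]⟩
    · obtain ⟨h1, rfl⟩ := h
      rw [one_q] at h1
      exact ⟨(1, 1), by simp [extMap, pw_one, pw_gen, h1, one_q, q_one]⟩
    · obtain ⟨h1, rfl⟩ := h
      exact ⟨(b, Multiplicative.ofAdd 1), by simp [extMap, pw_one, pw_gen, h1]⟩
  · obtain ⟨X, hX, hY⟩ := mixed c d a b δ β h.symm
    exact ⟨X, hY, hX⟩
  · exact mixed a b c d β δ h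
  · -- both involve `x`
    have side : ∀ (a b : S.G) (β : C2) z e,
        S.extMap (a, Multiplicative.ofAdd 1) (b, β) = (z, e) →
        S.extMap (a, Multiplicative.ofAdd 1) (e, 1) = (z, e) := by
      intro a b β z e h1
      rcases c2_cases β with rfl | rfl <;>
        simp only [extMap, pw_one, pw_gen, one_mul, Prod.mk.injEq] at h1 ⊢
      · rw [← h1.1, ← h1.2]; exact ⟨rfl, trivial⟩
      · rw [← h1.1, ← h1.2, q_neg_mul]; exact ⟨rfl, trivial⟩
    exact ⟨_, side a b β _ _ rfl, (side c d δ _ _ h.symm).trans h⟩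

/-- The group extension `S[x]`. Its quaternions are the elements of `Q × G` that are values of
`q_x`. -/
def groupExt : QuatStr where
  G := S.G × C2
  Q := {z : S.Q × S.G // ∃ A B, S.extMap A B = z}
  mul_self A := Prod.ext (S.mul_self A.1) (by
    rcases c2_cases A.2 with h | h <;> simp [h, gen_mul_gen])
  neg := (S.neg, 1)
  zero := ⟨(S.zero, 1), 1, (S.neg, 1) * 1, S.extMap_neg 1⟩
  q A B := ⟨S.extMap A B, A, B, rfl⟩
  surj := by
    rintro ⟨z, A, B, h⟩
    exact ⟨A, B, Subtype.ext h⟩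
  q1 A := Subtype.ext (S.extMap_neg A)
  q2 A B := Subtype.ext (S.extMap_comm A B)
  q3 A B C := by
    rw [Subtype.mk.injEq, Subtype.mk.injEq, Prod.ext_iff, Prod.ext_iff, extMap_mul,
      S.mul_eq_one_iff_eq]
    exact and_congr_left' (S.q3 A.1 B.1 C.1)
  q4 A B C D := by
    simp only [Subtype.mk.injEq]
    refine ⟨S.extMap_slot A B C D, ?_⟩
    rintro ⟨X, h1, h2, h3⟩
    exact h1.trans (h2.trans h3)

/-! ### Elementary types -/

/-- The structure `(G, -1, 0)` with one quaternion on a boolean group `G`. -/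
def totallyDegenerate (G : Type) [CommGroup G] (h : ∀ a : G, a * a = 1) (e : G) : QuatStr where
  G := G
  Q := Unit
  mul_self := h
  neg := e
  zero := ()
  q _ _ := ()
  surj _ := ⟨1, 1, rfl⟩
  q1 _ := rfl
  q2 _ _ := rfl
  q3 _ _ _ := Iff.intro (fun _ => rfl) (fun _ => rfl)
  q4 _ _ _ _ := ⟨fun _ => ⟨1, rfl, rfl, rfl⟩, fun _ => rfl⟩

/-- The structure of order zero. -/
def L0 : QuatStr := totallyDegenerate Unit (fun _ => rfl) 1

/-- The totally degenerate structure of order one with `-1 = 1`. -/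
def L10 : QuatStr := totallyDegenerate C2 (by decide) 1

/-- The totally degenerate structure of order one with `-1 ≠ 1`. -/
def L11 : QuatStr := totallyDegenerate C2 (by decide) (Multiplicative.ofAdd 1)

/-- The quaternionic structure of the real numbers: `G = {1, -1}` and `q(a, b) ≠ 0` precisely
for `a = b = -1`. -/
def L1 : QuatStr where
  G := C2
  Q := ZMod 2
  mul_self := by decide
  neg := Multiplicative.ofAdd 1
  zero := 0
  q a b := Multiplicative.toAdd a * Multiplicative.toAdd b
  surj := by decide
  q1 := by decide
  q2 := by decide
  q3 := by decide
  q4 := by decide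

/-- Local type structures: finite, nondegenerate, of order at least three, with exactly two
quaternions. -/
def IsLocalType : Prop :=
  Finite S.G ∧ ¬ S.Degenerate ∧ 3 ≤ S.order ∧ Nat.card S.Q = 2

/-- Structures of elementary type. -/
inductive IsElementary : QuatStr → Prop
  | l0 : IsElementary L0
  | l10 : IsElementary L10
  | l11 : IsElementary L11
  | l1 : IsElementary L1
  | loc (S : QuatStr) : S.IsLocalType → IsElementary S
  | prod (S T : QuatStr) : IsElementary S → IsElementary T → IsElementary (S.prod T)
  | ext (S : QuatStr) : IsElementary S → IsElementary S.groupExt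
  | iso (S T : QuatStr) : S.Iso T → IsElementary S → IsElementary T

/-- `S` has positive order and is not a product of two structures of positive order. -/
def Indecomposable : Prop :=
  1 ≤ S.order ∧ ¬ ∃ T U : QuatStr, 1 ≤ T.order ∧ 1 ≤ U.order ∧ S.Iso (T.prod U)

/-! ### Sets of isomorphism types -/

/-- Isomorphism types of quaternionic structures. -/
abbrev IsoType : Type 1 := Quotient isoSetoid

/-- The set of isomorphism types of elementary type structures of order `n` satisfying `P`. -/
def elemTypes (n : ℕ) (P : QuatStr → Prop) : Set IsoType :=
  {t | ∃ S : QuatStr, S.IsElementary ∧ S.order = (n : Cardinal) ∧ P S ∧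
    (Quotient.mk isoSetoid S) = t}

/-- All elementary types of order `n`. -/
def setE (n : ℕ) : Set IsoType := elemTypes n (fun _ => True)

/-- Those with `-1 = 1`. -/
def setE' (n : ℕ) : Set IsoType := elemTypes n (fun S => S.neg = 1)

/-- The degenerate ones. -/
def setEd (n : ℕ) : Set IsoType := elemTypes n (fun S => S.Degenerate)

/-- Those that are group extensions. -/
def setEΔ (n : ℕ) : Set IsoType := elemTypes n (fun S => ∃ T : QuatStr, S.Iso T.groupExt)

/-- The nondegenerate strictly `k`-rigid ones. -/
def setEk (k n : ℕ) : Set IsoType := elemTypes n (fun S => ¬ S.Degenerate ∧ S.StrictlyRigid k)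

/-- The indecomposable nondegenerate strictly `k`-rigid ones. -/
def setEkInd (k n : ℕ) : Set IsoType :=
  elemTypes n (fun S => (¬ S.Degenerate ∧ S.StrictlyRigid k) ∧ S.Indecomposable)

noncomputable def e (n : ℕ) : ℕ := (setE n).ncard
noncomputable def e' (n : ℕ) : ℕ := (setE' n).ncard
noncomputable def eD (n : ℕ) : ℕ := (setEd n).ncard
noncomputable def eΔ (n : ℕ) : ℕ := (setEΔ n).ncard
noncomputable def eK (k n : ℕ) : ℕ := (setEk k n).ncard
noncomputable def eInd (k n : ℕ) : ℕ := (setEkInd k n).ncard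

/-! ### The index sets -/

/-- Matrices `(m i j)`, `0 ≤ i ≤ k`, `1 ≤ j ≤ n`, of natural numbers with `∑ i * m i j = k` and
`∑ j * m i j = n`; the column index `j : Fin n` stands for the number `j + 1`. -/
def setP (k n : ℕ) : Set (Matrix (Fin (k + 1)) (Fin n) ℕ) :=
  {m | ∑ i : Fin (k + 1), ∑ j : Fin n, (i : ℕ) * m i j = k ∧
    ∑ i : Fin (k + 1), ∑ j : Fin n, ((j : ℕ) + 1) * m i j = n}

theorem setP_finite (k n : ℕ) : (setP k n).Finite := by
  refine Set.Finite.subset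
    (Set.Finite.pi' (fun _ => Set.Finite.pi' (fun _ => Set.finite_Iic n))) ?_
  rintro m ⟨-, h⟩ i j
  have h1 : ((j : ℕ) + 1) * m i j ≤ ∑ j : Fin n, ((j : ℕ) + 1) * m i j :=
    Finset.single_le_sum (f := fun j : Fin n => ((j : ℕ) + 1) * m i j)
      (fun _ _ => Nat.zero_le _) (Finset.mem_univ j)
  have h2 : ∑ j : Fin n, ((j : ℕ) + 1) * m i j ≤ n := le_trans
    (Finset.single_le_sum (f := fun i => ∑ j : Fin n, ((j : ℕ) + 1) * m i j)
      (fun _ _ => Nat.zero_le _) (Finset.mem_univ i)) h.le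
  have h3 : m i j ≤ ((j : ℕ) + 1) * m i j := Nat.le_mul_of_pos_left _ (Nat.succ_pos _)
  exact h3.trans (h1.trans h2)

/-- The index set `P_{k,n}` as a finite set. -/
noncomputable def P (k n : ℕ) : Finset (Matrix (Fin (k + 1)) (Fin n) ℕ) :=
  (setP_finite k n).toFinset

end QuatStr

/-! ### Dimension and cardinality of boolean groups -/

/-! Isomorphism types form a commutative monoid under direct product (`isoTypeCommMonoid`). On
finite types two invariants are additive: the order `dim` and the least dimension `lrk` of a value
group (`dim_prod`, `lrk_prod`). Nondegeneracy and -1 = 1 hold for a product exactly when they hold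
for both factors. Counting thus reduces to knowing how types factor and which factors are
indecomposable.

Nondegenerate structures factor uniquely. A direct factor is the image of an idempotent endomorphism
that preserves q = 0 in each argument (`IsProj`). Two such maps commute when the radical is trivial
(`IsProj.comm`), so any two decompositions have a common refinement (`refinement`), whence
`eq_of_prod_eq`. The formula for e_k(n) counts multisets of indecomposables with a prescribed number
of members for each pair (`lrk`, `dim`) (`ncard_multisets`, `eK_eq_sum`). For k = 1 exactly one
factor has `lrk` equal to 1, and it can be split off (`eK_one_eq_sum`).

An indecomposable structure of elementary type has order one, is of local type, or is a group
extension (`IsElementary.cases_of_indecomposable`). Every y in a group extension SΔ that involves x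
has value group {1, -y}. Consequently a finite S can be recovered from SΔ (`iso_of_groupExt_iso`), a
decomposable SΔ has order two (`card_eq_two_of_groupExt_iso_prod`), `lrk` of SΔ is at most 1, and
for S of positive order it is 0 exactly when `lrk` of S is 0. A local type structure is a
nondegenerate symmetric bilinear form over 𝔽₂: either the dot product, with -1 ≠ 1, or an
alternating form, with -1 = 1 and even order (`ncard_localTypes`). Its `lrk` is one less than its
order, hence at least 2. Above order two, `lrk` therefore separates the indecomposable group
extensions from the local types.

A degenerate type splits off the totally degenerate types `d₀` (-1 = 1) or `d₁` (-1 ≠ 1) of order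
one. The only relation needed is t * d₁ = t * d₀ when -1 ≠ 1 in t (`mul_d₁`). This gives a unique
normal form (`exists_normal`, `normal_unique`), and inclusion-exclusion over the types divisible by
`d₀` and by `d₁` gives the count (`ncard_setEd`). -/

theorem boolDim_eq_natCast_iff {G : Type} [CommGroup G] (h : ∀ g : G, g * g = 1) (n : ℕ) :
    boolDim G h = n ↔ Nat.card G = 2 ^ n := by
  let _ : Module (ZMod 2) (Additive G) :=
    AddCommGroup.zmodModule (n := 2) (fun x => by
      rw [two_nsmul]; exact congrArg Additive.ofMul (h x.toMul))
  change Module.rank (ZMod 2) (Additive G) = n ↔ Nat.card (Additive G) = 2 ^ n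
  constructor
  · intro hr
    have : Module.Finite (ZMod 2) (Additive G) :=
      Module.rank_lt_aleph0_iff.1 (by rw [hr]; exact Cardinal.natCast_lt_aleph0)
    rw [Module.natCard_eq_pow_finrank (K := ZMod 2), Nat.card_zmod,
      Module.finrank_eq_of_rank_eq hr]
  · intro hc
    -- `Nat.card` of an infinite type is 0, which is not a power of two; the equivalence therefore
    -- needs no finiteness hypothesis.
    have : Finite (Additive G) := Nat.finite_of_card_ne_zero (by rw [hc]; positivity)
    rw [Module.natCard_eq_pow_finrank (K := ZMod 2), Nat.card_zmod] at hc
    rw [← Module.finrank_eq_rank, Nat.pow_right_injective le_rfl hc]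

theorem one_le_boolDim_iff {G : Type} [CommGroup G] (h : ∀ g : G, g * g = 1) :
    1 ≤ boolDim G h ↔ Nontrivial G := by
  rw [← not_iff_not, not_nontrivial_iff_subsingleton, Cardinal.one_le_iff_ne_zero, not_not]
  have := boolDim_eq_natCast_iff h 0
  rw [Nat.cast_zero, pow_zero] at this
  rw [this, Nat.card_eq_one_iff_unique]
  exact ⟨fun h => h.1, fun h => ⟨h, ⟨1⟩⟩⟩

theorem exists_natCard_eq_two_pow {G : Type} [CommGroup G] [Finite G] (h : ∀ g : G, g * g = 1) :
    ∃ n, Nat.card G = 2 ^ n := by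
  let _ : Module (ZMod 2) (Additive G) :=
    AddCommGroup.zmodModule (n := 2) (fun x => by
      rw [two_nsmul]; exact congrArg Additive.ofMul (h x.toMul))
  have := Module.natCard_eq_pow_finrank (K := ZMod 2) (V := Additive G)
  rw [Nat.card_zmod] at this
  exact ⟨_, this⟩

namespace QuatStr

/-! ### The zero relation -/

theorem q_eq_zero_comm (S : QuatStr) (a b : S.G) : S.q a b = S.zero ↔ S.q b a = S.zero := by
  rw [S.q2]

theorem q_mul_eq_zero (S : QuatStr) {a b c : S.G} (hb : S.q a b = S.zero)
    (hc : S.q a c = S.zero) : S.q a (b * c) = S.zero :=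
  (S.V a).mul_mem hb hc

theorem mul_q_eq_zero (S : QuatStr) {a b c : S.G} (ha : S.q a c = S.zero)
    (hb : S.q b c = S.zero) : S.q (a * b) c = S.zero := by
  rw [S.q2] at *
  exact S.q_mul_eq_zero ha hb

theorem mem_V {S : QuatStr} {a b : S.G} : b ∈ S.V a ↔ S.q a b = S.zero := Iff.rfl

theorem mul_mul_cancel_self (S : QuatStr) (a b : S.G) : a * (a * b) = b := by
  rw [← mul_assoc, S.mul_self, one_mul]

theorem not_degenerate_iff {S : QuatStr} :
    ¬ S.Degenerate ↔ ∀ a, (∀ x, S.q a x = S.zero) → a = 1 := by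
  rw [Degenerate, not_not]
  constructor
  · intro h a ha
    have : a ∈ S.rad := ha
    rwa [h] at this
  · intro h
    ext a
    exact ⟨h a, by rintro rfl; exact S.one_q⟩

/-! ### Numerical invariants -/

/-- The order of a finite quaternionic structure. -/
noncomputable def dim (S : QuatStr) : ℕ := Nat.log 2 (Nat.card S.G)

/-- The smallest number `k` for which a finite quaternionic structure is `k`-rigid. -/
noncomputable def lrk (S : QuatStr) : ℕ := sInf {k | ∃ a : S.G, Nat.card (S.V a) = 2 ^ k}

theorem card_eq (S : QuatStr) [Finite S.G] : Nat.card S.G = 2 ^ S.dim := by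
  obtain ⟨n, hn⟩ := exists_natCard_eq_two_pow S.mul_self
  rw [dim, hn, Nat.log_pow Nat.one_lt_two]

theorem dim_eq_of_card {S : QuatStr} {n : ℕ} (h : Nat.card S.G = 2 ^ n) : S.dim = n := by
  rw [dim, h, Nat.log_pow Nat.one_lt_two]

theorem order_eq_natCast_iff {S : QuatStr} {n : ℕ} :
    S.order = n ↔ Nat.card S.G = 2 ^ n := boolDim_eq_natCast_iff _ n

theorem order_eq_iff (S : QuatStr) [Finite S.G] {n : ℕ} : S.order = n ↔ S.dim = n := by
  rw [order_eq_natCast_iff, S.card_eq]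
  exact (Nat.pow_right_injective le_rfl).eq_iff

theorem order_eq_dim (S : QuatStr) [Finite S.G] : S.order = S.dim := S.order_eq_iff.2 rfl

theorem one_le_order_iff {S : QuatStr} : 1 ≤ S.order ↔ Nontrivial S.G := one_le_boolDim_iff _

theorem dim_eq_zero_iff (S : QuatStr) [Finite S.G] : S.dim = 0 ↔ Subsingleton S.G := by
  rw [← not_iff_not, not_subsingleton_iff_nontrivial, ← one_le_order_iff, order_eq_dim,
    Nat.one_le_cast, Nat.one_le_iff_ne_zero]

theorem rigid_iff {S : QuatStr} {k : ℕ} : S.Rigid k ↔ ∃ a : S.G, Nat.card (S.V a) = 2 ^ k :=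
  exists_congr fun _ => boolDim_eq_natCast_iff _ k

theorem exists_card_V (S : QuatStr) [Finite S.G] (a : S.G) : ∃ k, Nat.card (S.V a) = 2 ^ k :=
  exists_natCard_eq_two_pow fun g => Subtype.ext (S.mul_self g)

theorem exists_card_V_eq_lrk (S : QuatStr) [Finite S.G] : ∃ a, Nat.card (S.V a) = 2 ^ S.lrk := by
  obtain ⟨k, hk⟩ := S.exists_card_V 1
  exact Nat.sInf_mem (s := {k | ∃ a : S.G, Nat.card (S.V a) = 2 ^ k}) ⟨k, 1, hk⟩

theorem two_pow_lrk_le (S : QuatStr) [Finite S.G] (a : S.G) :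
    2 ^ S.lrk ≤ Nat.card (S.V a) := by
  obtain ⟨k, hk⟩ := S.exists_card_V a
  rw [hk]
  exact Nat.pow_le_pow_right two_pos (Nat.sInf_le ⟨a, hk⟩)

theorem lrk_eq_of {S : QuatStr} [Finite S.G] {k : ℕ} (h : ∃ a, Nat.card (S.V a) = 2 ^ k)
    (h' : ∀ a, 2 ^ k ≤ Nat.card (S.V a)) : S.lrk = k := by
  obtain ⟨a, ha⟩ := h
  obtain ⟨b, hb⟩ := S.exists_card_V_eq_lrk
  exact le_antisymm ((Nat.pow_le_pow_iff_right one_lt_two).1 (ha ▸ S.two_pow_lrk_le a))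
    ((Nat.pow_le_pow_iff_right one_lt_two).1 (hb ▸ h' b))

theorem strictlyRigid_iff (S : QuatStr) [Finite S.G] {k : ℕ} :
    S.StrictlyRigid k ↔ S.lrk = k := by
  simp only [StrictlyRigid, rigid_iff]
  constructor
  · rintro ⟨⟨a, ha⟩, h⟩
    refine lrk_eq_of ⟨a, ha⟩ fun b => ?_
    obtain ⟨l, hl⟩ := S.exists_card_V b
    rw [hl]
    exact Nat.pow_le_pow_right two_pos (not_lt.1 fun hlk => h l hlk ⟨b, hl⟩)
  · rintro rfl
    exact ⟨S.exists_card_V_eq_lrk, fun l hl ⟨a, ha⟩ =>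
      absurd (S.two_pow_lrk_le a) (by
        rw [ha, not_le]; exact Nat.pow_lt_pow_right one_lt_two hl)⟩

theorem lrk_eq_zero_iff (S : QuatStr) [Finite S.G] : S.lrk = 0 ↔ ∃ a, S.V a = ⊥ := by
  constructor
  · intro h
    obtain ⟨a, ha⟩ := S.exists_card_V_eq_lrk
    rw [h, pow_zero, Subgroup.card_eq_one] at ha
    exact ⟨a, ha⟩
  · rintro ⟨a, ha⟩
    exact lrk_eq_of ⟨a, by rw [ha]; simp⟩ fun b => by
      rw [pow_zero]; exact Nat.card_pos

/-! ### Invariance under isomorphism -/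

theorem Iso.card_eq {S T : QuatStr} (h : S.Iso T) : Nat.card S.G = Nat.card T.G :=
  Nat.card_congr h.choose.toEquiv

theorem Iso.finite_iff {S T : QuatStr} (h : S.Iso T) : Finite S.G ↔ Finite T.G :=
  h.choose.toEquiv.finite_iff

theorem Iso.nontrivial_iff {S T : QuatStr} (h : S.Iso T) : Nontrivial S.G ↔ Nontrivial T.G :=
  h.choose.toEquiv.nontrivial_congr

theorem Iso.dim_eq {S T : QuatStr} (h : S.Iso T) : S.dim = T.dim := by
  rw [dim, dim, h.card_eq]

theorem Iso.lrk_eq {S T : QuatStr} (h : S.Iso T) : S.lrk = T.lrk := by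
  have key : ∀ {S T : QuatStr} (h : S.Iso T) {k : ℕ}, (∃ a : S.G, Nat.card (S.V a) = 2 ^ k) →
      ∃ a : T.G, Nat.card (T.V a) = 2 ^ k := by
    rintro S T ⟨φ, -, hφ⟩ k ⟨a, ha⟩
    refine ⟨φ a, ?_⟩
    rw [← ha]
    exact Nat.card_congr (φ.toEquiv.subtypeEquiv fun b => hφ a b).symm
  unfold lrk
  congr 1
  ext k
  exact ⟨key h, key h.symm⟩

theorem Iso.degenerate_iff {S T : QuatStr} (h : S.Iso T) : S.Degenerate ↔ T.Degenerate := by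
  have key : ∀ {S T : QuatStr} (h : S.Iso T), ¬ T.Degenerate → ¬ S.Degenerate := by
    rintro S T ⟨φ, -, hφ⟩
    simp only [not_degenerate_iff]
    intro h a ha
    rw [← φ.map_eq_one_iff]
    refine h _ fun x => ?_
    obtain ⟨y, rfl⟩ := φ.surjective x
    exact (hφ _ _).1 (ha y)
  exact not_iff_not.1 ⟨key h.symm, key h⟩

theorem Iso.neg_eq_one_iff {S T : QuatStr} (h : S.Iso T) : S.neg = 1 ↔ T.neg = 1 := by
  obtain ⟨φ, h, -⟩ := h
  rw [← h, φ.map_eq_one_iff]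

theorem Iso.indecomposable_iff {S T : QuatStr} (h : S.Iso T) :
    S.Indecomposable ↔ T.Indecomposable := by
  simp only [Indecomposable, one_le_order_iff]
  rw [h.nontrivial_iff]
  refine and_congr_right' (not_congr ?_)
  refine exists_congr fun A => exists_congr fun B => ?_
  refine and_congr_right' (and_congr_right' ⟨h.symm.trans, h.trans⟩)

theorem isElementary_iff_of_iso {S T : QuatStr} (h : S.Iso T) :
    S.IsElementary ↔ T.IsElementary := ⟨.iso _ _ h, .iso _ _ h.symm⟩

theorem iso_of_subsingleton {S T : QuatStr} [Subsingleton S.G] [Subsingleton T.G] : S.Iso T := by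
  refine ⟨⟨⟨fun _ => 1, fun _ => 1, fun _ => Subsingleton.elim _ _,
    fun _ => Subsingleton.elim _ _⟩, fun _ _ => Subsingleton.elim _ _⟩,
    Subsingleton.elim _ _, fun a b => ?_⟩
  rw [Subsingleton.elim a 1, S.one_q, eq_self_iff_true, true_iff]
  exact T.one_q _

/-! ### Direct products -/

theorem prod_q_eq_zero_iff {S T : QuatStr} {a b : (S.prod T).G} :
    (S.prod T).q a b = (S.prod T).zero ↔ S.q a.1 b.1 = S.zero ∧ T.q a.2 b.2 = T.zero :=
  Prod.ext_iff

theorem prod_degenerate_iff {S T : QuatStr} :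
    ¬ (S.prod T).Degenerate ↔ ¬ S.Degenerate ∧ ¬ T.Degenerate := by
  simp only [not_degenerate_iff, prod_q_eq_zero_iff]
  constructor
  · intro h
    exact ⟨fun a ha => congrArg Prod.fst (h (a, 1) fun x => ⟨ha _, T.one_q _⟩),
      fun a ha => congrArg Prod.snd (h (1, a) fun x => ⟨S.one_q _, ha _⟩)⟩
  · rintro ⟨h1, h2⟩ a ha
    exact Prod.ext (h1 _ fun x => (ha (x, 1)).1) (h2 _ fun x => (ha (1, x)).2)

theorem prod_neg_eq_one_iff {S T : QuatStr} :
    (S.prod T).neg = 1 ↔ S.neg = 1 ∧ T.neg = 1 := Prod.ext_iff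

theorem card_prod (S T : QuatStr) : Nat.card (S.prod T).G = Nat.card S.G * Nat.card T.G :=
  Nat.card_prod _ _

instance finite_prod (S T : QuatStr) [Finite S.G] [Finite T.G] : Finite (S.prod T).G :=
  inferInstanceAs (Finite (S.G × T.G))

theorem dim_prod (S T : QuatStr) [Finite S.G] [Finite T.G] :
    (S.prod T).dim = S.dim + T.dim :=
  dim_eq_of_card (by rw [card_prod, S.card_eq, T.card_eq, pow_add])

theorem card_V_prod (S T : QuatStr) (a : (S.prod T).G) :
    Nat.card ((S.prod T).V a) = Nat.card (S.V a.1) * Nat.card (T.V a.2) := by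
  rw [← Nat.card_prod]
  exact Nat.card_congr
    { toFun := fun b => (⟨b.1.1, (prod_q_eq_zero_iff.1 b.2).1⟩, ⟨b.1.2, (prod_q_eq_zero_iff.1 b.2).2⟩)
      invFun := fun b => ⟨(b.1.1, b.2.1), prod_q_eq_zero_iff.2 ⟨b.1.2, b.2.2⟩⟩
      left_inv := fun _ => rfl
      right_inv := fun _ => rfl }

/-- The value group of a pair is the product of the value groups, so its size is minimized
independently in the two components. -/
theorem lrk_prod (S T : QuatStr) [Finite S.G] [Finite T.G] :
    (S.prod T).lrk = S.lrk + T.lrk := by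
  obtain ⟨a, ha⟩ := S.exists_card_V_eq_lrk
  obtain ⟨b, hb⟩ := T.exists_card_V_eq_lrk
  refine lrk_eq_of ⟨(a, b), (card_V_prod S T (a, b)).trans ?_⟩ fun c => ?_
  · rw [ha, hb, pow_add]
  · rw [card_V_prod, pow_add]
    exact Nat.mul_le_mul (S.two_pow_lrk_le _) (T.two_pow_lrk_le _)

theorem Iso.prod {S S' T T' : QuatStr} (h : S.Iso S') (h' : T.Iso T') :
    (S.prod T).Iso (S'.prod T') := by
  obtain ⟨φ, h1, h2⟩ := h
  obtain ⟨ψ, h3, h4⟩ := h'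
  refine ⟨φ.prodCongr ψ, Prod.ext h1 h3, fun a b => ?_⟩
  rw [prod_q_eq_zero_iff, prod_q_eq_zero_iff, h2, h4]
  rfl

theorem prod_comm_iso (S T : QuatStr) : (S.prod T).Iso (T.prod S) :=
  ⟨MulEquiv.prodComm, rfl, fun a b => by
    rw [prod_q_eq_zero_iff, prod_q_eq_zero_iff, and_comm]; rfl⟩

theorem prod_assoc_iso (S T U : QuatStr) : ((S.prod T).prod U).Iso (S.prod (T.prod U)) :=
  ⟨MulEquiv.prodAssoc, rfl, fun a b => by
    rw [prod_q_eq_zero_iff, prod_q_eq_zero_iff, prod_q_eq_zero_iff, prod_q_eq_zero_iff, and_assoc]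
    rfl⟩

theorem prod_iso_right (S T : QuatStr) [Subsingleton S.G] : (S.prod T).Iso T := by
  refine ⟨⟨⟨fun x => x.2, fun x => (1, x), fun _ => Prod.ext (Subsingleton.elim _ _) rfl,
    fun _ => rfl⟩, fun _ _ => rfl⟩, rfl, fun a b => ?_⟩
  rw [prod_q_eq_zero_iff, Subsingleton.elim a.1 1, S.one_q, eq_self_iff_true, true_and]
  rfl

instance : Subsingleton L0.G := inferInstanceAs (Subsingleton Unit)

/-! ### The monoid of isomorphism types -/

theorem mk_eq_iff {S T : QuatStr} : (Quotient.mk isoSetoid S) = Quotient.mk isoSetoid T ↔ S.Iso T :=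
  Quotient.eq

instance isoTypeCommMonoid : CommMonoid IsoType where
  mul := Quotient.map₂ prod fun _ _ h _ _ h' => Iso.prod h h'
  mul_assoc := by
    rintro ⟨S⟩ ⟨T⟩ ⟨U⟩
    exact Quotient.sound (prod_assoc_iso S T U)
  one := Quotient.mk isoSetoid L0
  one_mul := by
    rintro ⟨S⟩
    exact Quotient.sound (prod_iso_right L0 S)
  mul_one := by
    rintro ⟨S⟩
    exact Quotient.sound ((prod_comm_iso S L0).trans (prod_iso_right L0 S))
  mul_comm := by
    rintro ⟨S⟩ ⟨T⟩
    exact Quotient.sound (prod_comm_iso S T)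

theorem mk_mul (S T : QuatStr) :
    (Quotient.mk isoSetoid S * Quotient.mk isoSetoid T : IsoType) =
      Quotient.mk isoSetoid (S.prod T) := rfl

theorem mk_L0 : (Quotient.mk isoSetoid L0 : IsoType) = 1 := rfl

namespace IsoType

/-- A type of finite structures. -/
def IsFin (t : IsoType) : Prop :=
  Quotient.lift (fun S : QuatStr => Finite S.G) (fun _ _ h => propext (Iso.finite_iff h)) t

/-- A type of structures of positive order. -/
def Pos (t : IsoType) : Prop :=
  Quotient.lift (fun S : QuatStr => Nontrivial S.G) (fun _ _ h => propext (Iso.nontrivial_iff h)) t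

/-- A type of nondegenerate structures. -/
def Nondeg (t : IsoType) : Prop :=
  Quotient.lift (fun S : QuatStr => ¬ S.Degenerate)
    (fun _ _ h => propext (not_congr (Iso.degenerate_iff h))) t

/-- A type of structures with `-1 = 1`. -/
def NegOne (t : IsoType) : Prop :=
  Quotient.lift (fun S : QuatStr => S.neg = 1) (fun _ _ h => propext (Iso.neg_eq_one_iff h)) t

/-- A type of structures of elementary type. -/
def Elem (t : IsoType) : Prop :=
  Quotient.lift IsElementary (fun _ _ h => propext (isElementary_iff_of_iso h)) t

/-- A type of indecomposable structures. -/
def Indec (t : IsoType) : Prop :=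
  Quotient.lift Indecomposable (fun _ _ h => propext (Iso.indecomposable_iff h)) t

/-- The order of the structures of a finite type. -/
noncomputable def dim (t : IsoType) : ℕ :=
  Quotient.lift QuatStr.dim (fun _ _ h => Iso.dim_eq h) t

/-- The number `k` for which the structures of a finite type are strictly `k`-rigid. -/
noncomputable def lrk (t : IsoType) : ℕ :=
  Quotient.lift QuatStr.lrk (fun _ _ h => Iso.lrk_eq h) t

theorem fin_mul {s t : IsoType} (hs : IsFin s) (ht : IsFin t) : IsFin (s * t) := by
  induction s using Quotient.ind
  induction t using Quotient.ind
  exact @finite_prod _ _ hs ht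

theorem dim_mul {s t : IsoType} (hs : IsFin s) (ht : IsFin t) : dim (s * t) = dim s + dim t := by
  induction s using Quotient.ind
  induction t using Quotient.ind
  exact @dim_prod _ _ hs ht

theorem lrk_mul {s t : IsoType} (hs : IsFin s) (ht : IsFin t) : lrk (s * t) = lrk s + lrk t := by
  induction s using Quotient.ind
  induction t using Quotient.ind
  exact @lrk_prod _ _ hs ht

theorem nondeg_mul_iff {s t : IsoType} : Nondeg (s * t) ↔ Nondeg s ∧ Nondeg t := by
  induction s using Quotient.ind
  induction t using Quotient.ind
  exact prod_degenerate_iff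

theorem negOne_mul_iff {s t : IsoType} : NegOne (s * t) ↔ NegOne s ∧ NegOne t := by
  induction s using Quotient.ind
  induction t using Quotient.ind
  exact prod_neg_eq_one_iff

theorem elem_mul {s t : IsoType} (hs : Elem s) (ht : Elem t) : Elem (s * t) := by
  induction s using Quotient.ind
  induction t using Quotient.ind
  exact .prod _ _ hs ht

theorem eq_one_iff_not_pos {t : IsoType} : t = 1 ↔ ¬ Pos t := by
  induction t using Quotient.ind with | _ S
  change _ = Quotient.mk isoSetoid L0 ↔ ¬ Nontrivial S.G
  rw [mk_eq_iff, not_nontrivial_iff_subsingleton]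
  exact ⟨fun h => not_nontrivial_iff_subsingleton.1
    (fun hS => @not_subsingleton L0.G (h.nontrivial_iff.1 hS) inferInstance),
    fun _ => iso_of_subsingleton⟩

theorem pos_iff {t : IsoType} : Pos t ↔ t ≠ 1 := by rw [Ne, eq_one_iff_not_pos, not_not]

theorem indec_iff {t : IsoType} :
    Indec t ↔ t ≠ 1 ∧ ∀ s u, t = s * u → s = 1 ∨ u = 1 := by
  rw [← pos_iff]
  induction t using Quotient.ind with | _ S
  change S.Indecomposable ↔ Nontrivial S.G ∧ _
  simp only [Indecomposable, one_le_order_iff]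
  refine and_congr_right' ⟨?_, ?_⟩
  · intro h s u hsu
    by_contra hc
    rw [not_or, ← Ne, ← Ne, ← pos_iff, ← pos_iff] at hc
    induction s using Quotient.ind with | _ A
    induction u using Quotient.ind with | _ B
    exact h ⟨A, B, hc.1, hc.2, mk_eq_iff.1 hsu⟩
  · rintro h ⟨A, B, hA, hB, hS⟩
    rcases h (Quotient.mk _ A) (Quotient.mk _ B) (mk_eq_iff.2 hS) with h | h
    · exact pos_iff.1 (show Pos (Quotient.mk _ A) from hA) h
    · exact pos_iff.1 (show Pos (Quotient.mk _ B) from hB) h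

theorem fin_one : IsFin 1 := inferInstanceAs (Finite Unit)

theorem elem_one : Elem 1 := .l0

theorem nondeg_one : Nondeg 1 :=
  not_degenerate_iff.2 fun _ _ => Subsingleton.elim (α := L0.G) _ _

theorem dim_one : dim 1 = 0 := dim_eq_of_card (S := L0) (Nat.card_unique (α := Unit))

theorem dim_eq_zero_iff {t : IsoType} (ht : IsFin t) : dim t = 0 ↔ t = 1 := by
  rw [eq_one_iff_not_pos]
  induction t using Quotient.ind with | _ S
  have : Finite S.G := ht
  exact S.dim_eq_zero_iff.trans not_nontrivial_iff_subsingleton.symm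

theorem lrk_one : lrk 1 = 0 := by
  have := lrk_mul fin_one fin_one
  rw [mul_one] at this
  omega

/-- Any a ≠ 1 lies outside the radical, so V(a) is a proper subgroup. This is the source of e_k(n) =
0 for k ≥ n. -/
theorem lrk_lt_dim {t : IsoType} (ht : IsFin t) (hn : Nondeg t) (h1 : t ≠ 1) : lrk t < dim t := by
  rw [← pos_iff] at h1
  induction t using Quotient.ind with | _ S
  have : Finite S.G := ht
  obtain ⟨a, ha⟩ := @exists_ne _ h1 (1 : S.G)
  change S.lrk < S.dim
  have hn' := not_degenerate_iff.1 hn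
  refine (Nat.pow_lt_pow_iff_right (a := 2) one_lt_two).1 ?_
  refine (S.two_pow_lrk_le a).trans_lt ?_
  rw [← S.card_eq]
  refine lt_of_le_of_ne (Subgroup.card_le_card_group _) fun h => ha (hn' a fun x => ?_)
  have := (S.V a).eq_top_of_card_eq h
  have hx : x ∈ S.V a := this ▸ Subgroup.mem_top x
  exact hx

end IsoType

/-! ### Homomorphisms of direct products -/

/-- The first projection of a direct product. -/
def fst (S T : QuatStr) : (S.prod T).G →* S.G := MonoidHom.fst S.G T.G

/-- The second projection of a direct product. -/
def snd (S T : QuatStr) : (S.prod T).G →* T.G := MonoidHom.snd S.G T.G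

/-- The first inclusion into a direct product. -/
def inl (S T : QuatStr) : S.G →* (S.prod T).G := MonoidHom.inl S.G T.G

/-- The second inclusion into a direct product. -/
def inr (S T : QuatStr) : T.G →* (S.prod T).G := MonoidHom.inr S.G T.G

/-- The homomorphism into a direct product with given components. -/
def pair {G : Type} [CommGroup G] {S T : QuatStr} (φ : G →* S.G) (ψ : G →* T.G) :
    G →* (S.prod T).G := MonoidHom.prod φ ψ

section

variable {S T : QuatStr}

@[simp] theorem fst_inl (a : S.G) : fst S T (inl S T a) = a := rfl
@[simp] theorem snd_inl (a : S.G) : snd S T (inl S T a) = 1 := rfl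
@[simp] theorem fst_inr (a : T.G) : fst S T (inr S T a) = 1 := rfl
@[simp] theorem snd_inr (a : T.G) : snd S T (inr S T a) = a := rfl
@[simp] theorem fst_neg : fst S T (S.prod T).neg = S.neg := rfl
@[simp] theorem snd_neg : snd S T (S.prod T).neg = T.neg := rfl

@[simp] theorem fst_pair {G : Type} [CommGroup G] (φ : G →* S.G) (ψ : G →* T.G) (a : G) :
    fst S T (pair φ ψ a) = φ a := rfl

@[simp] theorem snd_pair {G : Type} [CommGroup G] (φ : G →* S.G) (ψ : G →* T.G) (a : G) :
    snd S T (pair φ ψ a) = ψ a := rfl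

theorem prod_ext {a b : (S.prod T).G} (h : fst S T a = fst S T b) (h' : snd S T a = snd S T b) :
    a = b := Prod.ext h h'

theorem inl_mul_inr (a : (S.prod T).G) : inl S T (fst S T a) * inr S T (snd S T a) = a :=
  prod_ext (by simp) (by simp)

theorem prod_q_iff {a b : (S.prod T).G} : (S.prod T).q a b = (S.prod T).zero ↔
    S.q (fst S T a) (fst S T b) = S.zero ∧ T.q (snd S T a) (snd S T b) = T.zero :=
  Prod.ext_iff

theorem iso_of_homs (φ : S.G →* T.G) (ψ : T.G →* S.G) (h : ∀ x, ψ (φ x) = x)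
    (h' : ∀ x, φ (ψ x) = x) (hneg : φ S.neg = T.neg)
    (hq : ∀ a b, S.q a b = S.zero ↔ T.q (φ a) (φ b) = T.zero) : S.Iso T :=
  ⟨φ.toMulEquiv ψ (MonoidHom.ext h) (MonoidHom.ext h'), hneg, hq⟩

end

/-! ### Direct factors and unique factorization -/

/-- An idempotent endomorphism of the group that preserves the zero relation in each argument:
the projection to a direct factor. -/
structure IsProj (S : QuatStr) (e : S.G →* S.G) : Prop where
  idem : ∀ x, e (e x) = e x
  zero : ∀ x y, S.q x y = S.zero → S.q (e x) y = S.zero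

namespace IsProj

variable {S : QuatStr} {e f g : S.G →* S.G}

theorem zero_right (he : S.IsProj e) (x y : S.G) (h : S.q x y = S.zero) :
    S.q x (e y) = S.zero := by
  rw [S.q2] at *
  exact he.zero _ _ h

theorem eq_of_mem_range (he : S.IsProj e) (x : e.range) : e x = x := by
  obtain ⟨_, y, rfl⟩ := x
  exact he.idem y

theorem compl (he : S.IsProj e) : S.IsProj (MonoidHom.id S.G * e) where
  idem x := by simp [he.idem, S.mul_self]
  zero x y h := S.mul_q_eq_zero h (he.zero x y h)

theorem compl_apply (x : S.G) : (MonoidHom.id S.G * e) x = x * e x := rfl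

theorem comp (he : S.IsProj e) (hf : S.IsProj f) (h : ∀ x, e (f x) = f (e x)) :
    S.IsProj (e.comp f) where
  idem x := by simp [← h, he.idem, hf.idem]
  zero x y hxy := he.zero _ _ (hf.zero _ _ hxy)

/-- Complementary direct factors annihilate each other. -/
theorem orthogonal (he : S.IsProj e) (hf : S.IsProj f) (hef : ∀ x, e (f x) = 1)
    (hfe : ∀ x, f (e x) = 1) (a b : S.G) : S.q (e a) (f b) = S.zero := by
  have h1 : ∀ a, S.q (e a) (f S.neg) = S.zero := fun a => by
    simpa [hfe] using hf.zero_right _ _ (S.q1 (e a))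
  -- Projecting q(z, -z) = 0 for z = e(a)f(b) by e on the left and by f on the right gives q(e(a),
  -- f(-1)f(b)) = 0. The factor f(-1) is removed by `h1`.
  have h2 := hf.zero_right _ _ (he.zero _ _ (S.q1 (e a * f b)))
  simp only [map_mul, he.idem, hf.idem, hef, hfe, mul_one, one_mul] at h2
  have h3 := S.q_mul_eq_zero (h1 a) h2
  rwa [S.mul_mul_cancel_self] at h3

/-- With c the complement of e, the element c(f(e(a))) is orthogonal to the image of e, because c
and e are complementary. It is also orthogonal to the image of c: q(e(a), c(z)) = 0 survives the
application of f and then of c on the left. It thus lies in the radical and is 1, so f preserves the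
image of e. -/
theorem comm (hS : ¬ S.Degenerate) (he : S.IsProj e) (hf : S.IsProj f) (x : S.G) :
    e (f x) = f (e x) := by
  rw [not_degenerate_iff] at hS
  have key : ∀ {e : S.G →* S.G}, S.IsProj e → ∀ a, e (f (e a)) = f (e a) := by
    intro e he a
    have hc := he.compl
    have h1 : ∀ x, e ((MonoidHom.id S.G * e) x) = 1 := fun x => by
      simp [he.idem, S.mul_self]
    have h2 : ∀ x, (MonoidHom.id S.G * e) (e x) = 1 := fun x => by
      simp [he.idem, S.mul_self]
    have h3 : (MonoidHom.id S.G * e) (f (e a)) = 1 := by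
      refine hS _ fun z => ?_
      have hz : z = e z * (MonoidHom.id S.G * e) z := by
        rw [compl_apply, mul_left_comm, S.mul_self, mul_one]
      rw [hz]
      exact S.q_mul_eq_zero (orthogonal hc he h2 h1 _ _)
        (hc.zero _ _ (hf.zero _ _ (orthogonal he hc h1 h2 _ _)))
    rw [compl_apply] at h3
    exact ((S.mul_eq_one_iff_eq _ _).1 h3).symm
  -- The map f preserves the image of e and, by the same argument, the image of its complement;
  -- together these mean that f commutes with e.
  have h1 := key he x
  have h2 := key he.compl x
  rw [compl_apply (f _), mul_eq_left, compl_apply, map_mul, map_mul, h1] at h2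
  exact (S.mul_eq_one_iff_eq _ _).1 h2

end IsProj

/-- The direct factor that is the image of a projection. -/
def factor (S : QuatStr) (e : S.G →* S.G) (he : S.IsProj e) : QuatStr where
  G := e.range
  Q := {z : S.Q // ∃ a b : e.range, S.q a b = z}
  mul_self a := Subtype.ext (S.mul_self a)
  neg := ⟨e S.neg, S.neg, rfl⟩
  zero := ⟨S.zero, 1, 1, S.q_one 1⟩
  q a b := ⟨S.q a b, a, b, rfl⟩
  surj := by
    rintro ⟨z, a, b, h⟩
    exact ⟨a, b, Subtype.ext h⟩
  q1 a := Subtype.ext (by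
    have := he.zero_right _ _ (S.q1 a)
    rwa [map_mul, he.eq_of_mem_range] at this)
  q2 a b := Subtype.ext (S.q2 a b)
  q3 a b c := by
    simp only [Subtype.mk.injEq]
    exact S.q3 a b c
  q4 a b c d := by
    simp only [Subtype.mk.injEq]
    constructor
    · intro h
      -- A linking element x of the ambient structure can be replaced by its projection e(x):
      -- equality of quaternions with a common slot is a vanishing statement, and e preserves that.
      obtain ⟨x, h1, -, h3⟩ := (S.q4 _ _ _ _).1 h
      rw [S.q3] at h1 h3
      have h1' := he.zero_right _ _ h1
      have h3' := he.zero_right _ _ h3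
      rw [map_mul, he.eq_of_mem_range] at h1' h3'
      rw [← S.q3] at h1' h3'
      exact ⟨⟨e x, x, rfl⟩, h1', (h1'.symm.trans h).trans h3'.symm, h3'⟩
    · rintro ⟨x, h1, h2, h3⟩
      exact h1.trans (h2.trans h3)

/-- The inclusion of a direct factor. -/
def factorVal {S : QuatStr} {e : S.G →* S.G} (he : S.IsProj e) : (S.factor e he).G →* S.G :=
  e.range.subtype

/-- The projection onto a direct factor. -/
def factorMk {S : QuatStr} {e : S.G →* S.G} (he : S.IsProj e) : S.G →* (S.factor e he).G :=
  e.rangeRestrict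

section

variable {S : QuatStr} {e : S.G →* S.G} {he : S.IsProj e}

theorem factorVal_factorMk (x : S.G) : factorVal he (factorMk he x) = e x := rfl

theorem apply_factorVal (x : (S.factor e he).G) : e (factorVal he x) = factorVal he x :=
  he.eq_of_mem_range x

theorem factorVal_injective : Function.Injective (factorVal he) := Subtype.val_injective

theorem factor_neg : (S.factor e he).neg = factorMk he S.neg := rfl

theorem factor_q_iff {a b : (S.factor e he).G} :
    (S.factor e he).q a b = (S.factor e he).zero ↔
      S.q (factorVal he a) (factorVal he b) = S.zero :=
  Subtype.ext_iff

end

/-- The group decomposes because e and f are orthogonal idempotents with product k. For the zero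
relation, the mixed terms vanish by `IsProj.orthogonal`, so only the two diagonal terms remain. -/
theorem factor_mul_iso {S : QuatStr} {e f k : S.G →* S.G} (he : S.IsProj e) (hf : S.IsProj f)
    (hk : S.IsProj k) (hef : ∀ x, e (f x) = 1) (hfe : ∀ x, f (e x) = 1)
    (h : ∀ x, k x = e x * f x) :
    (S.factor k hk).Iso ((S.factor e he).prod (S.factor f hf)) := by
  have hef' : ∀ x, e (factorVal hf x) = 1 := fun x => by rw [← apply_factorVal, hef]
  have hfe' : ∀ x, f (factorVal he x) = 1 := fun x => by rw [← apply_factorVal, hfe]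
  have hke : ∀ x, k (factorVal he x) = factorVal he x := fun x => by
    rw [h, hfe', mul_one, apply_factorVal]
  have hkf : ∀ x, k (factorVal hf x) = factorVal hf x := fun x => by
    rw [h, hef', one_mul, apply_factorVal]
  refine iso_of_homs (pair ((factorMk he).comp (factorVal hk)) ((factorMk hf).comp (factorVal hk)))
    (((factorMk hk).comp (factorVal he)).comp (fst _ _) *
      ((factorMk hk).comp (factorVal hf)).comp (snd _ _)) ?_ ?_ ?_ ?_
  · intro x
    refine factorVal_injective ?_
    simp only [MonoidHom.mul_apply, MonoidHom.comp_apply, fst_pair, snd_pair, map_mul,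
      factorVal_factorMk]
    rw [← map_mul, ← h, apply_factorVal, apply_factorVal]
  · intro x
    refine prod_ext (factorVal_injective ?_) (factorVal_injective ?_) <;>
    simp only [MonoidHom.mul_apply, MonoidHom.comp_apply, fst_pair, snd_pair, map_mul,
      factorVal_factorMk, hke, hkf, hef', hfe', apply_factorVal, mul_one, one_mul]
  · refine prod_ext (factorVal_injective ?_) (factorVal_injective ?_) <;>
    simp only [MonoidHom.comp_apply, fst_pair, snd_pair, map_mul, factor_neg, fst_neg, snd_neg,
      factorVal_factorMk, h, hef, hfe, he.idem, hf.idem, mul_one, one_mul]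
  · intro x y
    rw [prod_q_iff, factor_q_iff, factor_q_iff, factor_q_iff]
    simp only [MonoidHom.comp_apply, fst_pair, snd_pair, factorVal_factorMk]
    constructor
    · exact fun h => ⟨he.zero _ _ (he.zero_right _ _ h), hf.zero _ _ (hf.zero_right _ _ h)⟩
    · rintro ⟨h1, h2⟩
      rw [← apply_factorVal x, ← apply_factorVal y, h, h]
      exact S.mul_q_eq_zero
        (S.q_mul_eq_zero h1 (IsProj.orthogonal he hf hef hfe _ _))
        (S.q_mul_eq_zero (IsProj.orthogonal hf he hfe hef _ _) h2)

/-- The projections are the coordinate projections of the product, transported along the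
isomorphism. -/
theorem exists_isProj_of_prod_iso {A B S : QuatStr} (h : (A.prod B).Iso S) :
    ∃ (e f : S.G →* S.G) (he : S.IsProj e) (hf : S.IsProj f), (∀ x, e x * f x = x) ∧
      A.Iso (S.factor e he) ∧ B.Iso (S.factor f hf) := by
  obtain ⟨φ, hneg, hφ⟩ := h
  let e : S.G →* S.G :=
    ((φ.toMonoidHom.comp (inl A B)).comp (fst A B)).comp φ.symm.toMonoidHom
  let f : S.G →* S.G :=
    ((φ.toMonoidHom.comp (inr A B)).comp (snd A B)).comp φ.symm.toMonoidHom
  have hex : ∀ x, e (φ x) = φ (inl A B (fst A B x)) := fun x => by simp [e]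
  have hfx : ∀ x, f (φ x) = φ (inr A B (snd A B x)) := fun x => by simp [f]
  have he : S.IsProj e := by
    constructor <;> intro x
    · obtain ⟨x, rfl⟩ := φ.surjective x
      rw [hex, hex, fst_inl]
    · intro y hxy
      obtain ⟨x, rfl⟩ := φ.surjective x
      obtain ⟨y, rfl⟩ := φ.surjective y
      rw [← hφ, prod_q_iff] at hxy
      rw [hex, ← hφ, prod_q_iff, fst_inl, snd_inl]
      exact ⟨hxy.1, B.one_q _⟩
  have hf : S.IsProj f := by
    constructor <;> intro x
    · obtain ⟨x, rfl⟩ := φ.surjective x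
      rw [hfx, hfx, snd_inr]
    · intro y hxy
      obtain ⟨x, rfl⟩ := φ.surjective x
      obtain ⟨y, rfl⟩ := φ.surjective y
      rw [← hφ, prod_q_iff] at hxy
      rw [hfx, ← hφ, prod_q_iff, fst_inr, snd_inr]
      exact ⟨A.one_q _, hxy.2⟩
  refine ⟨e, f, he, hf, fun x => ?_, ?_, ?_⟩
  · obtain ⟨x, rfl⟩ := φ.surjective x
    rw [hex, hfx, ← map_mul, inl_mul_inr]
  · refine iso_of_homs ((factorMk he).comp (φ.toMonoidHom.comp (inl A B)))
      (((fst A B).comp φ.symm.toMonoidHom).comp (factorVal he)) (fun x => ?_) (fun x => ?_) ?_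
      fun x y => ?_
    · simp [factorVal_factorMk, hex]
    · refine factorVal_injective ?_
      simp only [MonoidHom.comp_apply, factorVal_factorMk]
      rw [← apply_factorVal x]
      obtain ⟨x, hx⟩ := φ.surjective (factorVal he x)
      simp [← hx, hex]
    · refine factorVal_injective ?_
      simp [factorVal_factorMk, hex, factor_neg, ← hneg]
    · rw [factor_q_iff]
      simp [factorVal_factorMk, hex, ← hφ, prod_q_iff, q_one]
  · refine iso_of_homs ((factorMk hf).comp (φ.toMonoidHom.comp (inr A B)))
      (((snd A B).comp φ.symm.toMonoidHom).comp (factorVal hf)) (fun x => ?_) (fun x => ?_) ?_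
      fun x y => ?_
    · simp [factorVal_factorMk, hfx]
    · refine factorVal_injective ?_
      simp only [MonoidHom.comp_apply, factorVal_factorMk]
      rw [← apply_factorVal x]
      obtain ⟨x, hx⟩ := φ.surjective (factorVal hf x)
      simp [← hx, hfx]
    · refine factorVal_injective ?_
      simp [factorVal_factorMk, hfx, factor_neg, ← hneg]
    · rw [factor_q_iff]
      simp [factorVal_factorMk, hfx, ← hφ, prod_q_iff, q_one]

namespace IsoType

/-- Common refinement of two decompositions of a nondegenerate structure. -/
theorem refinement {a b c d : IsoType} (h : a * b = c * d) (hn : Nondeg (a * b)) :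
    ∃ x y z w, a = x * y ∧ b = z * w ∧ c = x * z ∧ d = y * w := by
  induction a using Quotient.ind with | _ A
  induction b using Quotient.ind with | _ B
  induction c using Quotient.ind with | _ C
  induction d using Quotient.ind with | _ D
  replace hn : ¬ (A.prod B).Degenerate := hn
  obtain ⟨e, f, he, hf, hef, hA, hB⟩ := exists_isProj_of_prod_iso (Iso.refl (A.prod B))
  obtain ⟨g, k, hg, hk, hgk, hC, hD⟩ := exists_isProj_of_prod_iso (mk_eq_iff.1 h).symm
  have key : ∀ {e g k : (A.prod B).G →* (A.prod B).G} (he : (A.prod B).IsProj e)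
      (hg : (A.prod B).IsProj g) (hk : (A.prod B).IsProj k) (hgk : ∀ x, g x * k x = x)
      (heg : (A.prod B).IsProj (e.comp g)) (hek : (A.prod B).IsProj (e.comp k)),
      (factor _ _ he).Iso ((factor _ _ heg).prod (factor _ _ hek)) := by
    intro e g k he hg hk hgk heg hek
    have hgk1 : ∀ x, g (k x) = 1 := fun x => by
      have := hgk (k x)
      rwa [hk.idem, mul_eq_right] at this
    have hkg1 : ∀ x, k (g x) = 1 := fun x => by
      have := hgk (g x)
      rwa [hg.idem, mul_eq_left] at this
    refine factor_mul_iso heg hek he (fun x => ?_) (fun x => ?_) (fun x => ?_)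
    · simp only [MonoidHom.comp_apply]
      rw [IsProj.comm hn he hk, hgk1, map_one]
    · simp only [MonoidHom.comp_apply]
      rw [IsProj.comm hn he hg, hkg1, map_one]
    · simp only [MonoidHom.comp_apply]
      rw [← map_mul, hgk]
  have hcomm : ∀ {e g : (A.prod B).G →* (A.prod B).G}, (A.prod B).IsProj e →
      (A.prod B).IsProj g → e.comp g = g.comp e :=
    fun he hg => MonoidHom.ext fun x => IsProj.comm hn he hg x
  -- The pieces of the refinement are the images of the four products of a projection from one
  -- decomposition with one from the other. Commutativity makes these products projections, and
  -- makes each piece a factor from both sides.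
  have heg := he.comp hg (IsProj.comm hn he hg)
  have hek := he.comp hk (IsProj.comm hn he hk)
  have hfg := hf.comp hg (IsProj.comm hn hf hg)
  have hfk := hf.comp hk (IsProj.comm hn hf hk)
  refine ⟨Quotient.mk _ (factor _ _ heg), Quotient.mk _ (factor _ _ hek),
    Quotient.mk _ (factor _ _ hfg), Quotient.mk _ (factor _ _ hfk), ?_, ?_, ?_, ?_⟩ <;>
    rw [mk_mul, mk_eq_iff]
  · exact hA.trans (key he hg hk hgk heg hek)
  · exact hB.trans (key hf hg hk hgk hfg hfk)
  · simp only [hcomm he hg, hcomm hf hg]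
    exact hC.trans (key hg he hf hef _ _)
  · simp only [hcomm he hk, hcomm hf hk]
    exact hD.trans (key hk he hf hef _ _)

theorem eq_one_of_mul_eq_one {s t : IsoType} (h : s * t = 1) : s = 1 := by
  rw [eq_one_iff_not_pos] at *
  induction s using Quotient.ind with | _ S
  induction t using Quotient.ind with | _ T
  intro hS
  have : Nontrivial S.G := hS
  exact h (inferInstanceAs (Nontrivial (S.G × T.G)))

/-- Indecomposables are prime. Refine p * a = q * (rest) with p = x * y and q = x * z. If x = 1,
then p divides the rest and induction applies; if y = 1, then p divides q, and indecomposability of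
q forces p = q. -/
theorem exists_cons_of_mul_eq_prod {p a : IsoType} (hp : Indec p) (hn : Nondeg (p * a))
    {N : Multiset IsoType} (hN : ∀ t ∈ N, Indec t) (h : p * a = N.prod) :
    ∃ N', N = p ::ₘ N' ∧ a = N'.prod := by
  induction N using Multiset.induction_on generalizing a with
  | empty =>
    rw [Multiset.prod_zero] at h
    exact absurd (eq_one_of_mul_eq_one h) (indec_iff.1 hp).1
  | cons q N ih =>
    rw [Multiset.prod_cons] at h
    obtain ⟨x, y, z, w, rfl, rfl, rfl, h4⟩ := refinement h hn
    have hq := (indec_iff.1 (hN _ (Multiset.mem_cons_self _ _))).2 _ _ rfl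
    rcases (indec_iff.1 hp).2 _ _ rfl with rfl | rfl
    · rw [one_mul] at *
      obtain ⟨N', rfl, rfl⟩ := ih (a := w) (by
          rw [mul_left_comm, nondeg_mul_iff] at hn
          exact hn.2)
        (fun t ht => hN t (Multiset.mem_cons_of_mem ht)) h4.symm
      exact ⟨z ::ₘ N', by rw [one_mul, Multiset.cons_swap], (Multiset.prod_cons _ _).symm⟩
    · have hx := (indec_iff.1 hp).1
      rw [mul_one] at *
      rcases hq with rfl | rfl
      · exact absurd rfl hx
      · exact ⟨N, by rw [mul_one], by rw [h4]⟩

/-- Unique factorization into indecomposables. -/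
theorem eq_of_prod_eq {M N : Multiset IsoType} (hM : ∀ t ∈ M, Indec t ∧ Nondeg t)
    (hN : ∀ t ∈ N, Indec t) (h : M.prod = N.prod) : M = N := by
  induction M using Multiset.induction_on generalizing N with
  | empty =>
    rw [Multiset.prod_zero] at h
    induction N using Multiset.induction_on with
    | empty => rfl
    | cons q N _ =>
      rw [Multiset.prod_cons] at h
      exact absurd (eq_one_of_mul_eq_one h.symm)
        (indec_iff.1 (hN _ (Multiset.mem_cons_self _ _))).1
  | cons p M ih =>
    have hn : Nondeg (p ::ₘ M).prod :=
      Multiset.prod_induction Nondeg _ (fun _ _ h h' => nondeg_mul_iff.2 ⟨h, h'⟩) nondeg_one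
        fun t ht => (hM t ht).2
    rw [Multiset.prod_cons] at h hn
    obtain ⟨N', rfl, h'⟩ :=
      exists_cons_of_mul_eq_prod (hM _ (Multiset.mem_cons_self _ _)).1 hn hN h
    rw [ih (fun t ht => hM t (Multiset.mem_cons_of_mem ht))
      (fun t ht => hN t (Multiset.mem_cons_of_mem ht)) h']

end IsoType
/-! ### Group extensions -/

/-- The inclusion of a structure into its group extension. -/
def extInl (S : QuatStr) : S.G →* S.groupExt.G := MonoidHom.inl S.G C2

/-- The projection of a group extension `G × {1, x}` to `G`. -/
def extFst (S : QuatStr) : S.groupExt.G →* S.G := MonoidHom.fst S.G C2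

/-- The projection of a group extension `G × {1, x}` to `{1, x}`. -/
def extSnd (S : QuatStr) : S.groupExt.G →* C2 := MonoidHom.snd S.G C2

theorem c2_mul_eq_one {a b : C2} (ha : a ≠ 1) (hb : b ≠ 1) : a * b = 1 := by
  rw [(c2_cases a).resolve_left ha, (c2_cases b).resolve_left hb, gen_mul_gen]

section

variable {S : QuatStr}

@[simp] theorem extFst_extInl (a : S.G) : extFst S (extInl S a) = a := rfl
@[simp] theorem extSnd_extInl (a : S.G) : extSnd S (extInl S a) = 1 := rfl

theorem extInl_injective : Function.Injective (extInl S) :=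
  Function.LeftInverse.injective extFst_extInl

theorem extInl_extFst {y : S.groupExt.G} (h : extSnd S y = 1) : extInl S (extFst S y) = y :=
  Prod.ext rfl h.symm

theorem groupExt_neg : S.groupExt.neg = extInl S S.neg := rfl

theorem exists_extSnd_ne_one (S : QuatStr) : ∃ y, extSnd S y ≠ 1 :=
  ⟨((1, Multiplicative.ofAdd 1) : S.G × C2), by
    change (Multiplicative.ofAdd 1 : C2) ≠ 1
    decide⟩

theorem groupExt_q_iff {A B : S.groupExt.G} :
    S.groupExt.q A B = S.groupExt.zero ↔
      S.q A.1 B.1 = S.zero ∧ (S.extMap A B).2 = 1 :=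
  Subtype.ext_iff.trans Prod.ext_iff

theorem groupExt_q_extInl {a b : S.G} :
    S.groupExt.q (extInl S a) (extInl S b) = S.groupExt.zero ↔ S.q a b = S.zero := by
  rw [groupExt_q_iff]
  refine and_iff_left ?_
  change S.pw (S.pw S.neg 1) 1 * S.pw a 1 * S.pw b 1 = 1
  simp [pw_one]

/-- The second coordinate of q_x(ax, b) is b and that of q_x(ax, bx) is -ab, so its vanishing
already determines z. All later facts about group extensions rest on this rigidity. -/
theorem eq_of_groupExt_q_eq_zero {y z : S.groupExt.G} (hy : extSnd S y ≠ 1)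
    (h : S.groupExt.q y z = S.groupExt.zero) : z = 1 ∨ z = S.groupExt.neg * y := by
  rw [groupExt_q_iff] at h
  obtain ⟨a, α⟩ := y
  obtain ⟨b, β⟩ := z
  obtain rfl := (c2_cases α).resolve_left hy
  replace h : S.pw (S.pw S.neg (Multiplicative.ofAdd 1)) β * S.pw a β *
    S.pw b (Multiplicative.ofAdd 1) = 1 := h.2
  rcases c2_cases β with rfl | rfl
  · left
    simp only [pw_one, pw_gen, one_mul] at h
    exact Prod.ext h rfl
  · right
    simp only [pw_gen] at h
    exact Prod.ext ((S.mul_eq_one_iff_eq _ _).1 h).symm (one_mul _).symm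

theorem groupExt_q_eq_zero_iff {y z : S.groupExt.G} (hy : extSnd S y ≠ 1) :
    S.groupExt.q y z = S.groupExt.zero ↔ z = 1 ∨ z = S.groupExt.neg * y := by
  refine ⟨eq_of_groupExt_q_eq_zero hy, ?_⟩
  rintro (rfl | rfl)
  · exact q_one _ _
  · exact q1 _ _

theorem extSnd_neg_mul (y : S.groupExt.G) : extSnd S (S.groupExt.neg * y) = extSnd S y := by
  rw [groupExt_neg, map_mul, extSnd_extInl, one_mul]

instance [Finite S.G] : Finite S.groupExt.G := inferInstanceAs (Finite (S.G × C2))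

theorem card_groupExt (S : QuatStr) : Nat.card S.groupExt.G = 2 * Nat.card S.G :=
  (Nat.card_prod S.G C2).trans (by
    rw [mul_comm]
    congr 1
    exact (Nat.card_eq_fintype_card).trans (ZMod.card 2))

theorem dim_groupExt (S : QuatStr) [Finite S.G] : S.groupExt.dim = S.dim + 1 :=
  dim_eq_of_card (by rw [card_groupExt, S.card_eq, pow_succ, mul_comm])

end

theorem Iso.groupExt {S T : QuatStr} (h : S.Iso T) : S.groupExt.Iso T.groupExt := by
  obtain ⟨φ, h, hφ⟩ := h
  have hpw : ∀ a α, φ (S.pw a α) = T.pw (φ a) α := fun a α => map_pow φ a _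
  refine ⟨φ.prodCongr (MulEquiv.refl C2), Prod.ext h rfl, fun A B => ?_⟩
  rw [groupExt_q_iff, groupExt_q_iff]
  refine and_congr (hφ _ _) ?_
  rw [← φ.map_eq_one_iff]
  change φ (S.pw (S.pw S.neg A.2) B.2 * S.pw A.1 B.2 * S.pw B.1 A.2) = 1 ↔
    T.pw (T.pw T.neg A.2) B.2 * T.pw (φ A.1) B.2 * T.pw (φ B.1) A.2 = 1
  simp only [map_mul, hpw, h]

/-- A finite structure is determined by its group extension. -/
theorem iso_of_groupExt_iso {S T : QuatStr} [Finite S.G] (h : S.groupExt.Iso T.groupExt) :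
    S.Iso T := by
  have hcard : Nat.card S.G = Nat.card T.G := by
    have := h.card_eq
    rw [card_groupExt, card_groupExt] at this
    omega
  obtain ⟨φ, hneg, hφ⟩ := h
  have : Finite T.G := Nat.finite_of_card_ne_zero (hcard ▸ Nat.card_pos.ne')
  let M := S.groupExt
  -- The kernel of χ is the preimage of the group of T. Elements outside it have value group {1,
  -- -y}, as do the elements outside the group of S.
  let χ : M.G →* C2 := (extSnd T).comp φ.toMonoidHom
  have hχφ : ∀ y, χ y = extSnd T (φ y) := fun y => rfl
  have hχneg : ∀ y, χ (M.neg * y) = χ y := fun y => by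
    rw [hχφ, hχφ, map_mul, hneg, extSnd_neg_mul]
  have hχ : ∀ {y z}, χ y ≠ 1 → (M.q y z = M.zero ↔ z = 1 ∨ z = M.neg * y) := by
    intro y z hy
    rw [hφ, groupExt_q_eq_zero_iff (y := φ y) hy, φ.map_eq_one_iff, ← hneg, ← map_mul, φ.injective.eq_iff]
  -- an element that lies outside both index two subgroups unless these agree
  obtain ⟨w, hw⟩ : ∃ w : M.G, (∀ a : S.G, χ (extInl S a) ≠ 1 →
      extSnd S w ≠ 1 ∧ χ w ≠ 1) := by
    by_cases hc : ∃ a : S.G, χ (extInl S a) ≠ 1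
    · obtain ⟨a, ha⟩ := hc
      obtain ⟨z, hz⟩ := exists_extSnd_ne_one S
      by_cases hz' : χ z = 1
      · exact ⟨extInl S a * z, fun _ _ => ⟨by rwa [map_mul, extSnd_extInl, one_mul],
          by rwa [map_mul, hz', mul_one]⟩⟩
      · exact ⟨z, fun _ _ => ⟨hz, hz'⟩⟩
    · exact ⟨1, fun a ha => absurd ⟨a, ha⟩ hc⟩
  have hpw : ∀ α, (α = 1 → M.pw w α = 1) ∧ (α ≠ 1 → M.pw w α = w) := fun α =>
    ⟨by rintro rfl; exact pw_one _ _, fun h => by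
      rw [(c2_cases α).resolve_left h]; exact pw_gen _ _⟩
  -- This map carries the group of S into the kernel of χ: it fixes the intersection and multiplies
  -- the remaining elements by w, which lies outside both subgroups. If there are no remaining
  -- elements, w plays no role.
  let g : S.G → M.G := fun a => extInl S a * M.pw w (χ (extInl S a))
  have g1 : ∀ {a}, χ (extInl S a) = 1 → g a = extInl S a := fun {a} h => by
    simp only [g, (hpw _).1 h, mul_one]
  have g2 : ∀ {a}, χ (extInl S a) ≠ 1 → g a = extInl S a * w := fun {a} h => by
    simp only [g, (hpw _).2 h]
  have hgχ : ∀ a, χ (g a) = 1 := fun a => by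
    by_cases h : χ (extInl S a) = 1
    · rw [g1 h, h]
    · rw [g2 h, map_mul, c2_mul_eq_one h (hw a h).2]
  have hgS : ∀ {a}, χ (extInl S a) ≠ 1 → extSnd S (g a) ≠ 1 := fun {a} h => by
    rw [g2 h, map_mul, extSnd_extInl, one_mul]
    exact (hw a h).1
  have hg1 : ∀ a, g a = 1 ↔ a = 1 := fun a => by
    constructor
    · intro hga
      by_cases h : χ (extInl S a) = 1
      · rw [g1 h] at hga
        exact extInl_injective (hga.trans (map_one _).symm)
      · exact absurd (by rw [hga, map_one]) (hgS h)
    · rintro rfl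
      rw [g1] <;> simp
  have hgmul : ∀ a b, g (a * b) = g a * g b := fun a b => by
    by_cases ha : χ (extInl S a) = 1 <;> by_cases hb : χ (extInl S b) = 1
    · rw [g1 ha, g1 hb, g1, map_mul]
      rw [map_mul, map_mul, ha, hb, one_mul]
    · rw [g1 ha, g2 hb, g2, map_mul, mul_assoc]
      rwa [map_mul, map_mul, ha, one_mul]
    · rw [g2 ha, g1 hb, g2, map_mul, mul_right_comm]
      rwa [map_mul, map_mul, hb, mul_one]
    · rw [g2 ha, g2 hb, g1, map_mul, mul_mul_mul_comm, M.mul_self, mul_one]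
      rw [map_mul, map_mul, c2_mul_eq_one ha hb]
  have hgneg : g S.neg = M.neg := by
    rw [g1]
    · rfl
    · have := hχneg 1
      rwa [map_one, mul_one] at this
  -- Both conditions amount to a = 1. The element b is rigid by χ and g(b) is rigid by `extSnd`,
  -- while a = -b or g(a) = -g(b) is excluded because the corresponding character takes different
  -- values on the two sides.
  have mixed : ∀ a b, χ (extInl S a) = 1 → χ (extInl S b) ≠ 1 →
      (S.q a b = S.zero ↔ M.q (g a) (g b) = M.zero) := by
    intro a b ha hb
    rw [← groupExt_q_extInl, q_eq_zero_comm, hχ hb, q_eq_zero_comm M,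
      groupExt_q_eq_zero_iff (hgS hb), hg1, map_eq_one_iff _ extInl_injective]
    refine or_congr_right ⟨fun h => ?_, fun h => ?_⟩
    · rw [h, hχneg] at ha
      exact absurd ha hb
    · refine absurd ?_ (hgS hb)
      rw [← extSnd_neg_mul, ← h, g1 ha, extSnd_extInl]
  have hgq : ∀ a b, S.q a b = S.zero ↔ M.q (g a) (g b) = M.zero := by
    intro a b
    by_cases ha : χ (extInl S a) = 1 <;> by_cases hb : χ (extInl S b) = 1
    · rw [g1 ha, g1 hb, groupExt_q_extInl]
    · exact mixed a b ha hb
    · rw [q_eq_zero_comm, q_eq_zero_comm M]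
      exact mixed b a hb ha
    · rw [← groupExt_q_extInl, hχ ha, groupExt_q_eq_zero_iff (hgS ha), hg1,
        map_eq_one_iff _ extInl_injective]
      refine or_congr_right ?_
      rw [groupExt_neg, ← map_mul, extInl_injective.eq_iff, ← S.mul_eq_one_iff_eq, ← hg1, hgmul,
        hgmul, hgneg, M.mul_eq_one_iff_eq]
      rfl
  let ψ : S.G →* T.G :=
    { toFun := fun a => extFst T (φ (g a))
      map_one' := by rw [(hg1 1).2 rfl, map_one, map_one]
      map_mul' := fun a b => by rw [hgmul, map_mul, map_mul] }
  have hψ : ∀ a, extInl T (ψ a) = φ (g a) := fun a => extInl_extFst (hgχ a)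
  have hinj : Function.Injective ψ := by
    rw [injective_iff_map_eq_one]
    intro a ha
    rw [← hg1, ← φ.map_eq_one_iff, ← hψ, ha, map_one]
  refine ⟨MulEquiv.ofBijective ψ ((Nat.bijective_iff_injective_and_card ψ).2 ⟨hinj, hcard⟩),
    ?_, fun a b => ?_⟩
  · refine extInl_injective ?_
    change extInl T (ψ S.neg) = _
    rw [hψ, hgneg, hneg, groupExt_neg]
  · change _ ↔ T.q (ψ a) (ψ b) = _
    rw [hgq, hφ, ← hψ, ← hψ, groupExt_q_extInl]

/-- A group extension of order greater than two is indecomposable. -/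
theorem card_eq_two_of_groupExt_iso_prod {T A B : QuatStr} (h : T.groupExt.Iso (A.prod B))
    (hA : Nontrivial A.G) (hB : Nontrivial B.G) : Nat.card A.G = 2 ∧ Nat.card B.G = 2 := by
  -- If a rigid element u lies in B, all of A is contained in V(u) = {1, -u}. This forces A = {1,
  -- -1} and u = -1. Hence u is the only element of B outside the kernel of χ, and B = {1, -1} too.
  have key : ∀ {A B : QuatStr} (χ : (A.prod B).G →* C2), Nontrivial A.G →
      (∀ y z, χ y ≠ 1 → (A.prod B).q y z = (A.prod B).zero →
        z = 1 ∨ z = (A.prod B).neg * y) → (∃ b, χ (inr A B b) ≠ 1) →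
      Nat.card A.G = 2 ∧ Nat.card B.G = 2 := by
    intro A B χ hA hχ ⟨u, hu⟩
    have h1 : ∀ {u}, χ (inr A B u) ≠ 1 → ∀ t : A.G, t = 1 ∨ (t = A.neg ∧ u = B.neg) := by
      intro u hu t
      rcases hχ _ (inl A B t) hu (prod_q_iff.2 ⟨A.one_q _, B.q_one _⟩) with h | h
      · exact Or.inl (congrArg (fst A B) h)
      · right
        have h2 := congrArg (fst A B) h
        have h3 := congrArg (snd A B) h
        simp only [map_mul, fst_inl, fst_neg, fst_inr, mul_one] at h2
        simp only [map_mul, snd_inl, snd_neg, snd_inr] at h3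
        exact ⟨h2, ((B.mul_eq_one_iff_eq _ _).1 h3.symm).symm⟩
    obtain ⟨t, ht⟩ := exists_ne (1 : A.G)
    have h2 : ∀ {u}, χ (inr A B u) ≠ 1 → u = B.neg := fun hu => ((h1 hu t).resolve_left ht).2
    have hA1 : A.neg ≠ 1 := ((h1 hu t).resolve_left ht).1 ▸ ht
    have hB1 : B.neg ≠ 1 := by
      rw [← h2 hu]
      rintro rfl
      exact hu (by simp)
    refine ⟨Nat.card_eq_two_iff.2 ⟨1, A.neg, hA1.symm, ?_⟩,
      Nat.card_eq_two_iff.2 ⟨1, B.neg, hB1.symm, ?_⟩⟩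
    · ext t
      simp only [Set.mem_insert_iff, Set.mem_singleton_iff, Set.mem_univ, iff_true]
      exact (h1 hu t).imp_right And.left
    · ext v
      simp only [Set.mem_insert_iff, Set.mem_singleton_iff, Set.mem_univ, iff_true]
      by_cases hv : χ (inr A B v) = 1
      · left
        have : χ (inr A B (u * v)) ≠ 1 := by rwa [map_mul, map_mul, hv, mul_one]
        have h3 := h2 this
        rwa [← h2 hu, mul_eq_left] at h3
      · exact Or.inr (h2 hv)
  obtain ⟨φ, h1, h2⟩ := h.symm
  have hq : ∀ y z, extSnd T (φ y) ≠ 1 → (A.prod B).q y z = (A.prod B).zero →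
        z = 1 ∨ z = (A.prod B).neg * y := by
    intro y z hy hyz
    rw [h2] at hyz
    have := eq_of_groupExt_q_eq_zero hy hyz
    rwa [φ.map_eq_one_iff, ← h1, ← map_mul, φ.injective.eq_iff] at this
  obtain ⟨y, hy⟩ := exists_extSnd_ne_one T
  obtain ⟨y, rfl⟩ := φ.surjective y
  -- One of the two components of an element outside the kernel is itself outside the kernel; if it
  -- is the component in A, the factors are interchanged.
  by_cases hb : extSnd T (φ (inr A B (snd A B y))) = 1
  · rw [← inl_mul_inr y, map_mul, map_mul, hb, mul_one] at hy
    refine (key (A := B) (B := A) ((extSnd T).comp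
      (φ.toMonoidHom.comp (pair (snd B A) (fst B A)))) hB (fun y z hy' hyz => ?_)
      ⟨fst A B y, ?_⟩).symm
    · have := hq (pair (snd B A) (fst B A) y) (pair (snd B A) (fst B A) z) hy'
        (prod_q_iff.2 (prod_q_iff.1 hyz).symm)
      refine this.imp (fun h => ?_) (fun h => ?_)
      · exact prod_ext (congrArg (snd A B) h) (congrArg (fst A B) h)
      · exact prod_ext (congrArg (snd A B) h) (congrArg (fst A B) h)
    · exact hy
  · exact key ((extSnd T).comp φ.toMonoidHom) hA hq ⟨_, hb⟩

/-! ### Rigidity of group extensions -/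

theorem V_groupExt_of_extSnd_ne_one {S : QuatStr} {y : S.groupExt.G} (hy : extSnd S y ≠ 1) :
    Nat.card (S.groupExt.V y) = 2 := by
  rw [Nat.card_eq_two_iff]
  refine ⟨1, ⟨S.groupExt.neg * y, S.groupExt.q1 y⟩, fun h => ?_, ?_⟩
  · have h' : 1 = S.groupExt.neg * y := congrArg Subtype.val h
    refine hy ?_
    rw [← extSnd_neg_mul, ← h', map_one]
  · ext z
    simp only [Set.mem_insert_iff, Set.mem_singleton_iff, Set.mem_univ, iff_true]
    exact (eq_of_groupExt_q_eq_zero hy z.2).imp Subtype.ext Subtype.ext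

theorem extSnd_eq_one_of_q_eq_zero {S : QuatStr} {a : S.G} (ha : a ≠ 1) {z : S.groupExt.G}
    (h : S.groupExt.q (extInl S a) z = S.groupExt.zero) : extSnd S z = 1 := by
  by_contra hz
  rw [q_eq_zero_comm] at h
  rcases eq_of_groupExt_q_eq_zero hz h with h | h
  · exact ha (extInl_injective (h.trans (map_one _).symm))
  · have := congrArg (extSnd S) h
    rw [extSnd_neg_mul, extSnd_extInl] at this
    exact hz this.symm

theorem lrk_groupExt_le (S : QuatStr) [Finite S.G] : S.groupExt.lrk ≤ 1 := by
  obtain ⟨y, hy⟩ := exists_extSnd_ne_one S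
  have := S.groupExt.two_pow_lrk_le y
  rw [V_groupExt_of_extSnd_ne_one hy] at this
  exact (Nat.pow_le_pow_iff_right (a := 2) one_lt_two).1 (by rwa [pow_one])

/-- Elements outside the group of S have value groups of order two, and for a ≠ 1 in S the value
group does not grow in the extension. For the trivial structure the statement fails: there V(1) is
trivial, but no value group of the extension is. -/
theorem lrk_groupExt_eq_zero_iff (S : QuatStr) [Finite S.G] [Nontrivial S.G] :
    S.groupExt.lrk = 0 ↔ S.lrk = 0 := by
  rw [lrk_eq_zero_iff, lrk_eq_zero_iff]
  constructor
  · rintro ⟨y, hy⟩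
    by_cases h : extSnd S y = 1
    · refine ⟨extFst S y, (Subgroup.eq_bot_iff_forall _).2 fun b hb => ?_⟩
      rw [Subgroup.eq_bot_iff_forall] at hy
      refine extInl_injective ((hy _ ?_).trans (map_one _).symm)
      rw [mem_V, ← extInl_extFst h, groupExt_q_extInl]
      exact hb
    · have := V_groupExt_of_extSnd_ne_one h
      rw [hy] at this
      simp at this
  · rintro ⟨a, ha⟩
    have h1 : a ≠ 1 := by
      rintro rfl
      obtain ⟨b, hb⟩ := exists_ne (1 : S.G)
      exact hb ((Subgroup.eq_bot_iff_forall _).1 ha b (S.one_q b))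
    refine ⟨extInl S a, (Subgroup.eq_bot_iff_forall _).2 fun z hz => ?_⟩
    have h2 := extInl_extFst (extSnd_eq_one_of_q_eq_zero h1 hz)
    rw [mem_V, ← h2, groupExt_q_extInl] at hz
    rw [← h2, (Subgroup.eq_bot_iff_forall _).1 ha _ hz, map_one]

theorem groupExt_nondegenerate (S : QuatStr) [Nontrivial S.G] : ¬ S.groupExt.Degenerate := by
  rw [not_degenerate_iff]
  intro y hy
  by_cases h : extSnd S y = 1
  · by_contra h1
    rw [← extInl_extFst h] at hy h1
    obtain ⟨z, hz⟩ := exists_extSnd_ne_one S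
    refine hz (extSnd_eq_one_of_q_eq_zero (fun h => h1 ?_) (hy z))
    rw [h, map_one]
  · obtain ⟨b, hb⟩ := exists_ne (1 : S.G)
    rcases eq_of_groupExt_q_eq_zero h (hy (extInl S b)) with h2 | h2
    · exact absurd (extInl_injective (h2.trans (map_one _).symm)) hb
    · refine absurd ?_ h
      rw [← extSnd_neg_mul, ← h2, extSnd_extInl]

/-- The radical is contained in every value group, and one of these is trivial. -/
theorem nondegenerate_of_lrk_eq_zero {S : QuatStr} [Finite S.G] (h : S.lrk = 0) :
    ¬ S.Degenerate := by
  obtain ⟨a, ha⟩ := S.lrk_eq_zero_iff.1 h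
  rw [not_degenerate_iff]
  intro b hb
  refine (Subgroup.eq_bot_iff_forall _).1 ha b ?_
  rw [mem_V, q_eq_zero_comm]
  exact hb a

/-! ### Structures of order one -/

/-- Only q(a, a) for the nontrivial element a is undetermined. If -1 = 1 it vanishes by q(a, -a) =
0; otherwise a = -1. -/
theorem iso_of_card_eq_two {S T : QuatStr} (hS : Nat.card S.G = 2) (hT : Nat.card T.G = 2)
    (hneg : S.neg = 1 ↔ T.neg = 1)
    (hq : S.q S.neg S.neg = S.zero ↔ T.q T.neg T.neg = T.zero) : S.Iso T := by
  have uniq : ∀ {S : QuatStr}, Nat.card S.G = 2 → ∀ {a b : S.G}, a ≠ 1 → b ≠ 1 → a = b :=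
    fun h _ _ ha hb => ((Nat.card_eq_two_iff' 1).1 h).unique ha hb
  have key : ∀ {S : QuatStr}, Nat.card S.G = 2 → ∀ a b, S.q a b = S.zero ↔
      a = 1 ∨ b = 1 ∨ S.q S.neg S.neg = S.zero := by
    intro S hS a b
    by_cases ha : a = 1
    · simp [ha, S.one_q]
    by_cases hb : b = 1
    · simp [hb, S.q_one]
    obtain rfl := uniq hS ha hb
    simp only [ha, false_or]
    by_cases hn : S.neg = 1
    · have := S.q1 a
      rw [hn, one_mul] at this
      rw [hn, S.q_one, this]
    · rw [uniq hS ha hn]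
  have : Fact (Nat.Prime 2) := ⟨Nat.prime_two⟩
  let φ : S.G ≃* T.G := mulEquivOfPrimeCardEq hS hT
  refine ⟨φ, ?_, fun a b => ?_⟩
  · by_cases h : S.neg = 1
    · rw [h, map_one, hneg.1 h]
    · exact uniq hT (fun h' => h (φ.map_eq_one_iff.1 h')) (fun h' => h (hneg.2 h'))
  · rw [key hS, key hT, hq, φ.map_eq_one_iff, φ.map_eq_one_iff]

theorem card_C2 : Nat.card C2 = 2 := Nat.card_eq_fintype_card.trans (ZMod.card 2)

theorem gen_ne_one : (Multiplicative.ofAdd 1 : C2) ≠ 1 := by decide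

theorem iso_of_card_eq_two_cases {S : QuatStr} (hS : Nat.card S.G = 2) :
    S.Iso L10 ∨ S.Iso L11 ∨ S.Iso L1 := by
  by_cases h : S.neg = 1
  · exact Or.inl (iso_of_card_eq_two hS card_C2 ⟨fun _ => rfl, fun _ => h⟩
      ⟨fun _ => rfl, fun _ => by rw [h, S.q_one]⟩)
  · right
    by_cases h' : S.q S.neg S.neg = S.zero
    · exact Or.inl (iso_of_card_eq_two hS card_C2
        ⟨fun h1 => absurd h1 h, fun h1 => absurd h1 gen_ne_one⟩ ⟨fun _ => rfl, fun _ => h'⟩)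
    · refine Or.inr (iso_of_card_eq_two hS card_C2
        ⟨fun h1 => absurd h1 h, fun h1 => absurd h1 gen_ne_one⟩
        ⟨fun h1 => absurd h1 h', fun h1 => absurd h1 ?_⟩)
      change ¬ (Multiplicative.toAdd (Multiplicative.ofAdd 1 : C2) *
        Multiplicative.toAdd (Multiplicative.ofAdd 1 : C2) = 0)
      decide

theorem isElementary_of_card_eq_two {S : QuatStr} (hS : Nat.card S.G = 2) : S.IsElementary := by
  rcases iso_of_card_eq_two_cases hS with h | h | h
  · exact .iso _ _ h.symm .l10
  · exact .iso _ _ h.symm .l11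
  · exact .iso _ _ h.symm .l1

theorem isElementary_of_subsingleton {S : QuatStr} [Subsingleton S.G] : S.IsElementary :=
  .iso _ _ iso_of_subsingleton .l0

theorem finite_C2 : Finite C2 := inferInstanceAs (Finite (ZMod 2))

theorem IsElementary.finite {S : QuatStr} (h : S.IsElementary) : Finite S.G := by
  induction h with
  | l0 => exact inferInstanceAs (Finite Unit)
  | l10 => exact finite_C2
  | l11 => exact finite_C2
  | l1 => exact finite_C2
  | loc S h => exact h.1
  | prod S T _ _ h h' => infer_instance
  | ext S _ h => infer_instance
  | iso S T h _ h' => exact h.finite_iff.1 h'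

/-! ### Local type structures -/

section

variable {S : QuatStr}

theorem q_eq_of_ne_zero (hQ : Nat.card S.Q = 2) {a b c d : S.G} (h : S.q a b ≠ S.zero)
    (h' : S.q c d ≠ S.zero) : S.q a b = S.q c d :=
  ((Nat.card_eq_two_iff' S.zero).1 hQ).unique h h'

theorem q_mul_eq_zero_of_ne_zero (hQ : Nat.card S.Q = 2) {a b c : S.G}
    (h : S.q a b ≠ S.zero) (h' : S.q a c ≠ S.zero) : S.q a (b * c) = S.zero :=
  (S.q3 a b c).1 (q_eq_of_ne_zero hQ h h')

theorem exists_q_ne_zero (hS : ¬ S.Degenerate) {a : S.G} (ha : a ≠ 1) :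
    ∃ b, S.q a b ≠ S.zero := by
  by_contra! h
  exact ha (not_degenerate_iff.1 hS a h)

/-- With two quaternions, q(a, ·) behaves as a nonzero functional to 𝔽₂, whose kernel V(a) has index
two. -/
theorem card_V_of_ne_one (hQ : Nat.card S.Q = 2) (hS : ¬ S.Degenerate) {a : S.G} (ha : a ≠ 1) :
    2 * Nat.card (S.V a) = Nat.card S.G := by
  have : (S.V a).index = 2 := by
    obtain ⟨b, hb⟩ := exists_q_ne_zero hS ha
    refine Subgroup.index_eq_two_iff.2 ⟨b, fun c => ?_⟩
    by_cases hc : c ∈ S.V a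
    · refine Or.inr ⟨hc, fun h => hb ?_⟩
      exact (Subgroup.mul_mem_cancel_left _ hc).1 h
    · exact Or.inl ⟨q_mul_eq_zero_of_ne_zero hQ hc hb, hc⟩
  rw [← (S.V a).index_mul_card, this]

theorem IsLocalType.three_le_dim (h : S.IsLocalType) : 3 ≤ S.dim := by
  have := h.1
  have h3 := h.2.2.1
  rw [S.order_eq_dim] at h3
  exact_mod_cast h3

theorem lrk_of_card_Q_eq_two [Finite S.G] (hQ : Nat.card S.Q = 2) (hS : ¬ S.Degenerate)
    (h1 : 1 ≤ S.dim) : S.lrk + 1 = S.dim := by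
  have hnt : Nontrivial S.G := by
    rw [← not_subsingleton_iff_nontrivial, ← dim_eq_zero_iff]
    omega
  have key : ∀ a : S.G, a ≠ 1 → Nat.card (S.V a) = 2 ^ (S.dim - 1) := fun a ha => by
    have := card_V_of_ne_one hQ hS ha
    rw [S.card_eq, ← Nat.sub_add_cancel h1, pow_succ] at this
    omega
  obtain ⟨a, ha⟩ := exists_ne (1 : S.G)
  rw [lrk_eq_of (k := S.dim - 1) ⟨a, key a ha⟩, Nat.sub_add_cancel h1]
  intro b
  by_cases hb : b = 1
  · have : S.V b = ⊤ := by
      rw [eq_top_iff]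
      intro x _
      rw [hb]
      exact S.one_q x
    rw [this, Subgroup.card_top, S.card_eq]
    exact Nat.pow_le_pow_right two_pos (Nat.sub_le _ _)
  · exact (key b hb).ge

/-- A product of two nondegenerate structures of positive order has nonzero quaternions supported in
either component. These are distinct, so there would be more than two quaternions. -/
theorem indecomposable_of_card_Q_eq_two [Finite S.G] (hQ : Nat.card S.Q = 2)
    (hS : ¬ S.Degenerate) (h1 : 1 ≤ S.dim) : S.Indecomposable := by
  refine ⟨by rw [order_eq_dim]; exact_mod_cast h1, ?_⟩
  rintro ⟨A, B, hA, hB, h⟩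
  rw [one_le_order_iff] at hA hB
  rw [h.degenerate_iff, prod_degenerate_iff] at hS
  obtain ⟨φ, -, hφ⟩ := h.symm
  obtain ⟨a, ha⟩ := exists_ne (1 : A.G)
  obtain ⟨b, hb⟩ := exists_ne (1 : B.G)
  obtain ⟨c, hc⟩ := exists_q_ne_zero hS.1 ha
  obtain ⟨d, hd⟩ := exists_q_ne_zero hS.2 hb
  have key := q_mul_eq_zero_of_ne_zero hQ (a := φ (inl A B a * inr A B b)) (b := φ (inl A B c))
    (c := φ (inr A B d)) (by
      rw [Ne, ← hφ, prod_q_iff]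
      simp [hc]) (by
      rw [Ne, ← hφ, prod_q_iff]
      simp [hd])
  rw [← map_mul, ← hφ, prod_q_iff] at key
  simp [hc] at key

end

theorem IsLocalType.lrk_add_one {S : QuatStr} (h : S.IsLocalType) : S.lrk + 1 = S.dim := by
  have := h.1
  exact lrk_of_card_Q_eq_two h.2.2.2 h.2.1 (by have := h.three_le_dim; omega)

theorem IsLocalType.indecomposable {S : QuatStr} (h : S.IsLocalType) : S.Indecomposable := by
  have := h.1
  exact indecomposable_of_card_Q_eq_two h.2.2.2 h.2.1 (by have := h.three_le_dim; omega)

/-! ### Decompositions of structures of elementary type -/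

/-- Group extensions are counted over arbitrary base structures, so the base must be shown to be
elementary. Local types are excluded by `lrk`, proper products force order two, and extensions are
handled by cancellation. -/
theorem IsElementary.of_groupExt {S : QuatStr} (hS : S.IsElementary) {T : QuatStr}
    (h : S.Iso T.groupExt) : T.IsElementary := by
  have sub : ∀ {T : QuatStr}, Nat.card T.groupExt.G = 2 → T.IsElementary := by
    intro T hT
    rw [card_groupExt] at hT
    have : Subsingleton T.G := (Nat.card_eq_one_iff_unique.1 (by omega)).1
    exact isElementary_of_subsingleton
  induction hS generalizing T with
  | l0 =>
    have h1 := h.card_eq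
    rw [card_groupExt, show Nat.card L0.G = 1 from Nat.card_unique (α := Unit)] at h1
    omega
  | l10 => exact sub (h.card_eq.symm.trans card_C2)
  | l11 => exact sub (h.card_eq.symm.trans card_C2)
  | l1 => exact sub (h.card_eq.symm.trans card_C2)
  | loc S hS =>
    have := hS.1
    have h1 := hS.lrk_add_one
    have h2 := hS.three_le_dim
    have : Finite T.groupExt.G := h.finite_iff.1 this
    have : Finite T.G := Finite.of_injective _ (extInl_injective (S := T))
    have h3 := T.lrk_groupExt_le
    rw [← h.lrk_eq] at h3
    omega
  | prod A B hA hB ihA ihB =>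
    rcases subsingleton_or_nontrivial A.G with hA' | hA'
    · exact ihB ((prod_iso_right A B).symm.trans h)
    rcases subsingleton_or_nontrivial B.G with hB' | hB'
    · exact ihA (((prod_comm_iso A B).trans (prod_iso_right B A)).symm.trans h)
    obtain ⟨h1, h2⟩ := card_eq_two_of_groupExt_iso_prod h.symm hA' hB'
    have h3 := h.card_eq
    rw [card_prod, card_groupExt, h1, h2] at h3
    exact isElementary_of_card_eq_two (by omega)
  | ext A hA _ =>
    have := hA.finite
    exact .iso _ _ (iso_of_groupExt_iso h) hA
  | iso A B hAB _ ih => exact ih (hAB.trans h)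

theorem IsElementary.cases_of_indecomposable {S : QuatStr} (hS : S.IsElementary)
    (hi : S.Indecomposable) : S.dim = 1 ∨ (∃ T : QuatStr, T.IsLocalType ∧ S.Iso T) ∨
      ∃ T : QuatStr, T.IsElementary ∧ S.Iso T.groupExt := by
  induction hS with
  | l0 => exact absurd (one_le_order_iff.1 hi.1) (not_nontrivial L0.G)
  | l10 => exact Or.inl (dim_eq_of_card card_C2)
  | l11 => exact Or.inl (dim_eq_of_card card_C2)
  | l1 => exact Or.inl (dim_eq_of_card card_C2)
  | loc S hS => exact Or.inr (Or.inl ⟨S, hS, Iso.refl S⟩)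
  | prod A B hA hB ihA ihB =>
    rcases subsingleton_or_nontrivial A.G with hA' | hA'
    · have h := prod_iso_right A B
      rw [h.dim_eq]
      refine (ihB (h.indecomposable_iff.1 hi)).imp_right (Or.imp ?_ ?_)
      · exact fun ⟨T, h1, h2⟩ => ⟨T, h1, h.trans h2⟩
      · exact fun ⟨T, h1, h2⟩ => ⟨T, h1, h.trans h2⟩
    rcases subsingleton_or_nontrivial B.G with hB' | hB'
    · have h := (prod_comm_iso A B).trans (prod_iso_right B A)
      rw [h.dim_eq]
      refine (ihA (h.indecomposable_iff.1 hi)).imp_right (Or.imp ?_ ?_)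
      · exact fun ⟨T, h1, h2⟩ => ⟨T, h1, h.trans h2⟩
      · exact fun ⟨T, h1, h2⟩ => ⟨T, h1, h.trans h2⟩
    exact absurd ⟨A, B, one_le_order_iff.2 hA', one_le_order_iff.2 hB', Iso.refl _⟩ hi.2
  | ext A hA _ => exact Or.inr (Or.inr ⟨A, hA, Iso.refl _⟩)
  | iso A B h _ ih =>
    rw [← h.dim_eq]
    refine (ih (h.indecomposable_iff.2 hi)).imp_right (Or.imp ?_ ?_)
    · exact fun ⟨T, h1, h2⟩ => ⟨T, h1, h.symm.trans h2⟩
    · exact fun ⟨T, h1, h2⟩ => ⟨T, h1, h.symm.trans h2⟩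

theorem indecomposable_of_card_eq_two {S : QuatStr} (h : Nat.card S.G = 2) :
    S.Indecomposable := by
  have : Finite S.G := Nat.finite_of_card_ne_zero (by omega)
  refine ⟨one_le_order_iff.2 (Finite.one_lt_card_iff_nontrivial.1 (by omega)), ?_⟩
  rintro ⟨A, B, hA, hB, hS⟩
  rw [one_le_order_iff] at hA hB
  have hc := hS.card_eq
  have hf : Finite (A.G × B.G) := hS.finite_iff.1 this
  have : Finite A.G := Finite.prod_left B.G
  have : Finite B.G := Finite.prod_right A.G
  have h1 := Finite.one_lt_card_iff_nontrivial.2 hA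
  have h2 := Finite.one_lt_card_iff_nontrivial.2 hB
  rw [h, card_prod] at hc
  have := Nat.mul_le_mul h1 h2
  omega

theorem indecomposable_groupExt {S : QuatStr} [Finite S.G] (h : 2 ≤ S.dim) :
    S.groupExt.Indecomposable := by
  refine ⟨?_, ?_⟩
  · rw [order_eq_dim, dim_groupExt]
    exact_mod_cast Nat.le_add_left 1 _
  · rintro ⟨A, B, hA, hB, hS⟩
    rw [one_le_order_iff] at hA hB
    obtain ⟨h1, h2⟩ := card_eq_two_of_groupExt_iso_prod hS hA hB
    have hc := hS.card_eq
    rw [card_groupExt, card_prod, h1, h2, S.card_eq] at hc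
    have := Nat.pow_le_pow_right two_pos h
    omega

/-- The factorization follows the construction of S. This avoids having to know beforehand that
direct factors of elementary type structures are again of elementary type. -/
theorem IsElementary.exists_multiset {S : QuatStr} (hS : S.IsElementary) (hn : ¬ S.Degenerate) :
    ∃ M : Multiset IsoType, (∀ t ∈ M, IsoType.Elem t ∧ IsoType.Nondeg t ∧ IsoType.Indec t) ∧
      M.prod = Quotient.mk isoSetoid S := by
  have single : ∀ S : QuatStr, S.IsElementary → ¬ S.Degenerate → S.Indecomposable →
      ∃ M : Multiset IsoType, (∀ t ∈ M, IsoType.Elem t ∧ IsoType.Nondeg t ∧ IsoType.Indec t) ∧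
      M.prod = Quotient.mk isoSetoid S := fun S h1 h2 h3 =>
    ⟨{Quotient.mk isoSetoid S}, fun t ht => by
      rw [Multiset.mem_singleton.1 ht]
      exact ⟨h1, h2, h3⟩, Multiset.prod_singleton _⟩
  induction hS with
  | l0 => exact ⟨0, by simp, rfl⟩
  | l10 => exact single _ .l10 hn (indecomposable_of_card_eq_two card_C2)
  | l11 => exact single _ .l11 hn (indecomposable_of_card_eq_two card_C2)
  | l1 => exact single _ .l1 hn (indecomposable_of_card_eq_two card_C2)
  | loc S hS => exact single _ (.loc _ hS) hn hS.indecomposable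
  | prod A B hA hB ihA ihB =>
    rw [prod_degenerate_iff] at hn
    obtain ⟨M, h1, h2⟩ := ihA hn.1
    obtain ⟨N, h3, h4⟩ := ihB hn.2
    refine ⟨M + N, fun t ht => ?_, by rw [Multiset.prod_add, h2, h4, mk_mul]⟩
    exact (Multiset.mem_add.1 ht).elim (h1 t) (h3 t)
  | ext A hA _ =>
    by_cases hi : A.groupExt.Indecomposable
    · exact single _ hA.ext hn hi
    · have := hA.finite
      have h1 : 1 ≤ A.groupExt.order := by
        rw [order_eq_dim, dim_groupExt]
        exact_mod_cast Nat.le_add_left 1 _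
      rw [Indecomposable, not_and, not_not] at hi
      obtain ⟨B, C, hB, hC, h⟩ := hi h1
      rw [one_le_order_iff] at hB hC
      -- An extension can only decompose into two factors of order one, and every structure of order
      -- one is elementary and indecomposable.
      obtain ⟨h2, h3⟩ := card_eq_two_of_groupExt_iso_prod h hB hC
      rw [h.degenerate_iff, prod_degenerate_iff] at hn
      obtain ⟨M, h4, h5⟩ :=
        single B (isElementary_of_card_eq_two h2) hn.1 (indecomposable_of_card_eq_two h2)
      obtain ⟨N, h6, h7⟩ :=
        single C (isElementary_of_card_eq_two h3) hn.2 (indecomposable_of_card_eq_two h3)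
      refine ⟨M + N, fun t ht => ?_, ?_⟩
      · exact (Multiset.mem_add.1 ht).elim (h4 t) (h6 t)
      · rw [Multiset.prod_add, h5, h7, mk_mul, mk_eq_iff]
        exact h.symm
  | iso A B h _ ih =>
    obtain ⟨M, h1, h2⟩ := ih (by rwa [h.degenerate_iff])
    exact ⟨M, h1, h2.trans (mk_eq_iff.2 h)⟩

/-! ### Structures of order two -/

theorem card_L10 : Nat.card L10.G = 2 := card_C2
theorem card_L11 : Nat.card L11.G = 2 := card_C2
theorem card_L1 : Nat.card L1.G = 2 := card_C2

theorem L1_q_iff {a b : L1.G} : L1.q a b = L1.zero ↔ a = 1 ∨ b = 1 := by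
  have key : ∀ a b : C2, Multiplicative.toAdd a * Multiplicative.toAdd b = 0 ↔ a = 1 ∨ b = 1 := by
    decide
  exact key a b

theorem L1_neg_ne_one : L1.neg ≠ 1 := gen_ne_one

theorem L1_nondegenerate : ¬ L1.Degenerate := by
  rw [not_degenerate_iff]
  intro a h
  exact (L1_q_iff.1 (h L1.neg)).resolve_right L1_neg_ne_one

theorem L10_degenerate : L10.Degenerate := by
  by_contra h
  exact gen_ne_one (not_degenerate_iff.1 h (Multiplicative.ofAdd 1 : C2) fun _ => rfl)

theorem L11_degenerate : L11.Degenerate := by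
  by_contra h
  exact gen_ne_one (not_degenerate_iff.1 h (Multiplicative.ofAdd 1 : C2) fun _ => rfl)

instance : Finite L10.G := finite_C2
instance : Finite L11.G := finite_C2
instance : Finite L1.G := finite_C2

theorem nontrivial_of_card_eq_two {S : QuatStr} (h : Nat.card S.G = 2) : Nontrivial S.G := by
  have : Finite S.G := Nat.finite_of_card_ne_zero (by omega)
  exact Finite.one_lt_card_iff_nontrivial.1 (by omega)

instance : Nontrivial L10.G := nontrivial_of_card_eq_two card_C2
instance : Nontrivial L11.G := nontrivial_of_card_eq_two card_C2
instance : Nontrivial L1.G := nontrivial_of_card_eq_two card_C2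

theorem L1_lrk : L1.lrk = 0 := by
  rw [lrk_eq_zero_iff]
  exact ⟨L1.neg, (Subgroup.eq_bot_iff_forall _).2 fun x hx =>
    (L1_q_iff.1 hx).resolve_left L1_neg_ne_one⟩

theorem L10_lrk : L10.lrk ≠ 0 := fun h =>
  nondegenerate_of_lrk_eq_zero h L10_degenerate

theorem L11_lrk : L11.lrk ≠ 0 := fun h =>
  nondegenerate_of_lrk_eq_zero h L11_degenerate

/-- A group extension of order two can be decomposable, which is why the recursions for
indecomposables start above order two. -/
theorem L1_groupExt_iso : L1.groupExt.Iso (L1.prod L1) := by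
  let g : C2 := Multiplicative.ofAdd 1
  let φ : C2 × C2 ≃* C2 × C2 :=
    { toFun := fun a => (a.1 * a.2, a.1)
      invFun := fun a => (a.2, a.1 * a.2)
      left_inv := by decide
      right_inv := by decide
      map_mul' := by decide }
  have key : ∀ A B : C2 × C2,
      ((A.1 = 1 ∨ B.1 = 1) ∧ (g ^ (ZMod.val A.2.toAdd)) ^ (ZMod.val B.2.toAdd) *
        A.1 ^ (ZMod.val B.2.toAdd) * B.1 ^ (ZMod.val A.2.toAdd) = 1) ↔
      ((φ A).1 = 1 ∨ (φ B).1 = 1) ∧ ((φ A).2 = 1 ∨ (φ B).2 = 1) := by decide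
  refine ⟨φ, rfl, fun A B => ?_⟩
  rw [groupExt_q_iff, L1_q_iff, prod_q_iff, L1_q_iff, L1_q_iff]
  exact key A B

end QuatStr

/-! ### Symmetric bilinear forms over the field with two elements -/

theorem zmod_two_cases (c : ZMod 2) : c = 0 ∨ c = 1 := by
  revert c; decide

/-- A nondegenerate symmetric bilinear form over `𝔽₂` that is not alternating has an orthonormal
basis. Here `u` is the vector representing the additive map `v ↦ B v v`. -/
theorem exists_linearMap_dotProduct (n : ℕ) {V : Type} [AddCommGroup V] [Module (ZMod 2) V]
    [Module.Finite (ZMod 2) V] (B : V →ₗ[ZMod 2] V →ₗ[ZMod 2] ZMod 2)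
    (hsymm : ∀ v w, B v w = B w v) (u : V) (hu : ∀ v, B v v = B u v)
    (hB : ∀ v, (∀ w, B v w = 0) → v = 0) (hu0 : u ≠ 0) (hn : Module.finrank (ZMod 2) V = n) :
    ∃ f : V →ₗ[ZMod 2] (Fin n → ZMod 2), ∀ v w, B v w = ∑ i, f v i * f w i := by
  induction n generalizing V with
  | zero =>
    have := Module.finrank_zero_iff.1 hn
    exact absurd (Subsingleton.elim u 0) hu0
  | succ n ih =>
    have h2 : ∀ v : V, v + v = 0 := fun v => by
      rw [← two_smul (ZMod 2) v, show (2 : ZMod 2) = 0 from by decide, zero_smul]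
    obtain ⟨a, ha⟩ : ∃ a, B u a = 1 := by
      by_contra! h
      exact hu0 (hB u fun w => (zmod_two_cases _).resolve_right (h w))
    -- Here B(a, a) = B(u, a) = 1, so the space is the orthogonal sum of the line through a and its
    -- orthogonal complement.
    have split : ∀ a, B u a = 1 → ∀ v w, B v w = B a v * B a w +
        B (v + B a v • a) (w + B a w • a) := by
      intro a ha v w
      simp only [map_add, map_smul, LinearMap.add_apply, LinearMap.smul_apply, smul_eq_mul]
      rw [hu a, ha, hsymm v a]
      rcases zmod_two_cases (B a v) with h | h <;> rcases zmod_two_cases (B a w) with h' | h' <;>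
        rw [h, h'] <;> rcases zmod_two_cases (B v w) with h | h <;> rw [h] <;> decide
    have hker : ∀ a, B u a = 1 → ∀ v, v + B a v • a ∈ LinearMap.ker (B a) := by
      intro a ha v
      rw [LinearMap.mem_ker, map_add, map_smul, hu a, ha, smul_eq_mul, mul_one]
      rcases zmod_two_cases (B a v) with h | h <;> rw [h] <;> decide
    have hrank : ∀ a, B u a = 1 → Module.finrank (ZMod 2) (LinearMap.ker (B a)) = n := by
      intro a ha
      have h := (B a).finrank_range_add_finrank_ker
      have hs : LinearMap.range (B a) = ⊤ := by
        refine LinearMap.range_eq_top.2 fun c => ⟨c • a, ?_⟩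
        rw [map_smul, hu a, ha, smul_eq_mul, mul_one]
      rw [hs, finrank_top, Module.finrank_self, hn] at h
      omega
    rcases Nat.eq_zero_or_pos n with rfl | hpos
    · refine ⟨LinearMap.pi fun _ => B a, fun v w => ?_⟩
      have := Module.finrank_zero_iff.1 (hrank a ha)
      have h0 : v + B a v • a = 0 :=
        congrArg Subtype.val (Subsingleton.elim (⟨_, hker a ha v⟩ : LinearMap.ker (B a)) 0)
      rw [split a ha v w, h0]
      simp
    -- The restriction of B to the complement of b has characteristic vector u + b. Choosing b ≠ u
    -- keeps it nonzero, so the restricted form is again not alternating. If a = u, a nonzero vector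
    -- orthogonal to u is added to it.
    obtain ⟨b, hb, hbu⟩ : ∃ b, B u b = 1 ∧ b ≠ u := by
      by_cases hau : a = u
      · subst hau
        have : Nontrivial (LinearMap.ker (B a)) :=
          Module.nontrivial_of_finrank_pos (R := ZMod 2) (by rw [hrank a ha]; exact hpos)
        obtain ⟨⟨c, hc⟩, hc0⟩ := exists_ne (0 : LinearMap.ker (B a))
        refine ⟨a + c, ?_, fun h => hc0 (Subtype.ext ?_)⟩
        · rw [map_add, ha, LinearMap.mem_ker.1 hc, add_zero]
        · exact (add_eq_left).1 h
      · exact ⟨a, ha, hau⟩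
    let W := LinearMap.ker (B b)
    have hBb : ∀ w : W, B b w = 0 := fun w => LinearMap.mem_ker.1 w.2
    obtain ⟨f, hf⟩ := ih (V := W) (B.domRestrict₁₂ W W) (fun v w => hsymm _ _)
      ⟨u + B b u • b, hker b hb u⟩ (fun v => by
        change B v v = B (u + B b u • b) v
        rw [hu, map_add, map_smul, LinearMap.add_apply, LinearMap.smul_apply, hBb, smul_zero,
          add_zero])
      (fun v hv => Subtype.ext (hB v fun w => by
        have := hv ⟨_, hker b hb w⟩
        change B v (w + B b w • b) = 0 at this
        rwa [map_add, map_smul, hsymm v b, hBb, smul_zero, add_zero] at this))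
      (fun h => hbu (by
        have := congrArg Subtype.val h
        change u + B b u • b = 0 at this
        rw [hsymm, hb, one_smul] at this
        exact (add_right_cancel (this.trans (h2 b).symm)).symm)) (hrank b hb)
    let p : V →ₗ[ZMod 2] W :=
      (LinearMap.id + (B b).smulRight b).codRestrict W fun v => hker b hb v
    refine ⟨LinearMap.pi (Fin.cons (B b) fun i => LinearMap.proj i ∘ₗ f ∘ₗ p), fun v w => ?_⟩
    rw [split b hb, Fin.sum_univ_succ]
    congr 1
    exact hf (p v) (p w)

/-! ### Structures with two quaternions as bilinear forms -/

namespace QuatStr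

/-- A homomorphism of finite nondegenerate structures of the same order that respects the zero
relation is an isomorphism. -/
theorem iso_of_hom {S T : QuatStr} [Finite S.G] (hS : ¬ S.Degenerate) (hT : ¬ T.Degenerate)
    (h : Nat.card S.G = Nat.card T.G) (f : S.G →* T.G)
    (hf : ∀ a b, S.q a b = S.zero ↔ T.q (f a) (f b) = T.zero) : S.Iso T := by
  rw [not_degenerate_iff] at hS hT
  have : Finite T.G := Nat.finite_of_card_ne_zero (h ▸ Nat.card_pos.ne')
  have hinj : Function.Injective f := by
    rw [injective_iff_map_eq_one]
    intro a ha
    refine hS a fun x => ?_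
    rw [hf, ha, T.one_q]
  have hbij := (Nat.bijective_iff_injective_and_card f).2 ⟨hinj, h⟩
  refine ⟨MulEquiv.ofBijective f hbij, ?_, hf⟩
  change f S.neg = T.neg
  -- The element -1 need not be preserved by assumption: both f(-1) and -1 satisfy q(y, · y) = 0 for
  -- all y, so their product lies in the radical.
  rw [← T.mul_eq_one_iff_eq]
  refine hT _ fun y => ?_
  obtain ⟨a, rfl⟩ := hbij.2 y
  have h1 := (hf _ _).1 (S.q1 a)
  rw [map_mul] at h1
  have h2 := T.q_mul_eq_zero h1 (T.q1 (f a))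
  rwa [mul_mul_mul_comm, T.mul_self, mul_one, q_eq_zero_comm] at h2

/-- The quaternionic structure with quaternions `𝔽₂` given by a symmetric bilinear form. -/
def ofForm {V : Type} [AddCommGroup V] (h2 : ∀ v : V, v + v = 0) (B : V →+ V →+ ZMod 2)
    (hsymm : ∀ v w, B v w = B w v) (u : V) (hu : ∀ v, B v v = B v u)
    (hB : ∃ a b, B a b = 1) : QuatStr where
  G := Multiplicative V
  Q := ZMod 2
  mul_self v := congrArg Multiplicative.ofAdd (h2 v.toAdd)
  neg := Multiplicative.ofAdd u
  zero := 0
  q a b := B a.toAdd b.toAdd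
  surj z := by
    obtain ⟨a, b, h⟩ := hB
    rcases zmod_two_cases z with rfl | rfl
    · exact ⟨1, 1, by simp⟩
    · exact ⟨Multiplicative.ofAdd a, Multiplicative.ofAdd b, h⟩
  q1 a := by
    rw [toAdd_mul, toAdd_ofAdd, map_add, ← hu]
    exact CharTwo.add_self_eq_zero _
  q2 a b := hsymm _ _
  q3 a b c := by
    rw [toAdd_mul, map_add, CharTwo.add_eq_zero]
  q4 a b c d := by
    constructor
    · intro h
      rcases zmod_two_cases (B a.toAdd b.toAdd) with h0 | h1
      · refine ⟨1, ?_, ?_, ?_⟩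
        · rw [h0, toAdd_one, map_zero]
        · rw [toAdd_one, map_zero, map_zero]
        · rw [← h, h0, toAdd_one, map_zero]
      have h1' := h1
      rw [h] at h1'
      suffices hx : ∃ x, B a.toAdd x = 1 ∧ B c.toAdd x = 1 by
        obtain ⟨x, h3, h4⟩ := hx
        exact ⟨Multiplicative.ofAdd x, by simp [h3, h1], by simp [h3, h4], by simp [h4, h1']⟩
      -- One of b, d, b + d takes the value 1 under both functionals B(a, ·) and B(c, ·).
      rcases zmod_two_cases (B c.toAdd b.toAdd) with h3 | h3
      · rcases zmod_two_cases (B a.toAdd d.toAdd) with h4 | h4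
        · exact ⟨b.toAdd + d.toAdd, by simp [h4, h1], by simp [h3, h1']⟩
        · exact ⟨_, h4, h1'⟩
      · exact ⟨_, h1, h3⟩
    · rintro ⟨x, h1, h2, h3⟩
      exact h1.trans (h2.trans h3)

section

variable {V : Type} [AddCommGroup V] {h2 : ∀ v : V, v + v = 0} {B : V →+ V →+ ZMod 2}
    {hsymm : ∀ v w, B v w = B w v} {u : V} {hu : ∀ v, B v v = B v u}
    {hB : ∃ a b, B a b = 1}

theorem ofForm_nondegenerate (h : ∀ v, (∀ w, B v w = 0) → v = 0) :
    ¬ (ofForm h2 B hsymm u hu hB).Degenerate :=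
  not_degenerate_iff.2 fun a ha => h a fun w => ha (Multiplicative.ofAdd w)

theorem ofForm_isLocalType {n : ℕ} (hn : 3 ≤ n) (hV : Nat.card V = 2 ^ n)
    (h : ∀ v, (∀ w, B v w = 0) → v = 0) : (ofForm h2 B hsymm u hu hB).IsLocalType := by
  have : Finite V := Nat.finite_of_card_ne_zero (by rw [hV]; positivity)
  refine ⟨inferInstanceAs (Finite V), ofForm_nondegenerate h, ?_, Nat.card_zmod 2⟩
  have ho : (ofForm h2 B hsymm u hu hB).order = n := order_eq_natCast_iff.2 hV
  rw [ho]
  exact_mod_cast hn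

end

/-- Identifying the zero quaternion with 0 and the other one with 1, the axiom `q3` becomes
additivity in the second argument. -/
theorem exists_form {S : QuatStr} (hQ : Nat.card S.Q = 2) :
    ∃ B : Additive S.G →+ Additive S.G →+ ZMod 2,
      (∀ a b, S.q a b = S.zero ↔ B (Additive.ofMul a) (Additive.ofMul b) = 0) := by
  classical
  let b : S.G → S.G → ZMod 2 := fun x y => if S.q x y = S.zero then 0 else 1
  have hb : ∀ x y, S.q x y = S.zero ↔ b x y = 0 := fun x y => by
    by_cases h : S.q x y = S.zero <;> simp [b, h]
  have hsymm : ∀ x y, b x y = b y x := fun x y => by simp only [b, S.q2 x y]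
  have hadd : ∀ x y z, b x (y * z) = b x y + b x z := fun x y z => by
    by_cases h : S.q x y = S.zero <;> by_cases h' : S.q x z = S.zero
    · simp [b, h, h', S.q_mul_eq_zero h h']
    · have : S.q x (y * z) ≠ S.zero := fun h3 => h' ((Subgroup.mul_mem_cancel_left (S.V x) h).1 h3)
      simp [b, h, h', this]
    · have : S.q x (y * z) ≠ S.zero := fun h3 => h ((Subgroup.mul_mem_cancel_right (S.V x) h').1 h3)
      simp [b, h, h', this]
    · simp only [b, h, h', q_mul_eq_zero_of_ne_zero hQ h h', if_true, if_false]
      decide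
  refine ⟨AddMonoidHom.mk' (fun x => AddMonoidHom.mk' (fun y => b x.toMul y.toMul)
    fun y z => hadd _ _ _) fun y z => ?_, hb⟩
  refine AddMonoidHom.ext fun x => ?_
  change b (y.toMul * z.toMul) x.toMul = b y.toMul x.toMul + b z.toMul x.toMul
  rw [hsymm, hadd, hsymm x.toMul, hsymm x.toMul]

theorem iso_ofForm {S : QuatStr} [Finite S.G] (hS : ¬ S.Degenerate)
    {V : Type} [AddCommGroup V] {h2 : ∀ v : V, v + v = 0} {B : V →+ V →+ ZMod 2}
    {hsymm : ∀ v w, B v w = B w v} {u : V} {hu : ∀ v, B v v = B v u}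
    {hB : ∃ a b, B a b = 1} (h : ∀ v, (∀ w, B v w = 0) → v = 0) (hc : Nat.card S.G = Nat.card V)
    (f : Additive S.G →+ V)
    (hf : ∀ a b, S.q a b = S.zero ↔ B (f (Additive.ofMul a)) (f (Additive.ofMul b)) = 0) :
    S.Iso (ofForm h2 B hsymm u hu hB) :=
  iso_of_hom hS (ofForm_nondegenerate h) hc
    (T := ofForm h2 B hsymm u hu hB)
    (MonoidHom.mk' (fun a => Multiplicative.ofAdd (f (Additive.ofMul a)))
      fun a b => congrArg Multiplicative.ofAdd (map_add f (Additive.ofMul a) (Additive.ofMul b))) hf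

/-! ### The two kinds of local type structures -/

/-- The dot product. -/
def dotForm (n : ℕ) : (Fin n → ZMod 2) →+ (Fin n → ZMod 2) →+ ZMod 2 :=
  AddMonoidHom.mk' (fun v => AddMonoidHom.mk' (fun w => ∑ i, v i * w i)
    fun w w' => by simp [mul_add, Finset.sum_add_distrib])
    fun v v' => by ext; simp [add_mul, Finset.sum_add_distrib]

theorem dotForm_apply {n : ℕ} (v w : Fin n → ZMod 2) : dotForm n v w = ∑ i, v i * w i := rfl

theorem dotForm_single {n : ℕ} (v : Fin n → ZMod 2) (i : Fin n) :
    dotForm n v (Pi.single i 1) = v i := by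
  simp [dotForm_apply, Pi.single_apply]

theorem dotForm_symm {n : ℕ} (v w : Fin n → ZMod 2) : dotForm n v w = dotForm n w v := by
  simp only [dotForm_apply, mul_comm]

theorem dotForm_self {n : ℕ} (v : Fin n → ZMod 2) : dotForm n v v = dotForm n v 1 := by
  rw [dotForm_apply, dotForm_apply]
  refine Finset.sum_congr rfl fun i _ => ?_
  rw [Pi.one_apply, mul_one]
  rcases zmod_two_cases (v i) with h | h <;> rw [h] <;> decide

theorem dotForm_nondegenerate {n : ℕ} (v : Fin n → ZMod 2) (h : ∀ w, dotForm n v w = 0) :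
    v = 0 := by
  ext i
  rw [← dotForm_single v i, h]
  rfl

/-- The vectors with coordinate sum zero. -/
def sumZero (n : ℕ) : AddSubgroup (Fin n → ZMod 2) := (dotForm n 1).ker

theorem mem_sumZero {n : ℕ} {v : Fin n → ZMod 2} : v ∈ sumZero n ↔ dotForm n 1 v = 0 := Iff.rfl

/-- The dot product on the vectors with coordinate sum zero. -/
def altForm (n : ℕ) : sumZero n →+ sumZero n →+ ZMod 2 :=
  ((dotForm n).comp (sumZero n).subtype).compl₂ (sumZero n).subtype

theorem altForm_apply {n : ℕ} (v w : sumZero n) : altForm n v w = dotForm n v w := rfl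

/-- Orthogonality to the sums of two unit vectors makes v constant. Since n + 1 is odd, a constant
vector with coordinate sum zero vanishes. -/
theorem altForm_nondegenerate {n : ℕ} (hn : Even n) (v : sumZero (n + 1))
    (h : ∀ w, altForm (n + 1) v w = 0) : v = 0 := by
  have h1 : ∀ i, v.1 i = v.1 0 := by
    intro i
    have hm : (Pi.single i 1 + Pi.single 0 1 : Fin (n + 1) → ZMod 2) ∈ sumZero (n + 1) := by
      rw [mem_sumZero, map_add, dotForm_single, dotForm_single]
      exact CharTwo.add_self_eq_zero 1
    have := h ⟨_, hm⟩
    rwa [altForm_apply, map_add, dotForm_single, dotForm_single, CharTwo.add_eq_zero] at this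
  have h2 := mem_sumZero.1 v.2
  rw [dotForm_symm, dotForm_apply] at h2
  simp only [h1, Pi.one_apply, mul_one, Finset.sum_const, Finset.card_univ, Fintype.card_fin,
    nsmul_eq_mul, Nat.cast_add, Nat.cast_one, (ZMod.natCast_eq_zero_iff_even).2 hn, zero_add,
    one_mul] at h2
  ext i
  rw [h1, h2]
  rfl

theorem card_sumZero (n : ℕ) : Nat.card (sumZero (n + 1)) = 2 ^ n := by
  have h1 := (sumZero (n + 1)).card_mul_index
  have h2 : (sumZero (n + 1)).index = 2 := by
    rw [sumZero, AddSubgroup.index_ker]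
    have : (dotForm (n + 1) 1).range = ⊤ := by
      refine AddMonoidHom.range_eq_top.2 fun c => ?_
      rcases zmod_two_cases c with rfl | rfl
      · exact ⟨0, map_zero _⟩
      · exact ⟨Pi.single 0 1, dotForm_single _ _⟩
    rw [this, AddSubgroup.card_top, Nat.card_zmod]
  rw [h2, Nat.card_fun, Nat.card_zmod, Nat.card_fin, pow_succ] at h1
  omega

/-- The local type structure of order `n` with `-1 ≠ 1`. -/
def dotStr (n : ℕ) (hn : 0 < n) : QuatStr :=
  ofForm (fun v => funext fun i => CharTwo.add_self_eq_zero (v i)) (dotForm n) dotForm_symm 1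
    dotForm_self ⟨1, Pi.single ⟨0, hn⟩ 1, dotForm_single _ _⟩

/-- The local type structure of even order `n` with `-1 = 1`. -/
def altStr (n : ℕ) (h : ∃ a b, altForm (n + 1) a b = 1) : QuatStr :=
  ofForm (fun v => Subtype.ext (funext fun i => CharTwo.add_self_eq_zero (v.1 i)))
    (altForm (n + 1)) (fun _ _ => dotForm_symm _ _) 0
    (fun v => by
      rw [map_zero, altForm_apply, dotForm_self, dotForm_symm]
      exact v.2) h

theorem exists_altForm_eq_one {n : ℕ} (hn : 2 ≤ n) : ∃ a b, altForm (n + 1) a b = 1 := by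
  obtain ⟨m, rfl⟩ := Nat.exists_eq_add_of_le hn
  have key : ∀ i j : Fin (2 + m + 1),
      (Pi.single i 1 + Pi.single j 1 : Fin (2 + m + 1) → ZMod 2) ∈ sumZero (2 + m + 1) := by
    intro i j
    rw [mem_sumZero, map_add, dotForm_single, dotForm_single]
    exact CharTwo.add_self_eq_zero 1
  let i0 : Fin (2 + m + 1) := ⟨0, by omega⟩
  let i1 : Fin (2 + m + 1) := ⟨1, by omega⟩
  let i2 : Fin (2 + m + 1) := ⟨2, by omega⟩
  have h1 : i1 ≠ i0 := by simp [i1, i0]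
  have h2 : i2 ≠ i0 := by simp [i2, i0]
  have h3 : i2 ≠ i1 := by simp [i2, i1]
  refine ⟨⟨_, key i0 i1⟩, ⟨_, key i0 i2⟩, ?_⟩
  rw [altForm_apply, map_add, dotForm_single, dotForm_single]
  simp [h1.symm, h2, h3]

section

variable {S : QuatStr}

theorem exists_hom_dotForm {V : Type} [AddCommGroup V] (h2 : ∀ v : V, v + v = 0)
    (B : V →+ V →+ ZMod 2) (hsymm : ∀ v w, B v w = B w v) (u : V) (hu : ∀ v, B v v = B v u)
    (hB : ∀ v, (∀ w, B v w = 0) → v = 0) (hu0 : u ≠ 0) {n : ℕ} (hn : Nat.card V = 2 ^ n) :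
    ∃ f : V →+ (Fin n → ZMod 2), ∀ v w, B v w = dotForm n (f v) (f w) := by
  let _ : Module (ZMod 2) V := AddCommGroup.zmodModule (n := 2) (fun x => by
    rw [two_nsmul]; exact h2 x)
  have : Finite V := Nat.finite_of_card_ne_zero (by rw [hn]; positivity)
  have hr : Module.finrank (ZMod 2) V = n := by
    have := Module.natCard_eq_pow_finrank (K := ZMod 2) (V := V)
    rw [Nat.card_zmod, hn] at this
    exact (Nat.pow_right_injective le_rfl this).symm
  obtain ⟨f, hf⟩ := exists_linearMap_dotProduct n
    (AddMonoidHom.toZModLinearMap 2 (AddMonoidHom.mk'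
      (fun v => AddMonoidHom.toZModLinearMap 2 (B v)) fun v w => by
        ext x
        change B (v + w) x = B v x + B w x
        rw [map_add, AddMonoidHom.add_apply])) hsymm u (fun v => (hu v).trans (hsymm _ _)) hB hu0 hr
  exact ⟨f.toAddMonoidHom, hf⟩

/-- The identity q(a, -a) = 0 reads B(a, a) = B(a, -1): the element -1 is the characteristic vector
of the form, and -1 ≠ 1 says that the form is not alternating. -/
theorem IsLocalType.iso_dotStr (hS : S.IsLocalType) (h : S.neg ≠ 1) {n : ℕ} (hn : S.dim = n)
    (hpos : 0 < n) : S.Iso (dotStr n hpos) := by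
  have := hS.1
  obtain ⟨B, hB⟩ := exists_form hS.2.2.2
  have hB' : ∀ a b : Additive S.G, S.q a.toMul b.toMul = S.zero ↔ B a b = 0 := fun a b => hB _ _
  have hval : ∀ {x y : ZMod 2}, (x = 0 ↔ y = 0) → x = y := by decide
  have hc := S.card_eq
  rw [hn] at hc
  obtain ⟨f, hf⟩ := exists_hom_dotForm (V := Additive S.G) S.mul_self B
    (fun v w => hval (by rw [← hB', ← hB', q_eq_zero_comm])) (Additive.ofMul S.neg)
    (fun v => by
      have := (hB' _ _).1 (S.q1 v.toMul)
      change B v (Additive.ofMul S.neg + v) = 0 at this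
      rw [map_add, CharTwo.add_eq_zero] at this
      exact this.symm)
    (fun v hv => not_degenerate_iff.1 hS.2.1 v.toMul fun x => (hB' v (Additive.ofMul x)).2 (hv _))
    (fun h' => h (congrArg Additive.toMul h')) hc
  refine iso_ofForm hS.2.1 dotForm_nondegenerate ?_ f fun a b => ?_
  · rw [hc, Nat.card_fun, Nat.card_zmod, Nat.card_fin]
  · rw [hB, hf]

/-- The form is alternating. Adding an orthogonal unit vector makes it non-alternating of rank n +
1, hence a dot product. The original space is the orthogonal complement of the added vector, which
corresponds to the all-ones vector. -/
theorem IsLocalType.iso_altStr (hS : S.IsLocalType) (h : S.neg = 1) {n : ℕ} (hn : S.dim = n)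
    (hn' : ∃ a b, altForm (n + 1) a b = 1) : Even n ∧ S.Iso (altStr n hn') := by
  have := hS.1
  obtain ⟨B, hB⟩ := exists_form hS.2.2.2
  have hB' : ∀ a b : Additive S.G, S.q a.toMul b.toMul = S.zero ↔ B a b = 0 := fun a b => hB _ _
  have hval : ∀ {x y : ZMod 2}, (x = 0 ↔ y = 0) → x = y := by decide
  have hc := S.card_eq
  rw [hn] at hc
  have hsymm : ∀ v w, B v w = B w v :=
    fun v w => hval (by rw [← hB', ← hB', q_eq_zero_comm])
  have halt : ∀ v, B v v = 0 := fun v => by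
    have := S.q1 v.toMul
    rwa [h, one_mul, hB'] at this
  -- the orthogonal sum with a form of rank one
  let C : (Additive S.G × ZMod 2) →+ (Additive S.G × ZMod 2) →+ ZMod 2 :=
    AddMonoidHom.mk' (fun v => AddMonoidHom.mk' (fun w => B v.1 w.1 + v.2 * w.2)
      fun w w' => by simp only [Prod.fst_add, Prod.snd_add, map_add]; ring)
      fun v v' => by
        refine AddMonoidHom.ext fun w => ?_
        simp only [AddMonoidHom.mk'_apply, AddMonoidHom.add_apply, Prod.fst_add, Prod.snd_add,
          map_add]
        ring
  have hC : ∀ v w, C v w = B v.1 w.1 + v.2 * w.2 := fun _ _ => rfl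
  have hC1 : ∀ v, C v (0, 1) = v.2 := fun v => by rw [hC, map_zero, zero_add, mul_one]
  have hC2 : ∀ v, C v v = v.2 := fun v => by
    rw [hC, halt, zero_add]
    rcases zmod_two_cases v.2 with h | h <;> rw [h] <;> decide
  have hcC : Nat.card (Additive S.G × ZMod 2) = 2 ^ (n + 1) := by
    rw [Nat.card_prod, Nat.card_zmod, pow_succ, ← hc]
    rfl
  obtain ⟨f, hf⟩ := exists_hom_dotForm (V := Additive S.G × ZMod 2)
    (fun v => Prod.ext (S.mul_self v.1.toMul) (CharTwo.add_self_eq_zero v.2)) C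
    (fun v w => by rw [hC, hC, hsymm, mul_comm]) (0, 1) (fun v => by rw [hC1, hC2])
    (fun v hv => by
      refine Prod.ext ?_ ((hC1 v).symm.trans (hv _))
      refine not_degenerate_iff.1 hS.2.1 v.1.toMul fun x => (hB' v.1 (Additive.ofMul x)).2 ?_
      have := hv (Additive.ofMul x, 0)
      rwa [hC, mul_zero, add_zero] at this)
    (fun h' => one_ne_zero (congrArg Prod.snd h')) hcC
  have hfinj : Function.Injective f := by
    rw [injective_iff_map_eq_zero]
    intro v hv
    have h0 : ∀ w, C v w = 0 := fun w => by rw [hf, hv, map_zero, AddMonoidHom.zero_apply]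
    refine Prod.ext ?_ ((hC1 v).symm.trans (h0 _))
    refine not_degenerate_iff.1 hS.2.1 v.1.toMul fun x => (hB' v.1 (Additive.ofMul x)).2 ?_
    have := h0 (Additive.ofMul x, 0)
    rwa [hC, mul_zero, add_zero] at this
  have hfsurj : Function.Surjective f := by
    have : Finite (Additive S.G) := hS.1
    refine ((Nat.bijective_iff_injective_and_card f).2 ⟨hfinj, ?_⟩).2
    rw [hcC, Nat.card_fun, Nat.card_zmod, Nat.card_fin]
  -- Both vectors represent the functional sending v to its dot product with itself.
  have hf1 : f (0, 1) = 1 := by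
    rw [← sub_eq_zero]
    refine dotForm_nondegenerate _ fun w => ?_
    obtain ⟨v, rfl⟩ := hfsurj w
    rw [dotForm_symm, map_sub, sub_eq_zero, ← dotForm_self, ← hf, ← hf, hC1, hC2]
  constructor
  · have h1 : C (0, 1) (0, 1) = 1 := hC1 _
    -- The added vector has norm 1 and the all-ones vector has norm n + 1, which is therefore odd.
    rw [hf, hf1, dotForm_apply] at h1
    simpa [ZMod.natCast_eq_zero_iff_even] using h1
  have hmem : ∀ v : Additive S.G, f (v, 0) ∈ sumZero (n + 1) := fun v => by
    rw [mem_sumZero, ← hf1, dotForm_symm, ← hf, hC1]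
  let g : Additive S.G →+ sumZero (n + 1) :=
    (f.comp (AddMonoidHom.inl _ _)).codRestrict _ hmem
  have hnd : ∀ v : Additive S.G, ∀ w, B v w = altForm (n + 1) (g v) (g w) := fun v w => by
    have := hf (v, 0) (w, 0)
    rw [hC, mul_zero, add_zero] at this
    exact this
  have hcard : Nat.card (Additive S.G) = Nat.card (sumZero (n + 1)) := by
    rw [card_sumZero]
    exact hc
  have hgsurj : Function.Surjective g := by
    have : Finite (Additive S.G) := hS.1
    refine ((Nat.bijective_iff_injective_and_card g).2 ⟨fun v w hvw => ?_, hcard⟩).2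
    exact congrArg Prod.fst (hfinj (congrArg Subtype.val hvw))
  refine iso_ofForm hS.2.1 (fun v hv => ?_) hcard g fun a b => ?_
  · obtain ⟨v, rfl⟩ := hgsurj v
    have hv0 : v = 0 := not_degenerate_iff.1 hS.2.1 v.toMul fun x =>
      (hB' v (Additive.ofMul x)).2 ((hnd _ _).trans (hv _))
    rw [hv0, map_zero]
  · rw [hB, hnd]

end

theorem dotStr_isLocalType {n : ℕ} (hn : 3 ≤ n) : (dotStr n (by omega)).IsLocalType :=
  ofForm_isLocalType hn (by rw [Nat.card_fun, Nat.card_zmod, Nat.card_fin]) dotForm_nondegenerate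

theorem altStr_isLocalType {n : ℕ} (hn : 3 ≤ n) (he : Even n) :
    (altStr n (exists_altForm_eq_one (by omega))).IsLocalType :=
  ofForm_isLocalType hn (card_sumZero n) (altForm_nondegenerate he)

theorem dim_dotStr {n : ℕ} (hn : 0 < n) : (dotStr n hn).dim = n :=
  dim_eq_of_card (by
    change Nat.card (Fin n → ZMod 2) = _
    rw [Nat.card_fun, Nat.card_zmod, Nat.card_fin])

theorem dim_altStr {n : ℕ} (h) : (altStr n h).dim = n := dim_eq_of_card (card_sumZero n)

theorem neg_dotStr {n : ℕ} (hn : 0 < n) : (dotStr n hn).neg ≠ 1 := fun h =>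
  zero_ne_one (congrFun (congrArg Multiplicative.toAdd h) ⟨0, hn⟩).symm

theorem neg_altStr {n : ℕ} (h) : (altStr n h).neg = 1 := rfl

/-- The number of local type structures of order `n`. -/
theorem ncard_localTypes {n : ℕ} (hn : 3 ≤ n) :
    {t : IsoType | ∃ S : QuatStr, S.IsLocalType ∧ S.dim = n ∧ Quotient.mk isoSetoid S = t}.ncard =
      if Even n then 2 else 1 := by
  have hpos : 0 < n := by omega
  have halt := exists_altForm_eq_one (n := n) (by omega)
  split_ifs with he
  · have : {t : IsoType | ∃ S : QuatStr, S.IsLocalType ∧ S.dim = n ∧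
        Quotient.mk isoSetoid S = t} =
        {Quotient.mk isoSetoid (dotStr n hpos), Quotient.mk isoSetoid (altStr n halt)} := by
      ext t
      simp only [Set.mem_ofPred_eq, Set.mem_insert_iff, Set.mem_singleton_iff]
      constructor
      · rintro ⟨S, hS, hd, rfl⟩
        by_cases h : S.neg = 1
        · exact Or.inr (mk_eq_iff.2 (hS.iso_altStr h hd halt).2)
        · exact Or.inl (mk_eq_iff.2 (hS.iso_dotStr h hd hpos))
      · rintro (rfl | rfl)
        · exact ⟨_, dotStr_isLocalType hn, dim_dotStr _, rfl⟩
        · exact ⟨_, altStr_isLocalType hn he, dim_altStr _, rfl⟩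
    rw [this, Set.ncard_pair]
    rw [Ne, mk_eq_iff]
    exact fun h => neg_dotStr hpos (h.neg_eq_one_iff.2 (neg_altStr halt))
  · rw [Set.ncard_eq_one]
    refine ⟨Quotient.mk isoSetoid (dotStr n hpos), ?_⟩
    ext t
    simp only [Set.mem_ofPred_eq, Set.mem_singleton_iff]
    constructor
    · rintro ⟨S, hS, hd, rfl⟩
      by_cases h : S.neg = 1
      · exact absurd (hS.iso_altStr h hd halt).1 he
      · exact mk_eq_iff.2 (hS.iso_dotStr h hd hpos)
    · rintro rfl
      exact ⟨_, dotStr_isLocalType hn, dim_dotStr _, rfl⟩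

/-! ### Finiteness -/

theorem exists_mulEquiv {S : QuatStr} {n : ℕ} (h : Nat.card S.G = 2 ^ n) :
    Nonempty (S.G ≃* Multiplicative (Fin n → ZMod 2)) := by
  let _ : Module (ZMod 2) (Additive S.G) :=
    AddCommGroup.zmodModule (n := 2) (fun x => by
      rw [two_nsmul]; exact congrArg Additive.ofMul (S.mul_self x.toMul))
  have : Finite (Additive S.G) := Nat.finite_of_card_ne_zero (α := S.G) (by rw [h]; positivity)
  have hr : Module.finrank (ZMod 2) (Additive S.G) = n := by
    have h1 := Module.natCard_eq_pow_finrank (K := ZMod 2) (V := Additive S.G)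
    rw [Nat.card_zmod] at h1
    exact (Nat.pow_right_injective le_rfl (h.symm.trans h1)).symm
  let f := LinearEquiv.ofFinrankEq (R := ZMod 2) (Additive S.G) (Fin n → ZMod 2) (by simp [hr])
  exact ⟨MulEquiv.mk' ⟨fun a => Multiplicative.ofAdd (f (Additive.ofMul a)),
    fun b => (f.symm b.toAdd).toMul, fun a => f.symm_apply_apply (Additive.ofMul a),
    fun b => f.apply_symm_apply b.toAdd⟩ fun a b => map_add f (Additive.ofMul a) (Additive.ofMul b)⟩

theorem exists_hom_C2 {S : QuatStr} {a : S.G} (ha : a ≠ 1) :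
    ∃ f : S.G →* C2, f a = Multiplicative.ofAdd 1 := by
  let _ : Module (ZMod 2) (Additive S.G) :=
    AddCommGroup.zmodModule (n := 2) (fun x => by
      rw [two_nsmul]; exact congrArg Additive.ofMul (S.mul_self x.toMul))
  obtain ⟨f, hf⟩ : ∃ f : Module.Dual (ZMod 2) (Additive S.G), f (Additive.ofMul a) ≠ 0 := by
    by_contra! h
    exact ha (congrArg Additive.toMul
      ((Module.forall_dual_apply_eq_zero_iff (ZMod 2) (Additive.ofMul a)).1 h))
  exact ⟨MonoidHom.mk' (fun x => Multiplicative.ofAdd (f (Additive.ofMul x)))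
    fun x y => congrArg Multiplicative.ofAdd (map_add f (Additive.ofMul x) (Additive.ofMul y)),
    congrArg Multiplicative.ofAdd ((zmod_two_cases _).resolve_left hf)⟩

namespace IsoType

/-- There are only finitely many structures of a given finite order. -/
theorem finite_dim_eq (n : ℕ) : {t : IsoType | IsFin t ∧ dim t = n}.Finite := by
  classical
  let X := Multiplicative (Fin n → ZMod 2)
  have : Finite X := inferInstanceAs (Finite (Fin n → ZMod 2))
  -- An isomorphism type of order n is encoded by -1 and the zero relation on a fixed group. Codes
  -- not realized by a structure receive the irrelevant value 1.
  let R : X × (X → X → Prop) → QuatStr → Prop := fun p S =>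
    ∃ φ : S.G ≃* X, φ S.neg = p.1 ∧ ∀ a b, S.q a b = S.zero ↔ p.2 (φ a) (φ b)
  let g : X × (X → X → Prop) → IsoType := fun p =>
    if h : ∃ S, R p S then Quotient.mk isoSetoid h.choose else 1
  refine (Set.finite_range g).subset ?_
  rintro t ⟨hf, hd⟩
  induction t using Quotient.ind with | _ S
  have hf' : Finite S.G := hf
  have hc := S.card_eq
  rw [show S.dim = n from hd] at hc
  obtain ⟨φ⟩ := exists_mulEquiv hc
  let p : X × (X → X → Prop) :=
    (φ S.neg, fun x y => S.q (φ.symm x) (φ.symm y) = S.zero)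
  have hp : ∃ S, R p S := ⟨S, φ, rfl, fun a b => by simp [p]⟩
  refine ⟨p, ?_⟩
  simp only [g, dif_pos hp]
  refine mk_eq_iff.2 ?_
  obtain ⟨ψ, h1, h2⟩ := hp.choose_spec
  refine ⟨ψ.trans φ.symm, ?_, fun a b => h2 a b⟩
  rw [MulEquiv.trans_apply, h1]
  simp [p]

theorem Elem.fin {t : IsoType} (h : Elem t) : IsFin t := by
  induction t using Quotient.ind with | _ S
  exact IsElementary.finite h

theorem elemTypes_eq {n : ℕ} {P : QuatStr → Prop} {p : IsoType → Prop}
    (h : ∀ S : QuatStr, S.IsElementary → (P S ↔ p (Quotient.mk isoSetoid S))) :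
    elemTypes n P = {t | Elem t ∧ dim t = n ∧ p t} := by
  ext t
  constructor
  · rintro ⟨S, hS, ho, hP, rfl⟩
    have := hS.finite
    exact ⟨hS, S.order_eq_iff.1 ho, (h S hS).1 hP⟩
  · induction t using Quotient.ind with | _ S
    rintro ⟨hS, hd, hp⟩
    have : Finite S.G := IsElementary.finite hS
    exact ⟨S, hS, S.order_eq_iff.2 hd, (h S hS).2 hp, rfl⟩

theorem setE_eq (n : ℕ) : setE n = {t | Elem t ∧ dim t = n ∧ True} :=
  elemTypes_eq (p := fun _ => True) fun _ _ => Iff.rfl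

theorem setE'_eq (n : ℕ) : setE' n = {t | Elem t ∧ dim t = n ∧ NegOne t} :=
  elemTypes_eq fun _ _ => Iff.rfl

theorem setEd_eq (n : ℕ) : setEd n = {t | Elem t ∧ dim t = n ∧ ¬ Nondeg t} :=
  elemTypes_eq (p := fun t => ¬ Nondeg t) fun _ _ => not_not.symm

theorem setEk_eq (k n : ℕ) : setEk k n = {t | Elem t ∧ dim t = n ∧ Nondeg t ∧ lrk t = k} :=
  elemTypes_eq (p := fun t => Nondeg t ∧ lrk t = k) fun S hS => by
    have := hS.finite
    rw [S.strictlyRigid_iff]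
    rfl

theorem setEkInd_eq (k n : ℕ) :
    setEkInd k n = {t | Elem t ∧ dim t = n ∧ (Nondeg t ∧ lrk t = k) ∧ Indec t} :=
  elemTypes_eq (p := fun t => (Nondeg t ∧ lrk t = k) ∧ Indec t) fun S hS => by
    have := hS.finite
    rw [S.strictlyRigid_iff]
    rfl

theorem finite_elem (n : ℕ) (p : IsoType → Prop) : {t | Elem t ∧ dim t = n ∧ p t}.Finite :=
  (finite_dim_eq n).subset fun _ h => ⟨h.1.fin, h.2.1⟩

/-! ### Degenerate structures -/

/-- The totally degenerate type of order one with `-1 = 1`. -/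
def d₀ : IsoType := Quotient.mk isoSetoid L10

/-- The totally degenerate type of order one with `-1 ≠ 1`. -/
def d₁ : IsoType := Quotient.mk isoSetoid L11

/-- A type of structures with `q = 0`. -/
def TotDeg (t : IsoType) : Prop :=
  ∃ S : QuatStr, (∀ a b, S.q a b = S.zero) ∧ Quotient.mk isoSetoid S = t

theorem totDeg_one : TotDeg 1 := ⟨L0, fun _ _ => rfl, rfl⟩
theorem totDeg_d₀ : TotDeg d₀ := ⟨L10, fun _ _ => rfl, rfl⟩
theorem totDeg_d₁ : TotDeg d₁ := ⟨L11, fun _ _ => rfl, rfl⟩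

theorem totDeg_mul {s t : IsoType} (hs : TotDeg s) (ht : TotDeg t) : TotDeg (s * t) := by
  obtain ⟨S, hS, rfl⟩ := hs
  obtain ⟨T, hT, rfl⟩ := ht
  exact ⟨S.prod T, fun _ _ => prod_q_iff.2 ⟨hS _ _, hT _ _⟩, rfl⟩

theorem totDeg_pow {s : IsoType} (hs : TotDeg s) (n : ℕ) : TotDeg (s ^ n) := by
  induction n with
  | zero => rw [pow_zero]; exact totDeg_one
  | succ n ih => rw [pow_succ]; exact totDeg_mul ih hs

theorem elem_d₀ : Elem d₀ := .l10
theorem elem_d₁ : Elem d₁ := .l11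

theorem elem_pow {s : IsoType} (hs : Elem s) (n : ℕ) : Elem (s ^ n) := by
  induction n with
  | zero => rw [pow_zero]; exact elem_one
  | succ n ih => rw [pow_succ]; exact elem_mul ih hs

theorem not_nondeg_d₀ : ¬ Nondeg d₀ := fun h => h L10_degenerate
theorem not_nondeg_d₁ : ¬ Nondeg d₁ := fun h => h L11_degenerate
theorem negOne_d₀ : NegOne d₀ := rfl
theorem not_negOne_d₁ : ¬ NegOne d₁ := gen_ne_one
theorem dim_d₀ : dim d₀ = 1 := dim_eq_of_card card_L10
theorem dim_d₁ : dim d₁ = 1 := dim_eq_of_card card_L11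

theorem fin_pow {s : IsoType} (hs : IsFin s) (n : ℕ) : IsFin (s ^ n) := by
  induction n with
  | zero => rw [pow_zero]; exact fin_one
  | succ n ih => rw [pow_succ]; exact fin_mul ih hs

theorem negOne_pow {s : IsoType} (hs : NegOne s) (n : ℕ) : NegOne (s ^ n) := by
  induction n with
  | zero => rw [pow_zero]; rfl
  | succ n ih => rw [pow_succ]; exact negOne_mul_iff.2 ⟨ih, hs⟩

/-- Choose a character f with f(-1) ≠ 1. The shear (s, x) ↦ (s, f(s)x) corrects -1 in the second
coordinate and does not affect the zero relation, since q vanishes there. -/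
theorem mul_d₁ {t : IsoType} (ht : ¬ NegOne t) : t * d₁ = t * d₀ := by
  induction t using Quotient.ind with | _ S
  rw [d₁, d₀, mk_mul, mk_mul, mk_eq_iff]
  obtain ⟨f, hf⟩ := exists_hom_C2 (S := S) ht
  have h2 : ∀ c x : C2, c * (c * x) = x := by decide
  let s₁ : (S.prod L11).G →* C2 := snd S L11
  let s₀ : (S.prod L10).G →* C2 := snd S L10
  let g₁ : (S.prod L11).G →* L10.G := (f.comp (fst S L11) * s₁ : (S.prod L11).G →* C2)
  let g₀ : (S.prod L10).G →* L11.G := (f.comp (fst S L10) * s₀ : (S.prod L10).G →* C2)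
  refine iso_of_homs (T := S.prod L10) (S := S.prod L11) (pair (fst S L11) g₁)
    (pair (fst S L10) g₀) (fun x => prod_ext rfl (h2 (f (fst S L11 x)) (s₁ x)))
    (fun x => prod_ext rfl (h2 (f (fst S L10 x)) (s₀ x))) ?_ (fun x y => ?_)
  · refine prod_ext rfl ?_
    change f S.neg * (Multiplicative.ofAdd 1 : C2) = 1
    rw [hf]
    exact gen_mul_gen
  · rw [prod_q_iff, prod_q_iff]
    exact and_congr_right' ⟨fun _ => rfl, fun _ => rfl⟩

/-- The totally degenerate factor is the radical of the product, so an isomorphism preserves it and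
induces one between the quotients, which are the nondegenerate factors. -/
theorem eq_of_mul_totDeg_eq {s s' t t' : IsoType} (hs : Nondeg s) (hs' : Nondeg s')
    (ht : TotDeg t) (ht' : TotDeg t') (h : s * t = s' * t') : s = s' := by
  obtain ⟨D, hD, rfl⟩ := ht
  obtain ⟨D', hD', rfl⟩ := ht'
  induction s using Quotient.ind with | _ N
  induction s' using Quotient.ind with | _ N'
  obtain ⟨φ, h1, h2⟩ := mk_eq_iff.1 h
  have key : ∀ {N D N' D' : QuatStr} (φ : (N.prod D).G ≃* (N'.prod D').G),
      (∀ a b, (N.prod D).q a b = (N.prod D).zero ↔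
        (N'.prod D').q (φ a) (φ b) = (N'.prod D').zero) →
      (∀ a b, D.q a b = D.zero) → ¬ N'.Degenerate →
      (∀ z, fst N' D' (φ (inr N D z)) = 1) := by
    intro N D N' D' φ hφ hD hN' z
    refine not_degenerate_iff.1 hN' _ fun x => ?_
    obtain ⟨y, hy⟩ := φ.surjective (inl N' D' x)
    have h3 := (hφ (inr N D z) y).1 (prod_q_iff.2 ⟨by rw [fst_inr, N.one_q], hD _ _⟩)
    rw [hy, prod_q_iff, fst_inl] at h3
    exact h3.1
  have hφs : ∀ a b, (N'.prod D').q a b = (N'.prod D').zero ↔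
      (N.prod D).q (φ.symm a) (φ.symm b) = (N.prod D).zero := fun a b => by
    rw [h2, φ.apply_symm_apply, φ.apply_symm_apply]
  have k1 := key φ h2 hD hs'
  have k2 := key φ.symm hφs hD' hs
  have inl_eq : ∀ {N D : QuatStr} (x : (N.prod D).G),
      inl N D (fst N D x) = x * inr N D (snd N D x) := fun {N D} x => by
    refine prod_ext (by simp) ?_
    simp only [snd_inl, map_mul, snd_inr]
    exact (D.mul_self _).symm
  refine mk_eq_iff.2 (iso_of_homs (((fst N' D').comp φ.toMonoidHom).comp (inl N D))
    (((fst N D).comp φ.symm.toMonoidHom).comp (inl N' D')) (fun x => ?_) (fun x => ?_) ?_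
    fun x y => ?_)
  · change fst N D (φ.symm (inl N' D' (fst N' D' (φ (inl N D x))))) = x
    rw [inl_eq, map_mul, map_mul, k2, φ.symm_apply_apply, fst_inl, mul_one]
  · change fst N' D' (φ (inl N D (fst N D (φ.symm (inl N' D' x))))) = x
    rw [inl_eq, map_mul, map_mul, k1, φ.apply_symm_apply, fst_inl, mul_one]
  · change fst N' D' (φ (inl N D (fst N D (N.prod D).neg))) = N'.neg
    rw [inl_eq, map_mul, map_mul, k1, h1, fst_neg, mul_one]
  · change _ ↔ N'.q (fst N' D' (φ (inl N D x))) (fst N' D' (φ (inl N D y))) = N'.zero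
    have h3 := h2 (inl N D x) (inl N D y)
    rw [prod_q_iff, prod_q_iff] at h3
    simpa [D.q_one, hD'] using h3

theorem dim_mul_pow {s : IsoType} (hs : IsFin s) (a b : ℕ) :
    dim (s * d₀ ^ a * d₁ ^ b) = dim s + a + b := by
  have h0 : ∀ a, dim (d₀ ^ a) = a := fun a => by
    induction a with
    | zero => rw [pow_zero, dim_one]
    | succ n ih => rw [pow_succ, dim_mul (fin_pow elem_d₀.fin n) elem_d₀.fin, ih, dim_d₀]
  have h1 : ∀ a, dim (d₁ ^ a) = a := fun a => by
    induction a with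
    | zero => rw [pow_zero, dim_one]
    | succ n ih => rw [pow_succ, dim_mul (fin_pow elem_d₁.fin n) elem_d₁.fin, ih, dim_d₁]
  rw [dim_mul (fin_mul hs (fin_pow elem_d₀.fin a)) (fin_pow elem_d₁.fin b),
    dim_mul hs (fin_pow elem_d₀.fin a), h0, h1]

/-- The conditions under which `s * d₀ ^ a * d₁ ^ b` is in normal form. -/
structure IsNormal (s : IsoType) (b : ℕ) : Prop where
  elem : Elem s
  nondeg : Nondeg s
  le : b ≤ 1
  negOne : b = 1 → NegOne s

/-- The construction of t gives such an expression with arbitrary exponents. The relation d₁ * d₁ =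
d₁ * d₀ reduces b to at most 1, and `mul_d₁` removes the last d₁ when -1 ≠ 1 in s. -/
theorem exists_normal {t : IsoType} (ht : Elem t) :
    ∃ s a b, IsNormal s b ∧ t = s * d₀ ^ a * d₁ ^ b := by
  have weak : ∃ s a b, Elem s ∧ Nondeg s ∧ t = s * d₀ ^ a * d₁ ^ b := by
    induction t using Quotient.ind with | _ S
    replace ht : S.IsElementary := ht
    induction ht with
    | l0 => exact ⟨1, 0, 0, elem_one, nondeg_one, by simp [mk_L0]⟩
    | l10 => exact ⟨1, 1, 0, elem_one, nondeg_one, by simp [d₀]⟩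
    | l11 => exact ⟨1, 0, 1, elem_one, nondeg_one, by simp [d₁]⟩
    | l1 => exact ⟨Quotient.mk isoSetoid L1, 0, 0, .l1, L1_nondegenerate, by simp⟩
    | loc S hS => exact ⟨Quotient.mk isoSetoid S, 0, 0, .loc S hS, hS.2.1, by simp⟩
    | prod A B _ _ ihA ihB =>
      obtain ⟨s, a, b, h1, h2, h3⟩ := ihA
      obtain ⟨s', a', b', h1', h2', h3'⟩ := ihB
      refine ⟨s * s', a + a', b + b', elem_mul h1 h1', nondeg_mul_iff.2 ⟨h2, h2'⟩, ?_⟩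
      rw [← mk_mul, h3, h3', pow_add, pow_add]
      simp only [mul_assoc, mul_left_comm]
    | ext A hA _ =>
      rcases subsingleton_or_nontrivial A.G with h | h
      · refine ⟨1, 1, 0, elem_one, nondeg_one, ?_⟩
        have hc : Nat.card A.groupExt.G = 2 := by
          rw [card_groupExt, Nat.card_unique]
        have hn : A.groupExt.neg = 1 := by
          rw [groupExt_neg, Subsingleton.elim A.neg 1, map_one]
        simp only [one_mul, pow_one, pow_zero, mul_one]
        refine mk_eq_iff.2 (iso_of_card_eq_two hc card_C2 ⟨fun _ => rfl, fun _ => hn⟩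
          ⟨fun _ => rfl, fun _ => by rw [hn, q_one]⟩)
      · exact ⟨Quotient.mk isoSetoid A.groupExt, 0, 0, hA.ext, A.groupExt_nondegenerate, by simp⟩
    | iso A B h _ ih =>
      rw [← mk_eq_iff.2 h]
      exact ih
  obtain ⟨s, a, b, h1, h2, rfl⟩ := weak
  have hd : d₁ * d₁ = d₁ * d₀ := mul_d₁ not_negOne_d₁
  have hpow : ∀ b, d₁ ^ (b + 1) = d₁ * d₀ ^ b := fun b => by
    induction b with
    | zero => simp
    | succ b ih => rw [pow_succ, ih, mul_right_comm, hd, mul_assoc, ← pow_succ']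
  rcases b with _ | b
  · exact ⟨s, a, 0, ⟨h1, h2, zero_le_one, by simp⟩, rfl⟩
  by_cases hs : NegOne s
  · refine ⟨s, a + b, 1, ⟨h1, h2, le_rfl, fun _ => hs⟩, ?_⟩
    rw [hpow, pow_one, pow_add]
    simp only [mul_assoc, mul_comm d₁]
  · refine ⟨s, a + b + 1, 0, ⟨h1, h2, zero_le_one, by simp⟩, ?_⟩
    rw [hpow, pow_zero, mul_one, pow_succ, pow_add, mul_right_comm, ← mul_assoc, mul_d₁ hs]
    simp only [mul_assoc]
    rw [mul_comm (d₀ ^ b) (d₀ ^ a), mul_left_comm d₀, mul_comm d₀ (d₀ ^ b)]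

theorem negOne_normal_iff {s : IsoType} {a b : ℕ} (h : IsNormal s b) :
    NegOne (s * d₀ ^ a * d₁ ^ b) ↔ NegOne s ∧ b = 0 := by
  rw [negOne_mul_iff, negOne_mul_iff]
  have := h.le
  interval_cases b
  · simp only [negOne_pow negOne_d₀, pow_zero, and_true]
    exact and_iff_left rfl
  · simp [not_negOne_d₁]

/-- The nondegenerate part determines s, the order determines a + b, and b records whether -1 = 1,
because b = 1 is allowed only if -1 = 1 in s. -/
theorem normal_unique {s s' : IsoType} {a a' b b' : ℕ} (h : IsNormal s b) (h' : IsNormal s' b')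
    (he : s * d₀ ^ a * d₁ ^ b = s' * d₀ ^ a' * d₁ ^ b') : s = s' ∧ a = a' ∧ b = b' := by
  have hs : s = s' := by
    refine eq_of_mul_totDeg_eq h.nondeg h'.nondeg ?_ ?_ ((mul_assoc _ _ _).symm.trans
      (he.trans (mul_assoc _ _ _)))
    · exact totDeg_mul (totDeg_pow totDeg_d₀ _) (totDeg_pow totDeg_d₁ _)
    · exact totDeg_mul (totDeg_pow totDeg_d₀ _) (totDeg_pow totDeg_d₁ _)
  subst hs
  have hd := congrArg dim he
  rw [dim_mul_pow h.elem.fin, dim_mul_pow h.elem.fin] at hd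
  have hb : b = b' := by
    have h1 := negOne_normal_iff (a := a) h
    rw [he, negOne_normal_iff h'] at h1
    have h2 := h.le
    have h3 := h'.le
    have h4 := h.negOne
    have h5 := h'.negOne
    by_cases hs : NegOne s
    · simp only [hs, true_and] at h1
      omega
    · have : b ≠ 1 := fun h => hs (h4 h)
      have : b' ≠ 1 := fun h => hs (h5 h)
      omega
  exact ⟨rfl, by omega, hb⟩

/-- The number of degenerate elementary types. -/
theorem ncard_setEd (m : ℕ) :
    (setEd (m + 2)).ncard + (setE' m).ncard = (setE (m + 1)).ncard + (setE' (m + 1)).ncard := by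
  rw [setEd_eq, setE'_eq, setE_eq, setE'_eq]
  have m0 : ∀ s a b, s * d₀ ^ a * d₁ ^ b * d₀ = s * d₀ ^ (a + 1) * d₁ ^ b := fun s a b => by
    rw [mul_right_comm, pow_succ, mul_assoc s]
  have m1 : ∀ s a b, s * d₀ ^ a * d₁ ^ b * d₁ = s * d₀ ^ a * d₁ ^ (b + 1) := fun s a b => by
    rw [pow_succ, mul_assoc _ (d₁ ^ b)]
  have inj0 : ∀ {s t}, Elem s → Elem t → s * d₀ = t * d₀ → s = t := by
    intro s t hs ht h
    obtain ⟨s, a, b, h1, rfl⟩ := exists_normal hs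
    obtain ⟨t, a', b', h2, rfl⟩ := exists_normal ht
    rw [m0, m0] at h
    obtain ⟨rfl, h3, rfl⟩ := normal_unique h1 h2 h
    rw [add_right_cancel h3]
  have inj1 : ∀ {s t}, Elem s → Elem t → NegOne s → NegOne t → s * d₁ = t * d₁ → s = t := by
    intro s t hs ht hns hnt h
    obtain ⟨s, a, b, h1, rfl⟩ := exists_normal hs
    obtain ⟨t, a', b', h2, rfl⟩ := exists_normal ht
    obtain ⟨hns', rfl⟩ := (negOne_normal_iff h1).1 hns
    obtain ⟨hnt', rfl⟩ := (negOne_normal_iff h2).1 hnt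
    rw [m1, m1] at h
    obtain ⟨rfl, rfl, -⟩ := normal_unique ⟨h1.elem, h1.nondeg, le_rfl, fun _ => hns'⟩
      ⟨h2.elem, h2.nondeg, le_rfl, fun _ => hnt'⟩ h
    rfl
  have dim0 : ∀ {s}, Elem s → dim (s * d₀) = dim s + 1 := fun hs => by
    rw [dim_mul hs.fin elem_d₀.fin, dim_d₀]
  have dim1 : ∀ {s}, Elem s → dim (s * d₁) = dim s + 1 := fun hs => by
    rw [dim_mul hs.fin elem_d₁.fin, dim_d₁]
  -- In normal form a degenerate type either has a > 0 and is divisible by d₀, or is s * d₁ with -1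
  -- = 1 in s. Multiplication by d₁ is used only on types with -1 = 1, where it is injective.
  have hU : {t | Elem t ∧ dim t = m + 2 ∧ ¬ Nondeg t} =
      (fun t => t * d₀) '' {t | Elem t ∧ dim t = m + 1 ∧ True} ∪
      (fun t => t * d₁) '' {t | Elem t ∧ dim t = m + 1 ∧ NegOne t} := by
    ext t
    constructor
    · rintro ⟨he, hd, hn⟩
      obtain ⟨s, a, b, h1, rfl⟩ := exists_normal he
      have hE : ∀ a b, Elem (s * d₀ ^ a * d₁ ^ b) := fun a b =>
        elem_mul (elem_mul h1.elem (elem_pow elem_d₀ a)) (elem_pow elem_d₁ b)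
      rw [dim_mul_pow h1.elem.fin] at hd
      rcases a with _ | a
      · have hb := h1.le
        interval_cases b
        · exact absurd (by simpa using h1.nondeg) hn
        · refine Or.inr ⟨s, ⟨h1.elem, ?_, h1.negOne rfl⟩, by simp⟩
          omega
      · refine Or.inl ⟨s * d₀ ^ a * d₁ ^ b, ⟨hE _ _, ?_, trivial⟩, m0 _ _ _⟩
        rw [dim_mul_pow h1.elem.fin]
        omega
    · rintro (⟨s, ⟨he, hd, -⟩, rfl⟩ | ⟨s, ⟨he, hd, -⟩, rfl⟩)
      · exact ⟨elem_mul he elem_d₀, (dim0 he).trans (by rw [hd]),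
          fun h => not_nondeg_d₀ (nondeg_mul_iff.1 h).2⟩
      · exact ⟨elem_mul he elem_d₁, (dim1 he).trans (by rw [hd]),
          fun h => not_nondeg_d₁ (nondeg_mul_iff.1 h).2⟩
  have hI : (fun t => t * d₀) '' {t | Elem t ∧ dim t = m + 1 ∧ True} ∩
      (fun t => t * d₁) '' {t | Elem t ∧ dim t = m + 1 ∧ NegOne t} =
      (fun t => t * d₀ * d₁) '' {t | Elem t ∧ dim t = m ∧ NegOne t} := by
    ext x
    constructor
    · rintro ⟨⟨s, ⟨hs, hds, -⟩, rfl⟩, ⟨t, ⟨ht, hdt, hnt⟩, h⟩⟩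
      obtain ⟨s, a, b, h1, rfl⟩ := exists_normal hs
      obtain ⟨t, a', b', h2, rfl⟩ := exists_normal ht
      obtain ⟨hnt', rfl⟩ := (negOne_normal_iff h2).1 hnt
      have h' := h
      simp only at h h'
      rw [m0, m1] at h
      obtain ⟨rfl, h3, rfl⟩ := normal_unique ⟨h2.elem, h2.nondeg, le_rfl, fun _ => hnt'⟩ h1 h
      refine ⟨t * d₀ ^ a * d₁ ^ 0, ⟨?_, ?_, ?_⟩, ?_⟩
      · exact elem_mul (elem_mul h2.elem (elem_pow elem_d₀ a)) (elem_pow elem_d₁ 0)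
      · rw [dim_mul_pow h2.elem.fin] at hds ⊢
        omega
      · exact (negOne_normal_iff h2).2 ⟨hnt', rfl⟩
      · simp only
        rw [m0, m1, m0]
    · rintro ⟨s, ⟨hs, hds, hn⟩, rfl⟩
      refine ⟨⟨s * d₁, ⟨elem_mul hs elem_d₁, (dim1 hs).trans (by rw [hds]), trivial⟩,
        mul_right_comm _ _ _⟩, ⟨s * d₀, ⟨elem_mul hs elem_d₀, (dim0 hs).trans (by rw [hds]),
        negOne_mul_iff.2 ⟨hn, negOne_d₀⟩⟩, rfl⟩⟩
  have c0 : ((fun t => t * d₀) '' {t | Elem t ∧ dim t = m + 1 ∧ True}).ncard =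
      {t | Elem t ∧ dim t = m + 1 ∧ True}.ncard :=
    Set.InjOn.ncard_image fun s hs t ht h => inj0 hs.1 ht.1 h
  have c1 : ((fun t => t * d₁) '' {t | Elem t ∧ dim t = m + 1 ∧ NegOne t}).ncard =
      {t | Elem t ∧ dim t = m + 1 ∧ NegOne t}.ncard :=
    Set.InjOn.ncard_image fun s hs t ht h => inj1 hs.1 ht.1 hs.2.2 ht.2.2 h
  have c2 : ((fun t => t * d₀ * d₁) '' {t | Elem t ∧ dim t = m ∧ NegOne t}).ncard =
      {t | Elem t ∧ dim t = m ∧ NegOne t}.ncard := by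
    refine Set.InjOn.ncard_image fun s hs t ht h => inj0 hs.1 ht.1 ?_
    exact inj1 (elem_mul hs.1 elem_d₀) (elem_mul ht.1 elem_d₀)
      (negOne_mul_iff.2 ⟨hs.2.2, negOne_d₀⟩) (negOne_mul_iff.2 ⟨ht.2.2, negOne_d₀⟩) h
  rw [← c0, ← c1, ← c2, hU, ← hI]
  exact Set.ncard_union_add_ncard_inter _ _ ((finite_elem _ _).image _)
    ((finite_elem _ _).image _)

end IsoType
end QuatStr

/-! ### Counting multisets -/

section Counting

variable {ι T A : Type*} [Fintype ι] [DecidableEq T]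

theorem Multiset.filter_sum_eq {X : ι → Finset T} (hX : ∀ i j x, x ∈ X i → x ∈ X j → i = j)
    {f : ι → Multiset T} (hf : ∀ i, ∀ x ∈ f i, x ∈ X i) (i : ι) :
    (∑ j, f j).filter (· ∈ X i) = f i := by
  ext x
  rw [Multiset.count_filter]
  split_ifs with hx
  · rw [Multiset.count_sum', Finset.sum_eq_single i]
    · intro j _ hji
      exact Multiset.count_eq_zero.2 fun h => hji (hX _ _ _ (hf j x h) hx)
    · simp
  · exact (Multiset.count_eq_zero.2 fun h => hx (hf i x h)).symm

theorem Multiset.sum_filter_eq {X : ι → Finset T} (hX : ∀ i j x, x ∈ X i → x ∈ X j → i = j)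
    {M : Multiset T} (hM : ∀ x ∈ M, ∃ i, x ∈ X i) : ∑ i, M.filter (· ∈ X i) = M := by
  ext x
  simp only [Multiset.count_sum', Multiset.count_filter]
  by_cases hx : x ∈ M
  · obtain ⟨i, hi⟩ := hM x hx
    rw [Finset.sum_eq_single i, if_pos hi]
    · intro j _ hji
      exact if_neg fun h => hji (hX _ _ _ h hi)
    · simp
  · rw [Multiset.count_eq_zero.2 hx]
    simp

theorem Multiset.sum_map_eq_of_filter {X : ι → Finset T}
    (hX : ∀ i j x, x ∈ X i → x ∈ X j → i = j) {M : Multiset T} (hM : ∀ x ∈ M, ∃ i, x ∈ X i)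
    (g : T → ℕ) (c : ι → ℕ) (hg : ∀ i, ∀ x ∈ X i, g x = c i) :
    (M.map g).sum = ∑ i, c i * (M.filter (· ∈ X i)).card := by
  have h : (M.map g).sum = ∑ i, ((M.filter (· ∈ X i)).map g).sum := by
    conv_lhs => rw [← Multiset.sum_filter_eq hX hM]
    exact map_sum ((Multiset.sumAddMonoidHom).comp (Multiset.mapAddMonoidHom g)) _ _
  rw [h]
  refine Finset.sum_congr rfl fun i _ => ?_
  rw [Multiset.map_congr rfl fun x hx => hg i x (Multiset.mem_filter.1 hx).2, Multiset.map_const',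
    Multiset.sum_replicate, smul_eq_mul, mul_comm]

/-- The number of multisets with prescribed numbers of elements in each of finitely many
disjoint finite sets. -/
theorem ncard_multisets {X : ι → Finset T} (hX : ∀ i j x, x ∈ X i → x ∈ X j → i = j)
    (P : Finset A) (w : A → ι → ℕ) (hw : Function.Injective w) :
    {M : Multiset T | (∀ x ∈ M, ∃ i, x ∈ X i) ∧
      ∃ m ∈ P, ∀ i, (M.filter (· ∈ X i)).card = w m i}.ncard =
      ∑ m ∈ P, ∏ i, Nat.multichoose (X i).card (w m i) := by
  classical
  let S : ι → ℕ → Finset (Multiset T) := fun i c =>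
    ((X i).sym c).map ⟨Sym.toMultiset, Sym.coe_injective⟩
  have hS : ∀ i c M, M ∈ S i c ↔ M.card = c ∧ ∀ x ∈ M, x ∈ X i := by
    intro i c M
    simp only [S, Finset.mem_map, Finset.mem_sym_iff, Function.Embedding.coeFn_mk]
    constructor
    · rintro ⟨s, hs, rfl⟩
      exact ⟨s.2, hs⟩
    · rintro ⟨h1, h2⟩
      exact ⟨⟨M, h1⟩, h2, rfl⟩
  have hSc : ∀ i c, (S i c).card = Nat.multichoose (X i).card c := by
    intro i c
    rw [Finset.card_map, ← Finset.attach_map_val (s := X i), Finset.sym_map, Finset.card_map,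
      Finset.attach_eq_univ, Finset.sym_univ, Finset.card_univ, Sym.card_sym_eq_multichoose,
      Finset.card_map, Finset.card_univ]
  let F : A → Finset (ι → Multiset T) := fun m => Fintype.piFinset fun i => S i (w m i)
  have hF : ∀ m f, f ∈ F m ↔ ∀ i, (f i).card = w m i ∧ ∀ x ∈ f i, x ∈ X i := by
    intro m f
    simp only [F, Fintype.mem_piFinset, hS]
  have himg : {M : Multiset T | (∀ x ∈ M, ∃ i, x ∈ X i) ∧
      ∃ m ∈ P, ∀ i, (M.filter (· ∈ X i)).card = w m i} =
      (fun f : ι → Multiset T => ∑ i, f i) '' (P.biUnion F : Set (ι → Multiset T)) := by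
    ext M
    simp only [Set.mem_image, Finset.mem_coe, Finset.mem_biUnion]
    constructor
    · rintro ⟨h1, m, hm, h2⟩
      exact ⟨fun i => M.filter (· ∈ X i), ⟨m, hm, (hF _ _).2 fun i =>
        ⟨h2 i, fun x hx => (Multiset.mem_filter.1 hx).2⟩⟩, Multiset.sum_filter_eq hX h1⟩
    · rintro ⟨f, ⟨m, hm, hf⟩, rfl⟩
      rw [hF] at hf
      refine ⟨fun x hx => ?_, m, hm, fun i => ?_⟩
      · obtain ⟨i, -, hi⟩ := Multiset.mem_sum.1 hx
        exact ⟨i, (hf i).2 x hi⟩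
      · rw [Multiset.filter_sum_eq hX (fun i => (hf i).2), (hf i).1]
  rw [himg, Set.InjOn.ncard_image, Set.ncard_coe_finset, Finset.card_biUnion]
  · refine Finset.sum_congr rfl fun m _ => ?_
    rw [Fintype.card_piFinset]
    exact Finset.prod_congr rfl fun i _ => hSc i _
  -- The numbers of members in the individual sets determine m by injectivity of w, so the families
  -- for different m are disjoint.
  · intro m _ m' _ hmm'
    refine Finset.disjoint_left.2 ?_
    intro f hf hf'
    rw [hF] at hf hf'
    exact hmm' (hw (funext fun i => (hf i).1.symm.trans (hf' i).1))
  · intro f hf g hg hfg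
    simp only [Finset.mem_coe, Finset.mem_biUnion] at hf hg
    obtain ⟨m, -, hf⟩ := hf
    obtain ⟨m', -, hg⟩ := hg
    rw [hF] at hf hg
    funext i
    rw [← Multiset.filter_sum_eq hX (fun i => (hf i).2) i,
      ← Multiset.filter_sum_eq hX (fun i => (hg i).2) i]
    exact congrArg _ hfg

end Counting

/-! ### Counting nondegenerate types by their factorizations -/

namespace QuatStr
namespace IsoType

/-- The types of nondegenerate indecomposable structures of elementary type. -/
def Prim (t : IsoType) : Prop := Elem t ∧ Nondeg t ∧ Indec t

theorem exists_prod_eq {t : IsoType} (he : Elem t) (hn : Nondeg t) :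
    ∃ M : Multiset IsoType, (∀ x ∈ M, Prim x) ∧ M.prod = t := by
  induction t using Quotient.ind with | _ S
  exact IsElementary.exists_multiset he hn

theorem elem_prod {M : Multiset IsoType} (hM : ∀ x ∈ M, Prim x) : Elem M.prod :=
  Multiset.prod_induction Elem _ (fun _ _ => elem_mul) elem_one fun t ht => (hM t ht).1

theorem nondeg_prod {M : Multiset IsoType} (hM : ∀ x ∈ M, Prim x) : Nondeg M.prod :=
  Multiset.prod_induction Nondeg _ (fun _ _ h h' => nondeg_mul_iff.2 ⟨h, h'⟩) nondeg_one
    fun t ht => (hM t ht).2.1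

theorem dim_prod_eq {M : Multiset IsoType} (hM : ∀ x ∈ M, Prim x) :
    dim M.prod = (M.map dim).sum := by
  induction M using Multiset.induction_on with
  | empty => exact dim_one
  | cons x M ih =>
    have h := Multiset.forall_mem_cons.1 hM
    rw [Multiset.prod_cons, dim_mul h.1.1.fin (elem_prod h.2).fin, ih h.2, Multiset.map_cons,
      Multiset.sum_cons]

theorem lrk_prod_eq {M : Multiset IsoType} (hM : ∀ x ∈ M, Prim x) :
    lrk M.prod = (M.map lrk).sum := by
  induction M using Multiset.induction_on with
  | empty => exact lrk_one
  | cons x M ih =>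
    have h := Multiset.forall_mem_cons.1 hM
    rw [Multiset.prod_cons, lrk_mul h.1.1.fin (elem_prod h.2).fin, ih h.2, Multiset.map_cons,
      Multiset.sum_cons]

theorem eq_of_prod_eq_prod {M N : Multiset IsoType} (hM : ∀ x ∈ M, Prim x)
    (hN : ∀ x ∈ N, Prim x) (h : M.prod = N.prod) : M = N :=
  eq_of_prod_eq (fun t ht => ⟨(hM t ht).2.2, (hM t ht).2.1⟩) (fun t ht => (hN t ht).2.2) h

theorem finite_setEkInd (k n : ℕ) : (setEkInd k n).Finite := by
  rw [setEkInd_eq]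
  exact finite_elem _ _

theorem finite_setEk (k n : ℕ) : (setEk k n).Finite := by
  rw [setEk_eq]
  exact finite_elem _ _

theorem mem_setEkInd {k n : ℕ} {t : IsoType} :
    t ∈ setEkInd k n ↔ Prim t ∧ dim t = n ∧ lrk t = k := by
  rw [setEkInd_eq]
  exact ⟨fun ⟨h1, h2, ⟨h3, h4⟩, h5⟩ => ⟨⟨h1, h3, h5⟩, h2, h4⟩,
    fun ⟨⟨h1, h3, h5⟩, h2, h4⟩ => ⟨h1, h2, ⟨h3, h4⟩, h5⟩⟩

theorem mem_setEk {k n : ℕ} {t : IsoType} :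
    t ∈ setEk k n ↔ Elem t ∧ dim t = n ∧ Nondeg t ∧ lrk t = k := by
  rw [setEk_eq]
  rfl

/-- By unique factorization a type is a multiset of indecomposables. The entry m i j is the number
of factors with `lrk` i and order j + 1, and additivity of both invariants gives the two equations
defining the index set. -/
theorem eK_eq_sum (k n : ℕ) : eK k n = ∑ m ∈ P k n, ∏ i : Fin (k + 1), ∏ j : Fin n,
    Nat.choose (eInd (i : ℕ) ((j : ℕ) + 1) + m i j - 1) (m i j) := by
  classical
  let X : Fin (k + 1) × Fin n → Finset IsoType := fun x =>
    (finite_setEkInd x.1 (x.2 + 1)).toFinset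
  have hX' : ∀ x t, t ∈ X x ↔ Prim t ∧ dim t = x.2 + 1 ∧ lrk t = x.1 := fun x t => by
    rw [Set.Finite.mem_toFinset, mem_setEkInd]
  have hX : ∀ x y t, t ∈ X x → t ∈ X y → x = y := by
    intro x y t hx hy
    rw [hX'] at hx hy
    refine Prod.ext (Fin.ext ?_) (Fin.ext ?_)
    · rw [← hx.2.2, hy.2.2]
    · have := hx.2.1.symm.trans hy.2.1
      omega
  have hXc : ∀ x, (X x).card = eInd x.1 (x.2 + 1) := fun x =>
    (Set.ncard_eq_toFinset_card _ _).symm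
  have hcount := ncard_multisets hX (P k n) (fun m x => m x.1 x.2)
    (fun m m' h => funext fun i => funext fun j => congrFun h (i, j))
  simp only [Fintype.prod_prod_type, hXc, Nat.multichoose_eq] at hcount
  rw [← hcount, eK]
  have hprim : ∀ {M : Multiset IsoType}, (∀ x ∈ M, ∃ i, x ∈ X i) → ∀ x ∈ M, Prim x := by
    intro M hM x hx
    obtain ⟨i, hi⟩ := hM x hx
    exact ((hX' _ _).1 hi).1
  have hsum : ∀ {M : Multiset IsoType}, (∀ x ∈ M, ∃ i, x ∈ X i) →
      lrk M.prod = ∑ i : Fin (k + 1), ∑ j : Fin n,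
        (i : ℕ) * (M.filter (· ∈ X (i, j))).card ∧
      dim M.prod = ∑ i : Fin (k + 1), ∑ j : Fin n,
        ((j : ℕ) + 1) * (M.filter (· ∈ X (i, j))).card := by
    intro M hM
    rw [lrk_prod_eq (hprim hM), dim_prod_eq (hprim hM),
      Multiset.sum_map_eq_of_filter hX hM lrk (fun x => x.1) fun x t ht => ((hX' _ _).1 ht).2.2,
      Multiset.sum_map_eq_of_filter hX hM dim (fun x => x.2 + 1) fun x t ht => ((hX' _ _).1 ht).2.1,
      Fintype.sum_prod_type, Fintype.sum_prod_type]
    exact ⟨rfl, rfl⟩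
  have himg : setEk k n = Multiset.prod '' {M : Multiset IsoType | (∀ x ∈ M, ∃ i, x ∈ X i) ∧
      ∃ m ∈ P k n, ∀ x : Fin (k + 1) × Fin n,
        (M.filter (· ∈ X x)).card = m x.1 x.2} := by
    ext t
    rw [mem_setEk]
    constructor
    · rintro ⟨he, hd, hn, hl⟩
      obtain ⟨M, hM, rfl⟩ := exists_prod_eq he hn
      have hMX : ∀ x ∈ M, ∃ i, x ∈ X i := by
        intro x hx
        have h1 : dim x ≤ n := by
          rw [← hd, dim_prod_eq hM]
          exact Multiset.le_sum_of_mem (Multiset.mem_map_of_mem _ hx)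
        have h2 : lrk x ≤ k := by
          rw [← hl, lrk_prod_eq hM]
          exact Multiset.le_sum_of_mem (Multiset.mem_map_of_mem _ hx)
        have hp := hM x hx
        have h3 : dim x ≠ 0 := by
          rw [Ne, dim_eq_zero_iff hp.1.fin]
          exact (indec_iff.1 hp.2.2).1
        -- Column j stands for order j + 1; the subtraction is harmless because an indecomposable
        -- has positive order.
        refine ⟨(⟨lrk x, by omega⟩, ⟨dim x - 1, by omega⟩), (hX' _ _).2 ⟨hp, ?_, rfl⟩⟩
        simp only
        omega
      obtain ⟨h1, h2⟩ := hsum hMX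
      exact ⟨M, ⟨hMX, fun i j => (M.filter (· ∈ X (i, j))).card, (Set.Finite.mem_toFinset _).2
        ⟨h1.symm.trans hl, h2.symm.trans hd⟩, fun _ => rfl⟩, rfl⟩
    · rintro ⟨M, ⟨hM, m, hm, hMm⟩, rfl⟩
      rw [P, Set.Finite.mem_toFinset] at hm
      obtain ⟨h1, h2⟩ := hsum hM
      refine ⟨elem_prod (hprim hM), ?_, nondeg_prod (hprim hM), ?_⟩
      · rw [h2]
        refine Eq.trans ?_ hm.2
        exact Finset.sum_congr rfl fun i _ => Finset.sum_congr rfl fun j _ => by rw [hMm]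
      · rw [h1]
        refine Eq.trans ?_ hm.1
        exact Finset.sum_congr rfl fun i _ => Finset.sum_congr rfl fun j _ => by rw [hMm]
  rw [himg]
  exact Set.InjOn.ncard_image fun M hM N hN h => eq_of_prod_eq_prod (hprim hM.1) (hprim hN.1) h

/-- Exactly one indecomposable factor has `lrk` 1, and the product of the others has `lrk` 0. The
distinguished factor has order at least 2 by `lrk_lt_dim`. -/
theorem eK_one_eq_sum (n : ℕ) : eK 1 n = ∑ j ∈ Finset.Icc 2 n, eInd 1 j * eK 0 (n - j) := by
  classical
  let A : ℕ → Finset IsoType := fun j => (finite_setEkInd 1 j).toFinset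
  let B : ℕ → Finset IsoType := fun j => (finite_setEk 0 j).toFinset
  have hA : ∀ j t, t ∈ A j ↔ Prim t ∧ dim t = j ∧ lrk t = 1 := fun j t => by
    rw [Set.Finite.mem_toFinset, mem_setEkInd]
  have hB : ∀ j t, t ∈ B j ↔ Elem t ∧ dim t = j ∧ Nondeg t ∧ lrk t = 0 := fun j t => by
    rw [Set.Finite.mem_toFinset, mem_setEk]
  have hcard : ∑ j ∈ Finset.Icc 2 n, eInd 1 j * eK 0 (n - j) =
      ((Finset.Icc 2 n).biUnion fun j => A j ×ˢ B (n - j)).card := by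
    rw [Finset.card_biUnion]
    · refine Finset.sum_congr rfl fun j _ => ?_
      rw [Finset.card_product, eInd, eK, Set.ncard_eq_toFinset_card _ (finite_setEkInd 1 j),
        Set.ncard_eq_toFinset_card _ (finite_setEk 0 (n - j))]
    · intro i _ j _ hij
      refine Finset.disjoint_left.2 ?_
      intro p hp hp'
      rw [Finset.mem_product, hA] at hp hp'
      exact hij (hp.1.2.1.symm.trans hp'.1.2.1)
  have himg : setEk 1 n = (fun p : IsoType × IsoType => p.1 * p.2) ''
      ((Finset.Icc 2 n).biUnion fun j => A j ×ˢ B (n - j) : Finset (IsoType × IsoType)) := by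
    ext t
    rw [mem_setEk]
    simp only [Set.mem_image, Finset.mem_coe, Finset.mem_biUnion, Finset.mem_product, hA, hB,
      Finset.mem_Icc]
    constructor
    · rintro ⟨he, hd, hn, hl⟩
      obtain ⟨M, hM, rfl⟩ := exists_prod_eq he hn
      obtain ⟨x, hx, hx0⟩ : ∃ x ∈ M, lrk x ≠ 0 := by
        by_contra! h
        rw [lrk_prod_eq hM, Multiset.map_congr rfl h] at hl
        simp at hl
      obtain ⟨N, rfl⟩ := Multiset.exists_cons_of_mem hx
      have h := Multiset.forall_mem_cons.1 hM
      have hf := (elem_prod h.2).fin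
      rw [Multiset.prod_cons] at hd hl ⊢
      rw [lrk_mul h.1.1.fin hf] at hl
      rw [dim_mul h.1.1.fin hf] at hd
      have hlt := lrk_lt_dim h.1.1.fin h.1.2.1 (indec_iff.1 h.1.2.2).1
      have hd' : dim N.prod = n - dim x := by omega
      have hl' : lrk N.prod = 0 := by omega
      have hx1 : lrk x = 1 := by omega
      exact ⟨(x, N.prod), ⟨dim x, by omega, ⟨h.1, rfl, hx1⟩, elem_prod h.2, hd',
        nondeg_prod h.2, hl'⟩, rfl⟩
    · rintro ⟨⟨a, b⟩, ⟨j, hj, ⟨h1, h2, h3⟩, h4, h5, h6, h7⟩, rfl⟩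
      refine ⟨elem_mul h1.1 h4, ?_, nondeg_mul_iff.2 ⟨h1.2.1, h6⟩, ?_⟩
      · rw [dim_mul h1.1.fin h4.fin]
        omega
      · rw [lrk_mul h1.1.fin h4.fin]
        omega
  rw [hcard, eK, himg, Set.InjOn.ncard_image, Set.ncard_coe_finset]
  rintro ⟨a, b⟩ hp ⟨a', b'⟩ hp' h
  simp only [Finset.mem_coe, Finset.mem_biUnion, Finset.mem_product, hA, hB] at hp hp' h
  obtain ⟨j, -, ⟨h1, h2, h3⟩, h4, h5, h6, h7⟩ := hp
  obtain ⟨j', -, ⟨h1', h2', h3'⟩, h4', h5', h6', h7'⟩ := hp'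
  obtain ⟨M, hM, rfl⟩ := exists_prod_eq h4 h6
  obtain ⟨M', hM', rfl⟩ := exists_prod_eq h4' h6'
  rw [← Multiset.prod_cons, ← Multiset.prod_cons] at h
  have he := eq_of_prod_eq_prod (Multiset.forall_mem_cons.2 ⟨h1, hM⟩)
    (Multiset.forall_mem_cons.2 ⟨h1', hM'⟩) h
  -- The factor a has nonzero `lrk`, so it cannot occur among the factors of the second product,
  -- whose `lrk` is 0.
  have ha : a = a' := by
    have := Multiset.mem_cons_self a M
    rw [he, Multiset.mem_cons] at this
    refine this.resolve_right fun hm => ?_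
    rw [lrk_prod_eq hM'] at h7'
    have := Multiset.le_sum_of_mem (Multiset.mem_map_of_mem lrk hm)
    omega
  subst ha
  rw [(Multiset.cons_inj_right a).1 he]

end IsoType
end QuatStr

namespace QuatStr
namespace IsoType

/-! ### Group extensions of types -/

/-- The group extension of an isomorphism type. -/
def ext (t : IsoType) : IsoType := Quotient.map groupExt (fun _ _ h => Iso.groupExt h) t

theorem ext_injective {s t : IsoType} (hs : IsFin s) (h : ext s = ext t) : s = t := by
  induction s using Quotient.ind with | _ S
  induction t using Quotient.ind with | _ T
  have : Finite S.G := hs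
  exact mk_eq_iff.2 (iso_of_groupExt_iso (mk_eq_iff.1 h))

theorem elem_ext {t : IsoType} : Elem (ext t) ↔ Elem t := by
  induction t using Quotient.ind with | _ S
  exact ⟨fun h => IsElementary.of_groupExt h (Iso.refl _), fun h => .ext S h⟩

theorem dim_ext {t : IsoType} (ht : IsFin t) : dim (ext t) = dim t + 1 := by
  induction t using Quotient.ind with | _ S
  have : Finite S.G := ht
  exact dim_groupExt S

theorem nondeg_ext {t : IsoType} (ht : t ≠ 1) : Nondeg (ext t) := by
  rw [← pos_iff] at ht
  induction t using Quotient.ind with | _ S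
  have : Nontrivial S.G := ht
  exact groupExt_nondegenerate S

theorem lrk_ext_le {t : IsoType} (ht : IsFin t) : lrk (ext t) ≤ 1 := by
  induction t using Quotient.ind with | _ S
  have : Finite S.G := ht
  exact lrk_groupExt_le S

theorem lrk_ext_eq_zero_iff {t : IsoType} (ht : IsFin t) (h1 : t ≠ 1) :
    lrk (ext t) = 0 ↔ lrk t = 0 := by
  rw [← pos_iff] at h1
  induction t using Quotient.ind with | _ S
  have : Finite S.G := ht
  have : Nontrivial S.G := h1
  exact lrk_groupExt_eq_zero_iff S

theorem indec_ext {t : IsoType} (ht : IsFin t) (h : 2 ≤ dim t) : Indec (ext t) := by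
  induction t using Quotient.ind with | _ S
  have : Finite S.G := ht
  exact indecomposable_groupExt h

theorem nondeg_of_lrk_eq_zero {t : IsoType} (ht : IsFin t) (h : lrk t = 0) : Nondeg t := by
  induction t using Quotient.ind with | _ S
  have : Finite S.G := ht
  exact nondegenerate_of_lrk_eq_zero h

theorem ne_one_of_dim_pos {t : IsoType} (h : 0 < dim t) : t ≠ 1 := by
  rintro rfl
  rw [dim_one] at h
  exact lt_irrefl _ h

theorem fin_of_mul {s t : IsoType} (h : IsFin (s * t)) : IsFin s := by
  induction s using Quotient.ind with | _ S
  induction t using Quotient.ind with | _ T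
  have : Finite (S.G × T.G) := h
  exact Finite.prod_left T.G

theorem indec_cases {t : IsoType} (he : Elem t) (hi : Indec t) : dim t = 1 ∨
    (∃ S : QuatStr, S.IsLocalType ∧ Quotient.mk isoSetoid S = t) ∨ ∃ s, Elem s ∧ t = ext s := by
  induction t using Quotient.ind with | _ S
  refine (IsElementary.cases_of_indecomposable he hi).imp_right (Or.imp ?_ ?_)
  · exact fun ⟨T, h1, h2⟩ => ⟨T, h1, (mk_eq_iff.2 h2).symm⟩
  · exact fun ⟨T, h1, h2⟩ => ⟨Quotient.mk isoSetoid T, h1, mk_eq_iff.2 h2⟩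

theorem local_props {S : QuatStr} (h : S.IsLocalType) {t : IsoType}
    (ht : Quotient.mk isoSetoid S = t) : Prim t ∧ lrk t + 1 = dim t ∧ 3 ≤ dim t := by
  subst ht
  exact ⟨⟨.loc S h, h.2.1, h.indecomposable⟩, h.lrk_add_one, h.three_le_dim⟩

theorem setEΔ_succ (m : ℕ) : setEΔ (m + 1) = ext '' setE m := by
  have h : setEΔ (m + 1) = {t | Elem t ∧ dim t = m + 1 ∧ ∃ s, t = ext s} :=
    elemTypes_eq (p := fun t => ∃ s, t = ext s) fun S _ =>
      ⟨fun ⟨T, h⟩ => ⟨Quotient.mk isoSetoid T, mk_eq_iff.2 h⟩, fun ⟨s, hs⟩ => by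
        induction s using Quotient.ind with | _ T
        exact ⟨T, mk_eq_iff.1 hs⟩⟩
  rw [h, setE_eq]
  ext t
  constructor
  · rintro ⟨he, hd, s, rfl⟩
    have hs := elem_ext.1 he
    rw [dim_ext hs.fin] at hd
    exact ⟨s, ⟨hs, by omega, trivial⟩, rfl⟩
  · rintro ⟨s, ⟨hs, hd, -⟩, rfl⟩
    exact ⟨elem_ext.2 hs, by rw [dim_ext hs.fin, hd], s, rfl⟩

theorem eΔ_succ (m : ℕ) : eΔ (m + 1) = e m := by
  rw [eΔ, setEΔ_succ, e, setE_eq]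
  exact Set.InjOn.ncard_image fun s hs t _ h => ext_injective hs.1.fin h

theorem eK_eq_zero {k n : ℕ} (h : n ≤ k) (hk : 1 ≤ k) : eK k n = 0 := by
  have : setEk k n = ∅ := by
    refine Set.eq_empty_of_forall_notMem fun t ht => ?_
    obtain ⟨he, hd, hn, hl⟩ := mem_setEk.1 ht
    by_cases h1 : t = 1
    · rw [h1, lrk_one] at hl
      omega
    · have := lrk_lt_dim he.fin hn h1
      omega
  rw [eK, this, Set.ncard_empty]

theorem setEkInd_zero_succ {m : ℕ} (hm : 2 ≤ m) : setEkInd 0 (m + 1) = ext '' setEk 0 m := by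
  ext t
  rw [mem_setEkInd]
  constructor
  · rintro ⟨hp, hd, hl⟩
    rcases indec_cases hp.1 hp.2.2 with h | ⟨S, hS, h⟩ | ⟨s, hs, rfl⟩
    · omega
    · have := local_props hS h
      omega
    · rw [dim_ext hs.fin] at hd
      have h1 := ne_one_of_dim_pos (t := s) (by omega)
      rw [lrk_ext_eq_zero_iff hs.fin h1] at hl
      exact ⟨s, mem_setEk.2 ⟨hs, by omega, nondeg_of_lrk_eq_zero hs.fin hl, hl⟩, rfl⟩
  · rintro ⟨s, hs, rfl⟩
    obtain ⟨hs, hd, hn, hl⟩ := mem_setEk.1 hs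
    have h1 := ne_one_of_dim_pos (t := s) (by omega)
    exact ⟨⟨elem_ext.2 hs, nondeg_ext h1, indec_ext hs.fin (by omega)⟩,
      by rw [dim_ext hs.fin, hd], (lrk_ext_eq_zero_iff hs.fin h1).2 hl⟩

theorem eInd_zero_succ {m : ℕ} (hm : 2 ≤ m) : eInd 0 (m + 1) = eK 0 m := by
  rw [eInd, setEkInd_zero_succ hm, eK]
  exact Set.InjOn.ncard_image fun s hs t _ h => ext_injective (mem_setEk.1 hs).1.fin h

/-- Above order two, group extensions are nondegenerate and indecomposable with `lrk` at most 1.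
Conversely, an indecomposable type with such `lrk` is not local, because local types have `lrk` at
least 2. -/
theorem eΔ_eq_add {m : ℕ} (hm : 2 ≤ m) : eΔ (m + 1) = eInd 0 (m + 1) + eInd 1 (m + 1) := by
  have hU : setEΔ (m + 1) = setEkInd 0 (m + 1) ∪ setEkInd 1 (m + 1) := by
    rw [setEΔ_succ, setE_eq]
    ext t
    rw [Set.mem_union, mem_setEkInd, mem_setEkInd]
    constructor
    · rintro ⟨s, ⟨hs, hd, -⟩, rfl⟩
      have h1 := ne_one_of_dim_pos (t := s) (by omega)
      have hp : Prim (ext s) :=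
        ⟨elem_ext.2 hs, nondeg_ext h1, indec_ext hs.fin (by omega)⟩
      have hd' : dim (ext s) = m + 1 := by rw [dim_ext hs.fin, hd]
      have hl := lrk_ext_le hs.fin
      rcases Nat.eq_zero_or_pos (lrk (ext s)) with h0 | h0
      · exact Or.inl ⟨hp, hd', h0⟩
      · exact Or.inr ⟨hp, hd', by omega⟩
    · intro h
      have h' : Prim t ∧ dim t = m + 1 ∧ lrk t ≤ 1 :=
        h.elim (fun h => ⟨h.1, h.2.1, by omega⟩) fun h => ⟨h.1, h.2.1, by omega⟩
      obtain ⟨hp, hd, hl⟩ := h'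
      rcases indec_cases hp.1 hp.2.2 with h | ⟨S, hS, h⟩ | ⟨s, hs, rfl⟩
      · omega
      · have := local_props hS h
        omega
      · rw [dim_ext hs.fin] at hd
        exact ⟨s, ⟨hs, by omega, trivial⟩, rfl⟩
  rw [eΔ, hU, eInd, eInd]
  refine Set.ncard_union_eq ?_ (finite_setEkInd _ _) (finite_setEkInd _ _)
  rw [Set.disjoint_left]
  intro t h h'
  rw [mem_setEkInd] at h h'
  omega

/-- For `lrk` at least 2 group extensions are excluded, and only local types, with `lrk` equal to n
- 1, remain. -/
theorem eInd_of_two_le {k n : ℕ} (hn : 2 < n) (hk : 2 ≤ k) :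
    eInd k n = if k + 1 = n then (if Even n then 2 else 1) else 0 := by
  have key : ∀ t, t ∈ setEkInd k n ↔ k + 1 = n ∧
      ∃ S : QuatStr, S.IsLocalType ∧ S.dim = n ∧ Quotient.mk isoSetoid S = t := by
    intro t
    rw [mem_setEkInd]
    constructor
    · rintro ⟨hp, hd, hl⟩
      rcases indec_cases hp.1 hp.2.2 with h | ⟨S, hS, h⟩ | ⟨s, hs, rfl⟩
      · omega
      · have h1 := local_props hS h
        subst h
        exact ⟨by omega, S, hS, hd, rfl⟩
      · have := lrk_ext_le hs.fin
        omega
    · rintro ⟨hkn, S, hS, hd, rfl⟩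
      have h1 := local_props hS rfl
      have hd' : dim (Quotient.mk isoSetoid S) = n := hd
      exact ⟨h1.1, hd', by omega⟩
  split_ifs with h h'
  · have := ncard_localTypes (n := n) hn
    rw [if_pos h'] at this
    rw [← this, eInd]
    congr 1
    ext t
    rw [key]
    exact and_iff_right h
  · have := ncard_localTypes (n := n) hn
    rw [if_neg h'] at this
    rw [← this, eInd]
    congr 1
    ext t
    rw [key]
    exact and_iff_right h
  · rw [eInd, Set.eq_empty_of_forall_notMem fun t ht => h ((key t).1 ht).1, Set.ncard_empty]

/-! ### Orders at most two -/

/-- The type of the quaternionic structure of the real numbers. -/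
def l₁ : IsoType := Quotient.mk isoSetoid L1

theorem elem_l₁ : Elem l₁ := .l1
theorem nondeg_l₁ : Nondeg l₁ := L1_nondegenerate
theorem dim_l₁ : dim l₁ = 1 := dim_eq_of_card card_L1
theorem lrk_l₁ : lrk l₁ = 0 := L1_lrk
theorem ext_l₁ : ext l₁ = l₁ * l₁ := mk_eq_iff.2 L1_groupExt_iso

theorem dim_one_cases {t : IsoType} (ht : IsFin t) (hd : dim t = 1) :
    t = d₀ ∨ t = d₁ ∨ t = l₁ := by
  induction t using Quotient.ind with | _ S
  have : Finite S.G := ht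
  have hc := S.card_eq
  rw [show S.dim = 1 from hd, pow_one] at hc
  exact (iso_of_card_eq_two_cases hc).imp mk_eq_iff.2 (Or.imp mk_eq_iff.2 mk_eq_iff.2)

theorem eq_l₁ {t : IsoType} (ht : IsFin t) (hd : dim t = 1) (hn : Nondeg t) : t = l₁ := by
  rcases dim_one_cases ht hd with rfl | rfl | rfl
  · exact absurd hn not_nondeg_d₀
  · exact absurd hn not_nondeg_d₁
  · rfl

theorem indec_of_dim_eq_one {t : IsoType} (ht : IsFin t) (hd : dim t = 1) : Indec t := by
  induction t using Quotient.ind with | _ S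
  have : Finite S.G := ht
  have hc := S.card_eq
  rw [show S.dim = 1 from hd, pow_one] at hc
  exact indecomposable_of_card_eq_two hc

/-- Both factors have order one and are nondegenerate, and l₁ is the only such type. -/
theorem eq_l₁_mul_l₁ {t : IsoType} (he : Elem t) (hd : dim t = 2) (hn : Nondeg t)
    (hi : ¬ Indec t) : t = l₁ * l₁ := by
  rw [indec_iff, not_and] at hi
  have := hi (ne_one_of_dim_pos (by omega))
  push Not at this
  obtain ⟨s, u, rfl, hs, hu⟩ := this
  have hfs := fin_of_mul he.fin
  have hfu := fin_of_mul (mul_comm s u ▸ he.fin)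
  rw [dim_mul hfs hfu] at hd
  rw [nondeg_mul_iff] at hn
  rw [Ne, ← dim_eq_zero_iff hfs] at hs
  rw [Ne, ← dim_eq_zero_iff hfu] at hu
  rw [eq_l₁ hfs (by omega) hn.1, eq_l₁ hfu (by omega) hn.2]

theorem lrk_l₁_mul_l₁ : lrk (l₁ * l₁) = 0 := by
  rw [lrk_mul elem_l₁.fin elem_l₁.fin, lrk_l₁]

theorem dim_l₁_mul_l₁ : dim (l₁ * l₁) = 2 := by
  rw [dim_mul elem_l₁.fin elem_l₁.fin, dim_l₁]

/-- Indecomposability at order two follows from `lrk`: the only decomposable nondegenerate type of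
that order is l₁ * l₁, whose `lrk` is 0. -/
theorem ext_props {d : IsoType} (hd : Elem d) (h1 : dim d = 1) (h0 : lrk d ≠ 0) :
    Prim (ext d) ∧ dim (ext d) = 2 ∧ lrk (ext d) = 1 := by
  have h1' := ne_one_of_dim_pos (t := d) (by omega)
  have hl : lrk (ext d) = 1 := by
    have h2 := lrk_ext_le hd.fin
    have h3 := (lrk_ext_eq_zero_iff hd.fin h1').not.2 h0
    omega
  have hdim : dim (ext d) = 2 := by rw [dim_ext hd.fin, h1]
  refine ⟨⟨elem_ext.2 hd, nondeg_ext h1', ?_⟩, hdim, hl⟩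
  by_contra hi
  rw [eq_l₁_mul_l₁ (elem_ext.2 hd) hdim (nondeg_ext h1') hi, lrk_l₁_mul_l₁] at hl
  exact zero_ne_one hl

theorem dim_two_cases {t : IsoType} (he : Elem t) (hd : dim t = 2) (hn : Nondeg t) :
    t = l₁ * l₁ ∨ t = ext d₀ ∨ t = ext d₁ := by
  by_cases hi : Indec t
  · rcases indec_cases he hi with h | ⟨S, hS, h⟩ | ⟨s, hs, rfl⟩
    · omega
    · have := local_props hS h
      omega
    · rw [dim_ext hs.fin] at hd
      rcases dim_one_cases hs.fin (by omega) with rfl | rfl | rfl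
      · exact Or.inr (Or.inl rfl)
      · exact Or.inr (Or.inr rfl)
      · exact Or.inl ext_l₁
  · exact Or.inl (eq_l₁_mul_l₁ he hd hn hi)

theorem lrk_d₀ : lrk d₀ ≠ 0 := L10_lrk
theorem lrk_d₁ : lrk d₁ ≠ 0 := L11_lrk

theorem ext_d₀_ne : ext d₀ ≠ ext d₁ := fun h =>
  not_negOne_d₁ (ext_injective elem_d₀.fin h ▸ negOne_d₀)

theorem not_indec_l₁_mul_l₁ : ¬ Indec (l₁ * l₁) := fun h => by
  have h1 := ne_one_of_dim_pos (t := l₁) (by rw [dim_l₁]; exact one_pos)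
  exact ((indec_iff.1 h).2 _ _ rfl).elim h1 h1

theorem eInd_zero_zero : eInd 0 0 = 0 := by
  suffices h : setEkInd 0 0 = ∅ by rw [eInd, h, Set.ncard_empty]
  refine Set.eq_empty_of_forall_notMem fun t ht => ?_
  obtain ⟨hp, hd, -⟩ := mem_setEkInd.1 ht
  exact (indec_iff.1 hp.2.2).1 ((dim_eq_zero_iff hp.1.fin).1 hd)

theorem eInd_zero_one : eInd 0 1 = 1 := by
  rw [eInd, Set.ncard_eq_one]
  refine ⟨l₁, Set.eq_singleton_iff_unique_mem.2 ⟨mem_setEkInd.2 ⟨⟨elem_l₁, nondeg_l₁,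
    indec_of_dim_eq_one elem_l₁.fin dim_l₁⟩, dim_l₁, lrk_l₁⟩, fun t ht => ?_⟩⟩
  obtain ⟨hp, hd, -⟩ := mem_setEkInd.1 ht
  exact eq_l₁ hp.1.fin hd hp.2.1

theorem eInd_zero_two : eInd 0 2 = 0 := by
  suffices h : setEkInd 0 2 = ∅ by rw [eInd, h, Set.ncard_empty]
  refine Set.eq_empty_of_forall_notMem fun t ht => ?_
  obtain ⟨hp, hd, hl⟩ := mem_setEkInd.1 ht
  rcases dim_two_cases hp.1 hd hp.2.1 with rfl | rfl | rfl
  · exact not_indec_l₁_mul_l₁ hp.2.2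
  · rw [(ext_props elem_d₀ dim_d₀ lrk_d₀).2.2] at hl
    exact one_ne_zero hl
  · rw [(ext_props elem_d₁ dim_d₁ lrk_d₁).2.2] at hl
    exact one_ne_zero hl

theorem eK_zero_zero : eK 0 0 = 1 := by
  rw [eK, Set.ncard_eq_one]
  refine ⟨1, Set.eq_singleton_iff_unique_mem.2 ⟨mem_setEk.2 ⟨elem_one, dim_one, nondeg_one,
    lrk_one⟩, fun t ht => ?_⟩⟩
  obtain ⟨he, hd, -⟩ := mem_setEk.1 ht
  exact (dim_eq_zero_iff he.fin).1 hd

theorem eK_zero_one : eK 0 1 = 1 := by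
  rw [eK, Set.ncard_eq_one]
  refine ⟨l₁, Set.eq_singleton_iff_unique_mem.2 ⟨mem_setEk.2 ⟨elem_l₁, dim_l₁, nondeg_l₁,
    lrk_l₁⟩, fun t ht => ?_⟩⟩
  obtain ⟨he, hd, hn, -⟩ := mem_setEk.1 ht
  exact eq_l₁ he.fin hd hn

theorem eK_zero_two : eK 0 2 = 1 := by
  rw [eK, Set.ncard_eq_one]
  refine ⟨l₁ * l₁, Set.eq_singleton_iff_unique_mem.2 ⟨mem_setEk.2 ⟨elem_mul elem_l₁ elem_l₁,
    dim_l₁_mul_l₁, nondeg_mul_iff.2 ⟨nondeg_l₁, nondeg_l₁⟩, lrk_l₁_mul_l₁⟩, fun t ht => ?_⟩⟩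
  obtain ⟨he, hd, hn, hl⟩ := mem_setEk.1 ht
  rcases dim_two_cases he hd hn with rfl | rfl | rfl
  · rfl
  · rw [(ext_props elem_d₀ dim_d₀ lrk_d₀).2.2] at hl
    exact absurd hl one_ne_zero
  · rw [(ext_props elem_d₁ dim_d₁ lrk_d₁).2.2] at hl
    exact absurd hl one_ne_zero

theorem eInd_one_two : eInd 1 2 = 2 := by
  have : setEkInd 1 2 = {ext d₀, ext d₁} := by
    ext t
    rw [mem_setEkInd, Set.mem_insert_iff, Set.mem_singleton_iff]
    constructor
    · rintro ⟨hp, hd, -⟩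
      refine (dim_two_cases hp.1 hd hp.2.1).resolve_left ?_
      rintro rfl
      exact not_indec_l₁_mul_l₁ hp.2.2
    · rintro (rfl | rfl)
      · exact ext_props elem_d₀ dim_d₀ lrk_d₀
      · exact ext_props elem_d₁ dim_d₁ lrk_d₁
  rw [eInd, this, Set.ncard_pair ext_d₀_ne]

theorem eK_one_two : eK 1 2 = 2 := by
  rw [eK_one_eq_sum, Finset.Icc_self, Finset.sum_singleton, eInd_one_two, Nat.sub_self,
    eK_zero_zero]

end IsoType
end QuatStr

/-! ### Assembly of the counting formulas -/

theorem mainTheorem8 (k n : ℕ) :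
    (QuatStr.setE n).Finite ∧
    (2 ≤ n → (QuatStr.eD n : ℤ) =
      (QuatStr.e (n - 1) : ℤ) + (QuatStr.e' (n - 1) : ℤ) - (QuatStr.e' (n - 2) : ℤ)) ∧
    (2 < n → QuatStr.eΔ n = QuatStr.e (n - 1)) ∧
    (QuatStr.eK 0 0 = 1 ∧ QuatStr.eK 0 1 = 1 ∧ QuatStr.eK 0 2 = 1 ∧ QuatStr.eInd 0 1 = 1 ∧
      QuatStr.eInd 0 0 = 0 ∧ QuatStr.eInd 0 2 = 0 ∧
      QuatStr.eK 1 2 = 2 ∧ QuatStr.eInd 1 2 = 2) ∧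
    (n ≤ k → 1 ≤ k → QuatStr.eK k n = 0) ∧
    (2 < n →
      QuatStr.eInd 0 n = QuatStr.eK 0 (n - 1) ∧
      QuatStr.eK 0 n = ∑ m ∈ QuatStr.P 0 n, ∏ j : Fin n,
        Nat.choose (QuatStr.eInd 0 ((j : ℕ) + 1) + m 0 j - 1) (m 0 j)) ∧
    (2 < n →
      (QuatStr.eInd 1 n : ℤ) = (QuatStr.eΔ n : ℤ) - (QuatStr.eInd 0 n : ℤ) ∧
      QuatStr.eK 1 n = ∑ j ∈ Finset.Icc 2 n, QuatStr.eInd 1 j * QuatStr.eK 0 (n - j)) ∧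
    (2 < n → 2 ≤ k →
      QuatStr.eInd k n = (if k + 1 = n then (if Even n then 2 else 1) else 0) ∧
      QuatStr.eK k n = ∑ m ∈ QuatStr.P k n, ∏ i : Fin (k + 1), ∏ j : Fin n,
        Nat.choose (QuatStr.eInd (i : ℕ) ((j : ℕ) + 1) + m i j - 1) (m i j)) := by
  open QuatStr QuatStr.IsoType in
  refine ⟨?_, ?_, ?_, ⟨eK_zero_zero, eK_zero_one, eK_zero_two, eInd_zero_one, eInd_zero_zero,
    eInd_zero_two, eK_one_two, eInd_one_two⟩, eK_eq_zero, ?_, ?_, ?_⟩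
  · rw [setE_eq]
    exact finite_elem _ _
  · intro hn
    obtain ⟨m, rfl⟩ := Nat.exists_eq_add_of_le' hn
    have := ncard_setEd m
    rw [eD, e, e', e', Nat.add_sub_cancel, show m + 2 - 1 = m + 1 from rfl]
    omega
  · intro hn
    obtain ⟨m, rfl⟩ := Nat.exists_eq_add_of_lt hn
    exact eΔ_succ _
  · intro hn
    obtain ⟨m, rfl⟩ := Nat.exists_eq_add_of_lt hn
    refine ⟨eInd_zero_succ (by omega), ?_⟩
    rw [eK_eq_sum]
    refine Finset.sum_congr rfl fun p _ => ?_
    -- For k = 0 the matrices have the single row i = 0.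
    exact Fin.prod_univ_one _
  · intro hn
    refine ⟨?_, eK_one_eq_sum n⟩
    obtain ⟨m, rfl⟩ := Nat.exists_eq_add_of_lt hn
    rw [eΔ_eq_add (by omega)]
    push_cast
    ring
  · intro hn hk
    exact ⟨eInd_of_two_le hn hk, eK_eq_sum k n⟩
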